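/- Let $n\ge 2$ and let $K\subset\mathbb{R}^n$ be a convex body, i.e. a non-empty compact convex set (possibly with empty interior). Let $h(K,u)=\sup\{(x,u)\mid x\in K\}$ be its support function and $w(K,u)=h(K,u)+h(K,-u)$ its width function, and let $W_0(K),\dots,W_n(K)$ be its quermassintegrals, i.e. the real numbers determined by the Steiner formula $$\operatorname{vol}(\{x\in\mathbb{R}^n\mid d(x,K)\le\varepsilon\})=\sum_{k=0}^n\binom nk W_k(K)\,\varepsilon^k\qquad(\varepsilon\ge 0).$$ The norm of $K$ is $$N(K)=\frac12\int_{S^{n-1}}w(K,u)\,du,$$ where $du$ is the surface measure of the unit sphere $S^{n-1}$. Let $\gamma=\varphi([a,b])$ be a curve, where $\varphi:[a,b]\to\mathbb{R}^n$ is continuous, and let $\operatorname{length}(\gamma)\in[0,\infty]$ be the supremum of $\sum_{i=1}^m d(\varphi(t_{i-1}),\varphi(t_i))$ over all partitions $a=t_0<\dots<t_m=b$. If $K$ is contained in the convex hull of $\gamma$, then $$N(K)=nW_{n-1}(K)\le\frac{\pi^{\frac{n-1}{2}}}{2\,\Gamma\left(\frac{n+1}{2}\right)}\cdot\operatorname{length}(\gamma)+\frac{\pi^{\frac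 n2-1}}{\Gamma\left(\frac n2\right)}\cdot\operatorname{diam}(K).$$ -/

import Mathlib

open MeasureTheory

noncomputable section

namespace ConvexCover

variable {n : ℕ}

/-- The support function `h(K, u) = sup {(x, u) | x ∈ K}` of a convex body
(a nonempty compact convex set, possibly with empty interior). -/
def supportFunction (K : ConvexBody (EuclideanSpace ℝ (Fin n)))
    (u : EuclideanSpace ℝ (Fin n)) : ℝ :=
  sSup ((fun x : EuclideanSpace ℝ (Fin n) => inner ℝ x u) ''
    (K : Set (EuclideanSpace ℝ (Fin n))))

/-- The width function `w(K, u) = h(K, u) + h(K, -u)`. -/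
def widthFunction (K : ConvexBody (EuclideanSpace ℝ (Fin n)))
    (u : EuclideanSpace ℝ (Fin n)) : ℝ :=
  supportFunction K u + supportFunction K (-u)

/-- The norm `N(K)`: half the integral of the width function over the unit sphere with respect to
the surface measure (of total mass `n * vol (B^n)`). -/
def norm (K : ConvexBody (EuclideanSpace ℝ (Fin n))) : ℝ :=
  (1 / 2) * ∫ u : Metric.sphere (0 : EuclideanSpace ℝ (Fin n)) 1,
    widthFunction K u ∂(volume : Measure (EuclideanSpace ℝ (Fin n))).toSphere

/-- The outer parallel body of `K` at distance `ε`, the set of points at distance at most `ε`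
from `K`. -/
def outerParallelBody (K : ConvexBody (EuclideanSpace ℝ (Fin n))) (ε : ℝ) :
    Set (EuclideanSpace ℝ (Fin n)) :=
  Metric.cthickening ε (K : Set (EuclideanSpace ℝ (Fin n)))

/-- `W 0, …, W n` are the normalized coefficients in the Steiner formula of `K`; they are uniquely
determined, as a polynomial is determined by its values on `[0, ∞)`. -/
def SteinerFormula (K : ConvexBody (EuclideanSpace ℝ (Fin n))) (W : ℕ → ℝ) : Prop :=
  ∀ ε : ℝ, 0 ≤ ε →
    (volume : Measure (EuclideanSpace ℝ (Fin n))).real (outerParallelBody K ε) =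
      ∑ k ∈ Finset.range (n + 1), (n.choose k : ℝ) * W k * ε ^ k

open Classical in
/-- The quermassintegrals `W_0(K), …, W_n(K)`, defined as the coefficients in the Steiner formula.
(The values at indices above `n` carry no meaning.) -/
def quermassintegral (K : ConvexBody (EuclideanSpace ℝ (Fin n))) : ℕ → ℝ :=
  if h : ∃ W : ℕ → ℝ, SteinerFormula K W then h.choose else 0

end ConvexCover

end

open MeasureTheory

noncomputable section

namespace ConvexCover

/-! Since the surface measure is invariant under negation, `norm K` is the integral of the support
function h_K over the sphere. Averaging over the orthogonal group with its Haar measure turns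
integrals over great circles into integrals over the sphere (`exists_sphere_average`,
`integral_sphere_le_of_circle`), so the inequality reduces to the plane: for a finite X in the
convex hull of a polygonal path, the integral of h_X over the circle is at most the length of the
path plus diam X (`integral_planarSupport_le`). The constants are the mean of |⟨z, u⟩| over the
sphere and the area of the sphere. Finite nets of K and inscribed polygons of the curve give the
general case.

In the plane it suffices that the vertices of the path reach every supporting half-plane of X. Take
such a list with the fewest vertices and, among its reorderings, the shortest. Its vertices are then
strictly exposed and no two edges cross, so chords of an initial stretch miss chords of the
complementary final stretch (`disjoint_segment_of_isTwoOptimal`), and the directions won by the two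
stretches do not interleave. Hence there are a vertex q and a half circle of directions served by
the path up to q, while the opposite half circle is served by the path from q on
(`exists_half_turn`). On a half circle centred at c the integral of h_X is at most the length of its
stretch plus ⟨q, c⟩ + h_X(c) (`integral_half_le_pathLength`). In the sum of the two halves the terms
in q cancel, and h_X(c) + h_X(-c) is a width of X, hence at most the diameter.

The half-circle bound is Cauchy–Crofton: each projection of the path runs from one end over the
maximum to the other end. If the path starts beyond the supporting line of X in direction c, it is
cut at that line, and the piece before the cut is paid for by `integral_le_pathLength_of_re_nonpos`.

The Steiner formula is proved by approximating the ball by sums of segments. Adding a multiple t of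
a segment to a convex body changes the volume affinely in t, so adding t times such a sum changes it
polynomially, and polynomials of bounded degree are closed under pointwise limits. Finally, B + sK
has radial function 1 + s h_K + O(s²). Comparing the terms linear in s of its volume gives `norm K =
n * W (n - 1)`. -/

/-- The length of the polygonal path through the points of a list. -/
def pathLength {E : Type*} [NormedAddCommGroup E] : List E → ℝ
  | [] => 0
  | [_] => 0
  | x :: y :: l => ‖y - x‖ + pathLength (y :: l)

/-! ### Lengths of polygonal paths -/

section PathLength

variable {E : Type*} [NormedAddCommGroup E]

@[simp] lemma pathLength_nil : pathLength ([] : List E) = 0 := rfl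
@[simp] lemma pathLength_singleton (x : E) : pathLength [x] = 0 := rfl
@[simp] lemma pathLength_cons_cons (x y : E) (l : List E) :
    pathLength (x :: y :: l) = ‖y - x‖ + pathLength (y :: l) := rfl

lemma pathLength_nonneg (l : List E) : 0 ≤ pathLength l := by
  induction l with
  | nil => simp
  | cons x l ih =>
    cases l with
    | nil => simp
    | cons y l => simp only [pathLength_cons_cons]; positivity

lemma pathLength_append_cons (A : List E) (p : E) (D : List E) :
    pathLength (A ++ p :: D) = pathLength (A ++ [p]) + pathLength (p :: D) := by
  induction A with
  | nil => simp
  | cons x A ih =>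
    cases A with
    | nil => simp
    | cons y A =>
      simp only [List.cons_append, pathLength_cons_cons] at ih ⊢
      rw [ih]; ring

lemma pathLength_append_cons_cons (A : List E) (p q : E) (D : List E) :
    pathLength (A ++ p :: q :: D) = pathLength (A ++ [p]) + ‖q - p‖ + pathLength (q :: D) := by
  rw [pathLength_append_cons]; simp [add_assoc]

lemma pathLength_reverse (l : List E) : pathLength l.reverse = pathLength l := by
  induction l with
  | nil => simp
  | cons x l ih =>
    cases l with
    | nil => simp
    | cons y l =>
      simp only [List.reverse_cons, pathLength_cons_cons] at ih ⊢
      rw [List.append_assoc]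
      simp only [List.singleton_append]
      rw [pathLength_append_cons, ih, pathLength_cons_cons, pathLength_singleton, norm_sub_rev]
      ring

lemma pathLength_cons_le (x : E) (l : List E) : pathLength l ≤ pathLength (x :: l) := by
  cases l with
  | nil => simp
  | cons y l => simp

lemma pathLength_remove_le (A : List E) (p : E) (B : List E) :
    pathLength (A ++ B) ≤ pathLength (A ++ p :: B) := by
  induction A with
  | nil => exact pathLength_cons_le p B
  | cons x A ih =>
    cases A with
    | nil =>
      cases B with
      | nil => simp
      | cons y B =>
        simp only [List.cons_append, List.nil_append, pathLength_cons_cons]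
        have := norm_sub_le_norm_sub_add_norm_sub y p x
        linarith
    | cons y A =>
      simp only [List.cons_append, pathLength_cons_cons] at ih ⊢
      linarith

lemma norm_sub_le_pathLength {x : E} {l : List E} {y : E} (hy : y ∈ l) :
    ‖y - x‖ ≤ pathLength (x :: l) := by
  induction l generalizing x with
  | nil => simp at hy
  | cons z l ih =>
    rcases List.mem_cons.1 hy with rfl | h
    · simpa using pathLength_nonneg _
    · have := ih (x := z) h
      have := norm_sub_le_norm_sub_add_norm_sub y z x
      simp only [pathLength_cons_cons]; linarith

/-- A path starting at `x` that visits two points is at least as long as the path through these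
points in one of the two possible orders. -/
lemma pathLength_two_points {x : E} {l : List E} {y z : E} (hy : y ∈ x :: l) (hz : z ∈ x :: l) :
    ‖y - x‖ + ‖z - y‖ ≤ pathLength (x :: l) ∨ ‖z - x‖ + ‖y - z‖ ≤ pathLength (x :: l) := by
  induction l generalizing x with
  | nil => simp at hy hz; simp [hy, hz]
  | cons w l ih =>
    rcases List.mem_cons.1 hy with rfl | h
    · rcases List.mem_cons.1 hz with rfl | h'
      · left; simpa using pathLength_nonneg (z :: w :: l)
      · left; simpa using norm_sub_le_pathLength h'
    rcases List.mem_cons.1 hz with rfl | h'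
    · right; simpa using norm_sub_le_pathLength h
    have h1 := norm_sub_le_norm_sub_add_norm_sub y w x
    have h2 := norm_sub_le_norm_sub_add_norm_sub z w x
    rcases ih h h' with h | h
    · left; simp only [pathLength_cons_cons]; linarith
    · right; simp only [pathLength_cons_cons]; linarith

lemma pathLength_map_sub_const (l : List E) (z : E) :
    pathLength (l.map fun x : E => x - z) = pathLength l := by
  induction l with
  | nil => simp
  | cons x l ih =>
    cases l with
    | nil => simp
    | cons y l => simp only [List.map_cons, pathLength_cons_cons] at ih ⊢; rw [ih]; simp

end PathLength

/-- The variation of a real sequence that reaches the value `f m` on its way from `f a` to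
`f b`. -/
lemma two_mul_sub_le_pathLength {α : Type*} {f : α → ℝ} {A : List α} {b m a : α}
    (hm : m ∈ a :: (A ++ [b])) :
    2 * f m - f a - f b ≤ pathLength ((a :: (A ++ [b])).map f) := by
  induction A generalizing a with
  | nil =>
    simp only [List.nil_append, List.mem_cons, List.not_mem_nil, or_false] at hm
    simp only [List.nil_append, List.map_cons, List.map_nil, pathLength_cons_cons,
      pathLength_singleton, Real.norm_eq_abs, add_zero]
    rcases hm with rfl | rfl
    · linarith [neg_abs_le (f b - f m)]
    · linarith [le_abs_self (f m - f a)]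
  | cons c A ih =>
    rcases List.mem_cons.1 hm with rfl | h
    · have h1 := norm_sub_le_pathLength (x := f m) (l := (c :: A ++ [b]).map f) (y := f b)
        (by simp)
      rw [Real.norm_eq_abs] at h1
      simp only [List.map_cons]
      linarith [neg_abs_le (f b - f m)]
    · have h2 := ih (a := c) (by simpa using h)
      simp only [List.cons_append, List.map_cons, pathLength_cons_cons, Real.norm_eq_abs] at h2 ⊢
      linarith [le_abs_self (f c - f a)]


/-! ### Projections of the plane and Cauchy–Crofton integrals -/

/-- The coordinate of a point of the plane in the direction of angle `θ`. -/
def height (θ : ℝ) (p : ℂ) : ℝ := p.re * Real.cos θ + p.im * Real.sin θ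

lemma height_sub (θ : ℝ) (p q : ℂ) : height θ (p - q) = height θ p - height θ q := by
  simp [height]; ring

lemma height_smul (θ : ℝ) (c : ℝ) (p : ℂ) : height θ (c • p) = c * height θ p := by
  simp [height]; ring

lemma height_add (θ : ℝ) (p q : ℂ) : height θ (p + q) = height θ p + height θ q := by
  simp [height]; ring

lemma height_add_pi (θ : ℝ) (p : ℂ) : height (θ + Real.pi) p = -height θ p := by
  simp [height]; ring

lemma height_add_two_pi (θ : ℝ) (p : ℂ) : height (θ + 2 * Real.pi) p = height θ p := by
  simp [height]

@[fun_prop]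
lemma continuous_height (p : ℂ) : Continuous fun θ => height θ p := by
  unfold height; fun_prop

lemma height_le_norm (θ : ℝ) (p : ℂ) : height θ p ≤ ‖p‖ := by
  have h1 : height θ p ^ 2 ≤ ‖p‖ ^ 2 := by
    rw [Complex.sq_norm, Complex.normSq_apply]
    unfold height
    nlinarith [sq_nonneg (p.re * Real.sin θ - p.im * Real.cos θ), Real.sin_sq_add_cos_sq θ]
  exact (abs_le_of_sq_le_sq' h1 (norm_nonneg _)).2

/-- The coordinate in a direction rotated by `φ`. -/
lemma height_add_angle (θ φ : ℝ) (p : ℂ) :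
    height (θ + φ) p = height θ (p * Complex.exp (-(φ * Complex.I))) := by
  simp only [height, Complex.mul_re, Complex.mul_im, Complex.exp_re, Complex.exp_im]
  simp [Real.cos_add, Real.sin_add]; ring

lemma integral_height (p : ℂ) :
    ∫ θ in (-(Real.pi / 2))..(Real.pi / 2), height θ p = 2 * p.re := by
  unfold height
  rw [intervalIntegral.integral_add (by apply Continuous.intervalIntegrable; fun_prop)
    (by apply Continuous.intervalIntegrable; fun_prop)]
  simp; ring

lemma exists_height_eq (p : ℂ) : ∃ φ, ∀ θ, height θ p = ‖p‖ * Real.cos (θ - φ) := by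
  refine ⟨p.arg, fun θ => ?_⟩
  rw [Real.cos_sub, height]
  by_cases hp : p = 0
  · simp [hp]
  have h1 := Complex.norm_mul_cos_arg p
  have h2 := Complex.norm_mul_sin_arg p
  rw [← h1, ← h2]; 
  simp only [Complex.norm_mul_cos_arg, Complex.norm_mul_sin_arg]
  linear_combination -Real.cos θ * h1 - Real.sin θ * h2

lemma integral_abs_cos_period (a : ℝ) : ∫ θ in a..(a + Real.pi), |Real.cos θ| = 2 := by
  have hper : Function.Periodic (fun θ => |Real.cos θ|) Real.pi := by
    intro θ; simp [Real.cos_add_pi]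
  rw [hper.intervalIntegral_add_eq a (-(Real.pi / 2))]
  rw [show -(Real.pi / 2) + Real.pi = Real.pi / 2 by ring]
  rw [intervalIntegral.integral_congr (g := Real.cos)]
  · simp; norm_num
  · intro θ hθ
    rw [Set.uIcc_of_le (by linarith [Real.pi_pos])] at hθ
    exact abs_of_nonneg (Real.cos_nonneg_of_mem_Icc hθ)

/-- Cauchy–Crofton for one segment: the projection has length ‖p‖ |cos (θ - φ)|, and |cos| has
integral 2 over its period π. -/
lemma integral_abs_height (a : ℝ) (p : ℂ) :
    ∫ θ in a..(a + Real.pi), |height θ p| = 2 * ‖p‖ := by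
  obtain ⟨φ, hφ⟩ := exists_height_eq p
  simp_rw [hφ, abs_mul, abs_norm]
  rw [intervalIntegral.integral_const_mul, intervalIntegral.integral_comp_sub_right
    (fun θ => |Real.cos θ|), show a + Real.pi - φ = (a - φ) + Real.pi by ring,
    integral_abs_cos_period]
  ring

lemma continuous_pathLength_height (l : List ℂ) :
    Continuous fun θ => pathLength (l.map (height θ)) := by
  induction l with
  | nil => simp; fun_prop
  | cons x l ih =>
    cases l with
    | nil => simp; fun_prop
    | cons y l =>
      simp only [List.map_cons, pathLength_cons_cons, Real.norm_eq_abs] at ih ⊢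
      fun_prop

lemma integral_pathLength_height (a : ℝ) (l : List ℂ) :
    ∫ θ in a..(a + Real.pi), pathLength (l.map (height θ)) = 2 * pathLength l := by
  induction l with
  | nil => simp
  | cons x l ih =>
    cases l with
    | nil => simp
    | cons y l =>
      have hc := continuous_pathLength_height (y :: l)
      simp only [List.map_cons, pathLength_cons_cons, Real.norm_eq_abs] at ih hc ⊢
      rw [intervalIntegral.integral_add (by apply Continuous.intervalIntegrable; fun_prop)
        (hc.intervalIntegrable _ _), ih]
      simp_rw [← height_sub]
      rw [integral_abs_height]; ring

/-! ### Support functions of planar finite sets: the half-circle estimate -/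

/-- The support function of a finite set of points of the plane. -/
def planarSupport (X : Finset ℂ) (hX : X.Nonempty) (θ : ℝ) : ℝ := X.sup' hX (height θ)

@[fun_prop]
lemma continuous_planarSupport (X : Finset ℂ) (hX : X.Nonempty) :
    Continuous (planarSupport X hX) := by
  unfold planarSupport
  exact Continuous.finset_sup'_apply hX fun p _ => continuous_height p

lemma height_le_planarSupport {X : Finset ℂ} {hX : X.Nonempty} {p : ℂ} (hp : p ∈ X) (θ : ℝ) :
    height θ p ≤ planarSupport X hX θ := Finset.le_sup' (height θ) hp

lemma exists_height_eq_planarSupport (X : Finset ℂ) (hX : X.Nonempty) (θ : ℝ) :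
    ∃ p ∈ X, planarSupport X hX θ = height θ p := Finset.exists_mem_eq_sup' hX (height θ)

open Real in
/-- On a quarter of the circle, the part of the support function of a subset of the left half-plane
that is reached by a point of a list is controlled by one of these points. -/
lemma exists_integral_quarter_le {X : Finset ℂ} {hX : X.Nonempty} (hre : ∀ x ∈ X, x.re ≤ 0)
    {r : ℝ → ℝ} (hr : Continuous r) (D : List ℂ)
    (h1 : ∀ θ ∈ Set.Icc 0 (π / 2), (∀ d ∈ (0 : ℂ) :: D, height θ d < planarSupport X hX θ) → r θ ≤ 0)
    (h2 : ∀ θ, r θ ≤ max (planarSupport X hX θ) 0) :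
    ∃ c t : ℝ, 0 ≤ c ∧ c ≤ 1 ∧ t ^ 2 * (1 + c) = 1 - c ∧ ∃ d ∈ (0 : ℂ) :: D,
      ∫ θ in (0 : ℝ)..(π / 2), r θ ≤ d.re * (t * c) + d.im * (1 - c) := by
  have hpi := pi_pos
  -- The parameters c = 1, t = 0 make the right-hand side vanish.
  have trivial_case : (∫ θ in (0 : ℝ)..(π / 2), r θ ≤ 0) →
      ∃ c t : ℝ, 0 ≤ c ∧ c ≤ 1 ∧ t ^ 2 * (1 + c) = 1 - c ∧ ∃ d ∈ (0 : ℂ) :: D,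
      ∫ θ in (0 : ℝ)..(π / 2), r θ ≤ d.re * (t * c) + d.im * (1 - c) := fun h =>
    ⟨1, 0, by norm_num, by norm_num, by norm_num, 0, by simp, by simpa using h⟩
  set g := planarSupport X hX with hg
  have hgc : Continuous g := continuous_planarSupport X hX
  set S : Set ℝ := {θ | θ ∈ Set.Icc 0 (π / 2) ∧ ∃ d ∈ (0 : ℂ) :: D, g θ ≤ height θ d} with hS
  have hSc : IsCompact S := by
    refine isCompact_Icc.of_isClosed_subset ?_ (fun θ h => h.1)
    refine isClosed_Icc.inter ?_
    have : {θ | ∃ d ∈ (0 : ℂ) :: D, g θ ≤ height θ d}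
        = ⋃ d ∈ ((0 : ℂ) :: D).toFinset, {θ | g θ ≤ height θ d} := by
      ext θ; simp
    change IsClosed {θ | ∃ d ∈ (0 : ℂ) :: D, g θ ≤ height θ d}
    rw [this]
    exact isClosed_biUnion_finset fun d _ => isClosed_le hgc (continuous_height d)
  rcases S.eq_empty_or_nonempty with hE | hne
  · apply trivial_case
    rw [← neg_nonneg, ← intervalIntegral.integral_neg]
    refine intervalIntegral.integral_nonneg (by positivity) fun θ hθ => ?_
    rw [neg_nonneg]
    refine h1 θ hθ fun d hd => ?_
    by_contra hcon
    have : θ ∈ S := ⟨hθ, d, hd, not_lt.1 hcon⟩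
    rw [hE] at this; exact this
  -- θ₁ is the last angle at which the list reaches the supporting half-plane of X; the integrand is
  -- nonpositive after it.
  obtain ⟨θ₁, ⟨⟨h0, hle⟩, d, hd, hgd⟩, hmax⟩ := hSc.exists_isGreatest hne
  have hafter : ∀ θ, θ₁ < θ → θ ≤ π / 2 → r θ ≤ 0 := by
    intro θ hθ hθ'
    refine h1 θ ⟨by linarith, hθ'⟩ fun d hd => ?_
    by_contra hcon
    exact absurd (hmax ⟨⟨by linarith, hθ'⟩, d, hd, not_lt.1 hcon⟩) (not_le.2 hθ)
  have hint : ∀ a b, IntervalIntegrable r volume a b := fun a b => hr.intervalIntegrable a b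
  have hsplit := intervalIntegral.integral_add_adjacent_intervals (hint 0 θ₁) (hint θ₁ (π / 2))
  have hsecond : ∫ θ in θ₁..(π / 2), r θ ≤ 0 := by
    have : ∫ θ in θ₁..(π / 2), r θ ≤ ∫ θ in θ₁..(π / 2), (0 : ℝ) := by
      refine intervalIntegral.integral_mono_on_of_le_Ioo hle (hint _ _) (by simp) ?_
      intro θ hθ
      exact hafter θ hθ.1 hθ.2.le
    simpa using this
  rcases h0.eq_or_lt with h00 | hpos
  · apply trivial_case
    rw [← hsplit, ← h00]; rw [← h00] at hsecond; simpa using hsecond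
  have hsin : 0 < sin θ₁ := sin_pos_of_pos_of_lt_pi hpos (by linarith)
  -- For a point x of the left half-plane, `height θ x / sin θ` = x.re cot θ + x.im is nondecreasing
  -- in θ.
  have hmono : ∀ θ ∈ Set.Icc 0 θ₁, g θ ≤ sin θ / sin θ₁ * g θ₁ := by
    intro θ hθ
    obtain ⟨x, hx, hxe⟩ := exists_height_eq_planarSupport X hX θ
    have h3 := height_le_planarSupport (hX := hX) hx θ₁
    have hs : 0 ≤ sin θ := sin_nonneg_of_nonneg_of_le_pi hθ.1 (by linarith [hθ.2])
    have hs' : 0 ≤ sin (θ₁ - θ) :=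
      sin_nonneg_of_nonneg_of_le_pi (by linarith [hθ.2]) (by linarith [hθ.1])
    rw [div_mul_eq_mul_div, le_div_iff₀ hsin]
    calc g θ * sin θ₁ = height θ x * sin θ₁ := by rw [hg, hxe]
      _ ≤ sin θ * height θ₁ x := by
        rw [sin_sub] at hs'
        unfold height
        nlinarith [hre x hx]
      _ ≤ sin θ * g θ₁ := mul_le_mul_of_nonneg_left h3 hs
  have hfirst : ∫ θ in (0 : ℝ)..θ₁, r θ ≤ (1 - cos θ₁) / sin θ₁ * max (g θ₁) 0 := by
    have : ∫ θ in (0 : ℝ)..θ₁, r θ ≤ ∫ θ in (0 : ℝ)..θ₁, sin θ * (max (g θ₁) 0 / sin θ₁) := by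
      refine intervalIntegral.integral_mono_on h0 (hint _ _)
        (by apply Continuous.intervalIntegrable; fun_prop) fun θ hθ => ?_
      have hs : 0 ≤ sin θ := sin_nonneg_of_nonneg_of_le_pi hθ.1 (by linarith [hθ.2])
      refine (h2 θ).trans (max_le ?_ (by positivity))
      refine (hmono θ hθ).trans ?_
      rw [div_mul_eq_mul_div, mul_div_assoc]
      gcongr
      exact le_max_left _ _
    rw [intervalIntegral.integral_mul_const, integral_sin] at this
    simp only [cos_zero] at this
    calc _ ≤ _ := this
      _ = _ := by ring
  rcases le_total (g θ₁) 0 with hneg | hnn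
  · apply trivial_case
    rw [max_eq_right hneg] at hfirst
    linarith
  rw [max_eq_left hnn] at hfirst
  have hcos : 0 ≤ cos θ₁ := cos_nonneg_of_mem_Icc ⟨by linarith, hle⟩
  have hsq := sin_sq_add_cos_sq θ₁
  -- c = cos θ₁ and t = tan (θ₁ / 2), so that t · `height θ₁ d` is the inner product of d with (t c,
  -- 1 - c).
  refine ⟨cos θ₁, (1 - cos θ₁) / sin θ₁, hcos, cos_le_one _, ?_, d, hd, ?_⟩
  · rw [div_pow, div_mul_eq_mul_div, div_eq_iff (by positivity)]
    linear_combination (1 - cos θ₁) * (-hsq)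
  · calc ∫ θ in (0 : ℝ)..(π / 2), r θ ≤ (1 - cos θ₁) / sin θ₁ * g θ₁ := by linarith
      _ ≤ (1 - cos θ₁) / sin θ₁ * height θ₁ d := by
        have := cos_le_one θ₁
        gcongr
      _ = _ := by unfold height; field_simp

lemma re_mul_add_im_mul_le_norm {α β : ℝ} (h : α ^ 2 + β ^ 2 ≤ 1) (a : ℂ) :
    a.re * α + a.im * β ≤ ‖a‖ := by
  have h1 : (a.re * α + a.im * β) ^ 2 ≤ ‖a‖ ^ 2 := by
    rw [Complex.sq_norm, Complex.normSq_apply]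
    nlinarith [sq_nonneg (a.re * β - a.im * α), mul_self_nonneg a.re, mul_self_nonneg a.im]
  exact (abs_le_of_sq_le_sq' h1 (norm_nonneg _)).2

lemma height_conj (θ : ℝ) (p : ℂ) : height θ (starRingEnd ℂ p) = height (-θ) p := by
  simp [height]

open Real in
/-- A path starting at the origin is at least as long as the integral of the part of the support
function of a subset of the left half-plane that is reached by the path only. -/
lemma integral_le_pathLength_of_re_nonpos {X : Finset ℂ} {hX : X.Nonempty}
    (hre : ∀ x ∈ X, x.re ≤ 0) {r : ℝ → ℝ} (hr : Continuous r) (D : List ℂ)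
    (h1 : ∀ θ ∈ Set.Icc (-(π / 2)) (π / 2),
      (∀ d ∈ (0 : ℂ) :: D, height θ d < planarSupport X hX θ) → r θ ≤ 0)
    (h2 : ∀ θ, r θ ≤ max (planarSupport X hX θ) 0) :
    ∫ θ in (-(π / 2))..(π / 2), r θ ≤ pathLength ((0 : ℂ) :: D) := by
  classical
  have hpi := pi_pos
  have hX' : (X.image (starRingEnd ℂ)).Nonempty := hX.image _
  -- Complex conjugation turns the quarter [-π/2, 0] into the quarter [0, π/2].
  have hconj : ∀ θ, planarSupport (X.image (starRingEnd ℂ)) hX' θ = planarSupport X hX (-θ) := by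
    intro θ
    simp only [planarSupport, Finset.sup'_image]
    exact Finset.sup'_congr hX rfl fun x _ => height_conj θ x
  obtain ⟨c, t, hc0, hc1, ht, d, hd, hint⟩ := exists_integral_quarter_le (hX := hX) hre hr D
    (fun θ hθ => h1 θ ⟨by linarith [hθ.1], hθ.2⟩) h2
  obtain ⟨c', t', hc0', hc1', ht', d', hd', hint'⟩ :=
    exists_integral_quarter_le (X := X.image (starRingEnd ℂ)) (hX := hX') (r := fun θ => r (-θ))
    (by simpa using hre) (by fun_prop) (D.map (starRingEnd ℂ))
    (fun θ hθ h => h1 (-θ) ⟨by linarith [hθ.2], by linarith [hθ.1]⟩ fun d hd => by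
      have := h (starRingEnd ℂ d) (by
        rcases List.mem_cons.1 hd with rfl | hd
        · simp
        · exact List.mem_cons_of_mem _ (List.mem_map_of_mem hd))
      rwa [hconj, height_conj] at this)
    (fun θ => by rw [hconj]; exact h2 (-θ))
  rw [intervalIntegral.integral_comp_neg, neg_zero] at hint'
  have hd'' : starRingEnd ℂ d' ∈ (0 : ℂ) :: D := by
    rcases List.mem_cons.1 hd' with rfl | h
    · simp
    · obtain ⟨e, he, rfl⟩ := List.mem_map.1 h
      simpa using Or.inr he
  have hsplit := intervalIntegral.integral_add_adjacent_intervals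
    (hr.intervalIntegrable (μ := volume) (-(π / 2)) 0) (hr.intervalIntegrable 0 (π / 2))
  -- After multiplication by 1 + c this is 2c ≤ 1 + c, up to the factor c (1 - c).
  have key1 : ∀ {c t : ℝ}, 0 ≤ c → c ≤ 1 → t ^ 2 * (1 + c) = 1 - c →
      2 * (t * c) ^ 2 ≤ c * (1 - c) := by
    intro c t h0 h1 h
    have h3 : 2 * (t * c) ^ 2 * (1 + c) ≤ c * (1 - c) * (1 + c) := by
      have : 2 * (t * c) ^ 2 * (1 + c) = 2 * c ^ 2 * (1 - c) := by rw [← h]; ring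
      rw [this]; nlinarith [mul_nonneg h0 (mul_nonneg (sub_nonneg.2 h1) (sub_nonneg.2 h1))]
    exact le_of_mul_le_mul_right h3 (by linarith)
  have k1 := key1 hc0 hc1 ht
  have k2 := key1 hc0' hc1' ht'
  have hU : (t * c) ^ 2 + (1 - c) ^ 2 ≤ 1 := by nlinarith
  have hW : (t' * c') ^ 2 + (-(1 - c')) ^ 2 ≤ 1 := by nlinarith
  -- With (a + b)² ≤ 2a² + 2b² and `key1` the left side is at most c + c' - 2cc', and 1 - c - c' +
  -- 2cc' = (1 - c)(1 - c') + cc'.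
  have hUW : (t * c + t' * c') ^ 2 + ((1 - c) + (-(1 - c'))) ^ 2 ≤ 1 := by
    nlinarith [sq_nonneg (t * c - t' * c'), mul_nonneg hc0 hc0',
      mul_nonneg (sub_nonneg.2 hc1) (sub_nonneg.2 hc1')]
  set e := starRingEnd ℂ d' with he
  have hde : d'.re * (t' * c') + d'.im * (1 - c') = e.re * (t' * c') + e.im * (-(1 - c')) := by
    simp only [he, Complex.conj_re, Complex.conj_im]; ring
  rw [hde] at hint'
  rcases pathLength_two_points hd hd'' with h | h
  -- Summation by parts: with U, W the two coefficient vectors, ⟨d, U⟩ + ⟨e, W⟩ = ⟨d, U + W⟩ + ⟨e -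
  -- d, W⟩, and both coefficient vectors on the right have norm at most 1. The other order of visit
  -- uses U + W and U.
  · have e1 := re_mul_add_im_mul_le_norm hUW (d - 0)
    have e2 := re_mul_add_im_mul_le_norm hW (e - d)
    simp only [sub_zero, Complex.sub_re, Complex.sub_im] at e1 e2 h
    linarith
  · have e1 := re_mul_add_im_mul_le_norm hUW (e - 0)
    have e2 := re_mul_add_im_mul_le_norm hU (d - e)
    simp only [sub_zero, Complex.sub_re, Complex.sub_im] at e1 e2 h
    linarith

-- In direction θ the projected path runs from z over the maximum to q, so its variation is at least
-- 2h_M - `height θ z` - `height θ q`. Integrating over the half circle turns variation into twice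
-- the length and each height into twice the real part.
open Real in
lemma integral_planarSupport_le_pathLength (z : ℂ) (B : List ℂ) (q : ℂ) {M : Finset ℂ}
    {hM : M.Nonempty} (h : ∀ p, p ∈ M ↔ p ∈ z :: (B ++ [q])) :
    (∫ θ in (-(π / 2))..(π / 2), planarSupport M hM θ) - z.re - q.re
      ≤ pathLength (z :: (B ++ [q])) := by
  have hint : ∀ a b, IntervalIntegrable (planarSupport M hM) volume a b :=
    fun a b => (continuous_planarSupport M hM).intervalIntegrable a b
  have hz : ∀ p a b, IntervalIntegrable (fun θ => height θ p) volume a b :=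
    fun p a b => (continuous_height p).intervalIntegrable a b
  have h1 := integral_pathLength_height (-(π / 2)) (z :: (B ++ [q]))
  rw [show -(π / 2) + π = π / 2 by ring] at h1
  have h2 : ∫ θ in (-(π / 2))..(π / 2),
      (2 * planarSupport M hM θ - height θ z - height θ q) ≤
      ∫ θ in (-(π / 2))..(π / 2), pathLength ((z :: (B ++ [q])).map (height θ)) := by
    refine intervalIntegral.integral_mono_on (by linarith [pi_pos])
      ((((hint _ _).const_mul 2).sub (hz _ _ _)).sub (hz _ _ _))
      ((continuous_pathLength_height _).intervalIntegrable _ _) fun θ _ => ?_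
    obtain ⟨p, hp, hpe⟩ := exists_height_eq_planarSupport M hM θ
    rw [hpe]
    exact two_mul_sub_le_pathLength ((h p).1 hp)
  rw [h1, intervalIntegral.integral_sub (((hint _ _).const_mul 2).sub (hz _ _ _)) (hz _ _ _),
    intervalIntegral.integral_sub ((hint _ _).const_mul 2) (hz _ _ _),
    intervalIntegral.integral_const_mul, integral_height, integral_height] at h2
  linarith

lemma planarSupport_image_sub (X : Finset ℂ) (hX : X.Nonempty) (z : ℂ) (θ : ℝ) :
    planarSupport (X.image fun x => x - z) (hX.image _) θ = planarSupport X hX θ - height θ z := by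
  obtain ⟨p, hp, hpe⟩ := exists_height_eq_planarSupport X hX θ
  apply le_antisymm
  · refine Finset.sup'_le _ _ fun y hy => ?_
    obtain ⟨x, hx, rfl⟩ := Finset.mem_image.1 hy
    rw [height_sub]
    linarith [height_le_planarSupport (hX := hX) hx θ]
  · rw [hpe, ← height_sub]
    exact height_le_planarSupport (Finset.mem_image_of_mem (fun x => x - z) hp) θ

-- The stretch z, B, q pays for its own support function h_M by Cauchy–Crofton. What remains, h_X -
-- h_M, is positive only in directions served by D alone; seen from z it is bounded by h_X and paid
-- for by the path z, D.
open Real in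
lemma integral_sub_le_of_split {X : Finset ℂ} {hX : X.Nonempty} {z q : ℂ} {D B : List ℂ}
    (hz : D = [] ∨ ∀ x ∈ X, x.re ≤ z.re)
    (hcov : ∀ θ ∈ Set.Icc (-(π / 2)) (π / 2), ∃ p ∈ D ++ z :: (B ++ [q]),
      planarSupport X hX θ ≤ height θ p) :
    (∫ θ in (-(π / 2))..(π / 2), planarSupport X hX θ) - z.re ≤
      pathLength (z :: D) + pathLength (z :: (B ++ [q])) + q.re := by
  classical
  set M : Finset ℂ := (z :: (B ++ [q])).toFinset with hMdef
  have hmem : ∀ p, p ∈ M ↔ p ∈ z :: (B ++ [q]) := fun p => List.mem_toFinset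
  have hM : M.Nonempty := ⟨z, (hmem z).2 (by simp)⟩
  have h1 := integral_planarSupport_le_pathLength z B q (hM := hM) hmem
  have hgi : ∀ a b, IntervalIntegrable (planarSupport X hX) volume a b :=
    fun a b => (continuous_planarSupport X hX).intervalIntegrable a b
  have hmi : ∀ a b, IntervalIntegrable (planarSupport M hM) volume a b :=
    fun a b => (continuous_planarSupport M hM).intervalIntegrable a b
  rcases hz with rfl | hz
  · have : ∫ θ in (-(π / 2))..(π / 2), planarSupport X hX θ ≤
        ∫ θ in (-(π / 2))..(π / 2), planarSupport M hM θ := by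
      refine intervalIntegral.integral_mono_on (by linarith [pi_pos]) (hgi _ _) (hmi _ _)
        fun θ hθ => ?_
      obtain ⟨p, hp, h⟩ := hcov θ hθ
      exact h.trans (height_le_planarSupport ((hmem p).2 hp) θ)
    simp only [pathLength_singleton]; linarith
  · have h2 := integral_le_pathLength_of_re_nonpos (X := X.image fun x => x - z)
      (hX := hX.image _) (r := fun θ => planarSupport X hX θ - planarSupport M hM θ)
      (by simpa using hz) (by fun_prop) (D.map fun x => x - z)
      (fun θ hθ h => by
        obtain ⟨p, hp, hpe⟩ := hcov θ hθ
        rw [planarSupport_image_sub X hX] at h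
        rcases List.mem_append.1 hp with hp | hp
        · have := h (p - z) (List.mem_cons_of_mem _ (List.mem_map_of_mem (f := fun x => x - z) hp))
          rw [height_sub] at this; linarith
        · have := height_le_planarSupport (hX := hM) ((hmem p).2 hp) θ
          linarith)
      (fun θ => by
        have := height_le_planarSupport (hX := hM) ((hmem z).2 (by simp)) θ
        rw [planarSupport_image_sub X hX]
        exact le_max_of_le_left (by linarith))
    have h3 := pathLength_map_sub_const (z :: D) z
    simp only [List.map_cons, sub_self] at h3
    rw [h3, intervalIntegral.integral_sub (hgi _ _) (hmi _ _)] at h2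
    linarith

/-- In a list starting with an element that satisfies `P` and containing an element that does not,
two consecutive elements witness the change. -/
lemma exists_consecutive {α : Type*} {P : α → Prop} {x : α} {l : List α} (hx : P x)
    (h : ∃ y ∈ x :: l, ¬ P y) : ∃ A a b B, x :: l = A ++ a :: b :: B ∧ P a ∧ ¬ P b := by
  induction l generalizing x with
  | nil => simp at h; exact absurd hx h
  | cons z l ih =>
    by_cases hz : P z
    · obtain ⟨y, hy, hPy⟩ := h
      have hy' : y ∈ z :: l := by
        rcases List.mem_cons.1 hy with rfl | h
        · exact absurd hx hPy
        · exact h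
      obtain ⟨A, a, b, B, hl, ha, hb⟩ := ih hz ⟨y, hy', hPy⟩
      exact ⟨x :: A, a, b, B, by rw [hl]; rfl, ha, hb⟩
    · exact ⟨[], x, z, l, rfl, hx, hz⟩

open Real in
/-- A path that reaches all the supporting half-planes of a finite set in the directions of a
half-circle. -/
lemma integral_half_le_pathLength {X : Finset ℂ} {hX : X.Nonempty} {A : List ℂ} {q : ℂ}
    (hcov : ∀ θ ∈ Set.Icc (-(π / 2)) (π / 2), ∃ p ∈ A ++ [q],
      planarSupport X hX θ ≤ height θ p) :
    (∫ θ in (-(π / 2))..(π / 2), planarSupport X hX θ) ≤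
      pathLength (A ++ [q]) + q.re + planarSupport X hX 0 := by
  set α := planarSupport X hX 0 with hα
  have hre : ∀ x ∈ X, x.re ≤ α := fun x hx => by
    simpa [height] using height_le_planarSupport (hX := hX) hx 0
  obtain ⟨e, l, hl⟩ : ∃ e l, A ++ [q] = e :: l := by
    cases A with
    | nil => exact ⟨q, [], rfl⟩
    | cons a A => exact ⟨a, A ++ [q], rfl⟩
  by_cases he : e.re ≤ α
  -- The path starts on the side of the supporting line that contains X: no cut is needed.
  · have := integral_sub_le_of_split (X := X) (hX := hX) (z := e) (q := q) (D := [])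
      (B := l.dropLast) (Or.inl rfl) (fun θ hθ => by
        obtain ⟨p, hp, h⟩ := hcov θ hθ
        refine ⟨p, ?_, h⟩
        cases A with
        | nil => simp at hl hp; simp [hp]
        | cons a A => 
          simp at hl
          obtain ⟨rfl, rfl⟩ := hl
          simpa using hp)
    cases A with
    | nil => 
      simp at hl
      obtain ⟨rfl, rfl⟩ := hl
      simp at this ⊢; linarith
    | cons a A => 
      simp at hl
      obtain ⟨rfl, rfl⟩ := hl
      simp at this ⊢; linarith
  push Not at he
  by_cases hall : ∀ p ∈ e :: l, α < p.re
  -- The whole path lies beyond the supporting line. It is run backwards from the foot z of the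
  -- perpendicular from q to that line; the extra edge costs q.re - α.
  · set z : ℂ := ⟨α, q.im⟩ with hz
    have h := integral_sub_le_of_split (X := X) (hX := hX) (z := z) (q := z) (B := [])
      (D := (A ++ [q]).reverse) (Or.inr hre) (fun θ hθ => by
        obtain ⟨p, hp, h⟩ := hcov θ hθ
        exact ⟨p, List.mem_append_left _ (List.mem_reverse.2 hp), h⟩)
    have hlen : pathLength (z :: (A ++ [q]).reverse) = (q.re - α) + pathLength (A ++ [q]) := by
      rw [List.reverse_append]
      simp only [List.reverse_singleton, List.singleton_append, pathLength_cons_cons]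
      rw [← pathLength_reverse (A ++ [q])]
      simp only [List.reverse_append, List.reverse_singleton, List.singleton_append]
      congr 1
      have h1 : q - z = ((q.re - α : ℝ) : ℂ) := by
        apply Complex.ext <;> simp [hz]
      have h2 := hall q (by rw [← hl]; simp)
      rw [h1, Complex.norm_real, Real.norm_of_nonneg (by linarith)]
    rw [hlen] at h
    simp only [List.nil_append, pathLength_cons_cons, pathLength_singleton, sub_self,
      norm_zero] at h
    simp only [hz] at h
    linarith
  push Not at hall
  obtain ⟨A₁, p, p', B₁, hs, hp, hp'⟩ := exists_consecutive (P := fun p : ℂ => α < p.re) he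
    (by simpa using hall)
  push Not at hp'
  -- The edge from p to p' crosses the supporting line; z is the crossing point, and the two pieces
  -- of the path start there.
  set t : ℝ := (p.re - α) / (p.re - p'.re) with ht
  have hd : 0 < p.re - p'.re := by linarith
  have ht0 : 0 ≤ t := div_nonneg (by linarith) hd.le
  have ht1 : t ≤ 1 := by rw [ht, div_le_one hd]; linarith
  set z : ℂ := p + t • (p' - p) with hz
  have hzre : z.re = α := by
    rw [hz]
    simp only [Complex.add_re, Complex.real_smul, Complex.re_ofReal_mul, Complex.sub_re]
    rw [ht]
    field_simp
    ring
  obtain ⟨B, hB⟩ : ∃ B, p' :: B₁ = B ++ [q] := by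
    have h1 : (A₁ ++ p :: p' :: B₁).getLast (by simp) = q := by
      simp [← hs, ← hl]
    refine ⟨(p' :: B₁).dropLast, ?_⟩
    conv_lhs => rw [← List.dropLast_append_getLast (l := p' :: B₁) (by simp)]
    rw [← h1]
    simp
  have h := integral_sub_le_of_split (X := X) (hX := hX) (z := z) (q := q) (B := B)
    (D := (A₁ ++ [p]).reverse) (Or.inr (by rw [hzre]; exact hre)) (fun θ hθ => by
      obtain ⟨y, hy, h⟩ := hcov θ hθ
      refine ⟨y, ?_, h⟩
      rw [← hB]
      rw [hl, hs] at hy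
      simp at hy ⊢
      tauto)
  rw [hl, hs, pathLength_append_cons_cons]
  rw [← hB, pathLength_cons_cons] at h
  have hlen : pathLength (z :: (A₁ ++ [p]).reverse) = ‖p - z‖ + pathLength (A₁ ++ [p]) := by
    rw [← pathLength_reverse (A₁ ++ [p])]
    simp
  have hn : ‖p - z‖ + ‖p' - z‖ = ‖p' - p‖ := by
    have e1 : p - z = -(t • (p' - p)) := by rw [hz]; ring
    have e2 : p' - z = (1 - t) • (p' - p) := by rw [hz]; simp [Complex.real_smul]; ring
    rw [e1, e2, norm_neg, norm_smul, norm_smul, Real.norm_of_nonneg ht0,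
      Real.norm_of_nonneg (by linarith)]
    ring
  rw [hlen] at h
  linarith

/-! ### Shortest covering lists have no crossings -/

/-- Every element of the set is the unique maximizer of some linear functional on the set. -/
def IsStrictlyExposed (S : Set ℂ) : Prop :=
  ∀ p ∈ S, ∃ θ, ∀ q ∈ S, q ≠ p → height θ q < height θ p

/-- No uncrossing of two edges of the polygonal path shortens it. -/
def IsTwoOptimal (l : List ℂ) : Prop :=
  ∀ A p p' B q q' D, l = A ++ p :: p' :: B ++ q :: q' :: D →
    ‖p' - p‖ + ‖q' - q‖ ≤ ‖q - p‖ + ‖q' - p'‖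

/-- Reversing the stretch between two edges leaves its length unchanged and replaces only these two
edges. -/
lemma pathLength_uncross (A : List ℂ) (p p' : ℂ) (B : List ℂ) (q q' : ℂ) (D : List ℂ) :
    pathLength (A ++ p :: p' :: B ++ q :: q' :: D) + (‖q - p‖ + ‖q' - p'‖) =
    pathLength (A ++ p :: (p' :: B ++ [q]).reverse ++ q' :: D) + (‖p' - p‖ + ‖q' - q‖) := by
  have h1 : pathLength (A ++ p :: p' :: B ++ q :: q' :: D) =
      pathLength (A ++ [p]) + ‖p' - p‖ + pathLength (p' :: B ++ [q]) + ‖q' - q‖ +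
        pathLength (q' :: D) := by
    rw [List.append_assoc, List.cons_append, List.cons_append, pathLength_append_cons_cons,
      ← List.cons_append, pathLength_append_cons_cons]
    ring
  have h2 : pathLength (A ++ p :: (p' :: B ++ [q]).reverse ++ q' :: D) =
      pathLength (A ++ [p]) + ‖q - p‖ + pathLength (p' :: B ++ [q]) + ‖q' - p'‖ +
        pathLength (q' :: D) := by
    have h3 : (p' :: B ++ [q]).reverse = q :: (B.reverse ++ [p']) := by simp
    have h4 : pathLength (p' :: B ++ [q]) = pathLength (q :: B.reverse ++ [p']) := by
      rw [← pathLength_reverse, h3]; rfl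
    rw [h4, h3, List.append_assoc, List.cons_append, List.cons_append,
      pathLength_append_cons_cons, List.append_assoc, List.singleton_append, ← List.cons_append,
      pathLength_append_cons_cons]
    ring
  rw [h1, h2]; ring

/-- The minimal number of vertices makes each vertex indispensable, hence the strict winner in some
direction; minimal length among the permutations makes every uncrossing useless. -/
lemma exists_optimal_cover {g : ℝ → ℝ} {l : List ℂ}
    (hl : ∀ θ, ∃ p ∈ l, g θ ≤ height θ p) :
    ∃ m : List ℂ, (∀ θ, ∃ p ∈ m, g θ ≤ height θ p) ∧ pathLength m ≤ pathLength l ∧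
      m.Nodup ∧ IsStrictlyExposed {p | p ∈ m} ∧ IsTwoOptimal m := by
  classical
  have hex : ∃ k, ∃ m : List ℂ, (∀ θ, ∃ p ∈ m, g θ ≤ height θ p) ∧ pathLength m ≤ pathLength l ∧
      m.length = k := ⟨_, l, hl, le_rfl, rfl⟩
  obtain ⟨m₀, hc₀, hL₀, hk₀⟩ := Nat.find_spec hex
  obtain ⟨m, hm, hmin⟩ := m₀.permutations.toFinset.exists_min_image pathLength
    ⟨m₀, by simp⟩
  simp only [List.mem_toFinset, List.mem_permutations] at hm hmin
  have hL : pathLength m ≤ pathLength l := (hmin m₀ (List.Perm.refl _)).trans hL₀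
  have hc : ∀ θ, ∃ p ∈ m, g θ ≤ height θ p := fun θ => by
    obtain ⟨p, hp, h⟩ := hc₀ θ
    exact ⟨p, hm.mem_iff.2 hp, h⟩
  -- If p were matched in every direction by another entry, deleting it would give a shorter list
  -- that still covers.
  have hexp : ∀ A p B, m = A ++ p :: B → ∃ θ, ∀ q ∈ A ++ B, height θ q < height θ p := by
    intro A p B h
    by_contra! hcon
    refine Nat.find_min hex (m := (A ++ B).length) ?_ ⟨A ++ B, fun θ => ?_, ?_, rfl⟩
    · rw [← hk₀, ← hm.length_eq, h]; simp
    · obtain ⟨r, hr, hgr⟩ := hc θ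
      rw [h] at hr
      obtain ⟨q, hq, hpq⟩ := hcon θ
      simp only [List.mem_append, List.mem_cons] at hr
      rcases hr with hr | rfl | hr
      · exact ⟨r, by simp [hr], hgr⟩
      · exact ⟨q, hq, hgr.trans hpq⟩
      · exact ⟨r, by simp [hr], hgr⟩
    · refine le_trans ?_ hL
      rw [h]
      exact pathLength_remove_le A p B
  have hnodup : m.Nodup := by
    rw [List.nodup_iff_sublist]
    intro p hp
    obtain ⟨r₁, r₂, h1, h2, h3⟩ := List.cons_sublist_iff.1 hp
    obtain ⟨A, B, hAB⟩ := List.append_of_mem h2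
    obtain ⟨θ, hθ⟩ := hexp A p (B ++ r₂) (by rw [h1, hAB]; simp)
    exact lt_irrefl _ (hθ p (by have := List.singleton_sublist.1 h3; simp [this]))
  refine ⟨m, hc, hL, hnodup, fun p hp => ?_, fun A p p' B q q' D h => ?_⟩
  · obtain ⟨A, B, hAB⟩ := List.append_of_mem (show p ∈ m from hp)
    obtain ⟨θ, hθ⟩ := hexp A p B hAB
    refine ⟨θ, fun q hq hqp => hθ q ?_⟩
    have : q ∈ m := hq
    rw [hAB] at this
    simp only [List.mem_append, List.mem_cons] at this ⊢
    tauto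
  · have h1 := pathLength_uncross A p p' B q q' D
    have h2 := hmin (A ++ p :: (p' :: B ++ [q]).reverse ++ q' :: D) (by
      refine List.Perm.trans ?_ hm
      rw [h, show A ++ p :: p' :: B ++ q :: q' :: D =
        A ++ p :: (p' :: B ++ [q]) ++ q' :: D by simp]
      exact (((List.reverse_perm _).cons p).append_left A).append_right _)
    rw [h] at h2
    linarith

/-- Twice the signed area of a triangle. -/
def signedArea (a b c : ℂ) : ℝ :=
  (b.re - a.re) * (c.im - a.im) - (b.im - a.im) * (c.re - a.re)

lemma height_combo (θ s : ℝ) (p q : ℂ) :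
    height θ ((1 - s) • p + s • q) = (1 - s) * height θ p + s * height θ q := by
  rw [height_add, height_smul, height_smul]

lemma eq_combo_of_mem_segment {z p q : ℂ} (h : z ∈ segment ℝ p q) :
    ∃ s : ℝ, 0 ≤ s ∧ s ≤ 1 ∧ z = (1 - s) • p + s • q := by
  rw [segment_eq_image] at h
  obtain ⟨s, hs, rfl⟩ := h
  exact ⟨s, hs.1, hs.2, rfl⟩

lemma combo_mem_segment {p q : ℂ} {s : ℝ} (h0 : 0 ≤ s) (h1 : s ≤ 1) :
    (1 - s) • p + s • q ∈ segment ℝ p q := by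
  rw [segment_eq_image]
  exact ⟨s, ⟨h0, h1⟩, rfl⟩

section Exposed

variable {S : Set ℂ}

lemma IsStrictlyExposed.notMem_segment (hS : IsStrictlyExposed S) {p a b : ℂ} (hp : p ∈ S)
    (ha : a ∈ S) (hb : b ∈ S) (hap : a ≠ p) (hbp : b ≠ p) : p ∉ segment ℝ a b := by
  intro h
  obtain ⟨s, h0, h1, h2⟩ := eq_combo_of_mem_segment h
  obtain ⟨θ, hθ⟩ := hS p hp
  have ha' := hθ a ha hap
  have hb' := hθ b hb hbp
  have h3 := height_combo θ s a b
  rw [← h2] at h3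
  rcases h0.eq_or_lt with rfl | h0
  · linarith
  · nlinarith

lemma IsStrictlyExposed.notMem_triangle (hS : IsStrictlyExposed S) {p a b c z : ℂ} (hp : p ∈ S)
    (ha : a ∈ S) (hb : b ∈ S) (hc : c ∈ S) (hap : a ≠ p) (hbp : b ≠ p) (hcp : c ≠ p)
    (hz : z ∈ segment ℝ a b) : p ∉ segment ℝ z c := by
  intro h
  obtain ⟨s, h0, h1, h2⟩ := eq_combo_of_mem_segment h
  obtain ⟨t, g0, g1, g2⟩ := eq_combo_of_mem_segment hz
  obtain ⟨θ, hθ⟩ := hS p hp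
  have ha' := hθ a ha hap
  have hb' := hθ b hb hbp
  have hc' := hθ c hc hcp
  have h3 := height_combo θ s z c
  have g3 := height_combo θ t a b
  rw [← h2] at h3
  rw [← g2] at g3
  have g4 : height θ z < height θ p := by
    rcases g0.eq_or_lt with rfl | g0
    · linarith
    · nlinarith
  rcases h0.eq_or_lt with rfl | h0
  · linarith
  · nlinarith

lemma signedArea_combo (p q a b : ℂ) (s : ℝ) :
    signedArea p q ((1 - s) • a + s • b) = (1 - s) * signedArea p q a + s * signedArea p q b := by
  simp only [signedArea, Complex.add_re, Complex.add_im, Complex.real_smul, Complex.re_ofReal_mul,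
    Complex.im_ofReal_mul]
  ring

lemma exists_combo_of_signedArea_eq_zero {p q z : ℂ} (hpq : p ≠ q) (h : signedArea p q z = 0) :
    ∃ s : ℝ, z = (1 - s) • p + s • q := by
  have hd : 0 < (q.re - p.re) ^ 2 + (q.im - p.im) ^ 2 := by
    by_contra hcon
    apply hpq
    apply Complex.ext <;> nlinarith [sq_nonneg (q.re - p.re), sq_nonneg (q.im - p.im)]
  unfold signedArea at h
  refine ⟨((z.re - p.re) * (q.re - p.re) + (z.im - p.im) * (q.im - p.im)) /
    ((q.re - p.re) ^ 2 + (q.im - p.im) ^ 2), ?_⟩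
  apply Complex.ext
  · simp only [Complex.add_re, Complex.real_smul, Complex.re_ofReal_mul]
    field_simp
    linear_combination (-(q.im - p.im)) * h
  · simp only [Complex.add_im, Complex.real_smul, Complex.im_ofReal_mul]
    field_simp
    linear_combination (q.re - p.re) * h

lemma mem_segment_of_combo_neg {p q z : ℂ} {s : ℝ} (hs : s ≤ 0) (h : z = (1 - s) • p + s • q) :
    p ∈ segment ℝ z q := by
  have h1 : 0 < 1 - s := by linarith
  have h2 : p = (1 - (-s / (1 - s))) • z + (-s / (1 - s)) • q := by
    rw [h]
    apply Complex.ext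
    · simp only [Complex.add_re, Complex.real_smul, Complex.re_ofReal_mul]
      field_simp
      ring
    · simp only [Complex.add_im, Complex.real_smul, Complex.im_ofReal_mul]
      field_simp
      ring
  rw [h2]
  exact combo_mem_segment (div_nonneg (by linarith) h1.le) ((div_le_one h1).2 (by linarith))

lemma mem_segment_of_combo_ge_one {p q z : ℂ} {s : ℝ} (hs : 1 ≤ s)
    (h : z = (1 - s) • p + s • q) : q ∈ segment ℝ z p :=
  mem_segment_of_combo_neg (s := 1 - s) (by linarith) (by rw [h, sub_sub_cancel, add_comm])

lemma IsStrictlyExposed.signedArea_ne_zero (hS : IsStrictlyExposed S) {a b c : ℂ} (ha : a ∈ S)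
    (hb : b ∈ S) (hc : c ∈ S) (hab : a ≠ b) (hac : a ≠ c) (hbc : b ≠ c) :
    signedArea a b c ≠ 0 := by
  intro h
  obtain ⟨s, hs⟩ := exists_combo_of_signedArea_eq_zero hab h
  rcases le_total s 0 with h0 | h0
  · exact hS.notMem_segment ha hc hb hac.symm hab.symm (mem_segment_of_combo_neg h0 hs)
  rcases le_total s 1 with h1 | h1
  · refine hS.notMem_segment hc ha hb hac hbc ?_
    rw [hs]
    exact combo_mem_segment h0 h1
  · exact hS.notMem_segment hb hc ha hbc.symm hab (mem_segment_of_combo_ge_one h1 hs)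

/-- The entries of m lie strictly off the line through p and p', with q and q' on opposite sides, so
some consecutive pair a, b changes side and the segment ab meets the line. If it met the line
outside the segment pp', then p or p' would lie in a triangle of three other exposed points. -/
lemma IsStrictlyExposed.exists_consecutive_crossing (hS : IsStrictlyExposed S) {m : List ℂ}
    (hm : ∀ x ∈ m, x ∈ S) {p p' q q' z : ℂ} (hp : p ∈ S) (hp' : p' ∈ S)
    (hpm : p ∉ m) (hpm' : p' ∉ m) (hq : q ∈ m) (hq' : q' ∈ m)
    (hz : z ∈ segment ℝ p p') (hz' : z ∈ segment ℝ q q') :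
    ∃ A a b B, m = A ++ a :: b :: B ∧ ∃ w, w ∈ segment ℝ p p' ∧ w ∈ segment ℝ a b := by
  have hne : ∀ x ∈ m, x ≠ p := fun x hx h => hpm (h ▸ hx)
  have hne' : ∀ x ∈ m, x ≠ p' := fun x hx h => hpm' (h ▸ hx)
  have hpp : p ≠ p' := by
    rintro rfl
    rw [segment_same, Set.mem_singleton_iff] at hz
    subst hz
    exact hS.notMem_segment hp (hm _ hq) (hm _ hq') (hne _ hq) (hne _ hq') hz'
  have hnz : ∀ x ∈ m, signedArea p p' x ≠ 0 := fun x hx =>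
    hS.signedArea_ne_zero hp hp' (hm x hx) hpp (hne x hx).symm (hne' x hx).symm
  obtain ⟨s, -, -, hs⟩ := eq_combo_of_mem_segment hz
  obtain ⟨t, ht0, ht1, ht⟩ := eq_combo_of_mem_segment hz'
  have h0 : (1 - t) * signedArea p p' q + t * signedArea p p' q' = 0 := by
    rw [← signedArea_combo, ← ht, hs, signedArea_combo]
    simp only [signedArea]; ring
  have hopp : (0 < signedArea p p' q ∧ ¬ 0 < signedArea p p' q') ∨
      (0 < signedArea p p' q' ∧ ¬ 0 < signedArea p p' q) := by
    have h1 := hnz q hq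
    have h2 := hnz q' hq'
    rcases lt_or_gt_of_ne h1 with h1 | h1 <;> rcases lt_or_gt_of_ne h2 with h2 | h2
    · exfalso
      rcases ht0.eq_or_lt with rfl | ht0
      · linarith
      · nlinarith
    · right; exact ⟨h2, not_lt.2 h1.le⟩
    · left; exact ⟨h1, not_lt.2 h2.le⟩
    · exfalso
      rcases ht0.eq_or_lt with rfl | ht0
      · linarith
      · nlinarith
  obtain ⟨A, a, b, B, hAB, hab⟩ : ∃ A a b B, m = A ++ a :: b :: B ∧
      signedArea p p' a * signedArea p p' b < 0 := by
    obtain ⟨x, l, rfl⟩ := List.exists_cons_of_ne_nil (List.ne_nil_of_mem hq)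
    by_cases hx : 0 < signedArea p p' x
    · obtain ⟨A, a, b, B, h1, h2, h3⟩ := exists_consecutive
        (P := fun y => 0 < signedArea p p' y) hx (l := l)
        (by rcases hopp with h | h
            exacts [⟨q', hq', h.2⟩, ⟨q, hq, h.2⟩])
      have hb := hnz b (by rw [h1]; simp)
      exact ⟨A, a, b, B, h1, mul_neg_of_pos_of_neg h2 (lt_of_le_of_ne (not_lt.1 h3) hb)⟩
    · obtain ⟨A, a, b, B, h1, h2, h3⟩ := exists_consecutive
        (P := fun y => ¬ 0 < signedArea p p' y) hx (l := l)
        (by rcases hopp with h | h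
            exacts [⟨q, hq, not_not.2 h.1⟩, ⟨q', hq', not_not.2 h.1⟩])
      have ha := hnz a (by rw [h1]; simp)
      exact ⟨A, a, b, B, h1, mul_neg_of_neg_of_pos (lt_of_le_of_ne (not_lt.1 h2) ha)
        (not_not.1 h3)⟩
  have ham : a ∈ m := by rw [hAB]; simp
  have hbm : b ∈ m := by rw [hAB]; simp
  refine ⟨A, a, b, B, hAB, ?_⟩
  set u := signedArea p p' a
  set v := signedArea p p' b
  have huv : u - v ≠ 0 := by
    intro h
    have : u = v := by linarith
    rw [this] at hab
    nlinarith [mul_self_nonneg v]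
  have hr : 0 ≤ u / (u - v) ∧ u / (u - v) ≤ 1 := by
    rcases lt_or_gt_of_ne huv with h | h
    · have hu : u < 0 := by
        by_contra hu; nlinarith
      refine ⟨div_nonneg_of_nonpos hu.le h.le, ?_⟩
      rw [div_le_one_of_neg h]
      nlinarith
    · have hu : 0 < u := by
        by_contra hu; nlinarith
      refine ⟨div_nonneg hu.le h.le, ?_⟩
      rw [div_le_one h]
      nlinarith
  have hw : (1 - u / (u - v)) • a + (u / (u - v)) • b ∈ segment ℝ a b :=
    combo_mem_segment hr.1 hr.2
  set w := (1 - u / (u - v)) • a + (u / (u - v)) • b with hwdef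
  have hw0 : signedArea p p' w = 0 := by
    rw [hwdef, signedArea_combo]
    field_simp
    ring
  obtain ⟨r, hr⟩ := exists_combo_of_signedArea_eq_zero hpp hw0
  refine ⟨w, ?_, hw⟩
  by_cases hr0 : 0 ≤ r
  · by_cases hr1 : r ≤ 1
    · rw [hr]; exact combo_mem_segment hr0 hr1
    · exact absurd (mem_segment_of_combo_ge_one (not_le.1 hr1).le hr)
        (hS.notMem_triangle hp' (hm a ham) (hm b hbm) hp (hne' a ham) (hne' b hbm) hpp hw)
  · exact absurd (mem_segment_of_combo_neg (not_le.1 hr0).le hr)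
      (hS.notMem_triangle hp (hm a ham) (hm b hbm) hp' (hne a ham) (hne b hbm) hpp.symm hw)

/-- Two triangle inequalities through the crossing point z. The one for a and c is strict, since
equality would put z on ca and make a, c, d collinear. -/
lemma IsStrictlyExposed.norm_lt_of_crossing (hS : IsStrictlyExposed S) {a b c d z : ℂ}
    (ha : a ∈ S) (hb : b ∈ S) (hc : c ∈ S) (hd : d ∈ S) (hac : a ≠ c) (hbc : b ≠ c)
    (had : a ≠ d) (hcd : c ≠ d)
    (hz : z ∈ segment ℝ c d) (hz' : z ∈ segment ℝ a b) :
    ‖a - c‖ + ‖b - d‖ < ‖d - c‖ + ‖b - a‖ := by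
  have h1 : ‖z - c‖ + ‖d - z‖ = ‖d - c‖ := by
    have := dist_add_dist_of_mem_segment hz
    rwa [dist_comm c z, dist_comm z d, dist_comm c d, dist_eq_norm, dist_eq_norm,
      dist_eq_norm] at this
  have h2 : ‖z - a‖ + ‖b - z‖ = ‖b - a‖ := by
    have := dist_add_dist_of_mem_segment hz'
    rwa [dist_comm a z, dist_comm z b, dist_comm a b, dist_eq_norm, dist_eq_norm,
      dist_eq_norm] at this
  have h3 : ‖b - d‖ ≤ ‖b - z‖ + ‖d - z‖ := by
    calc ‖b - d‖ = ‖(b - z) - (d - z)‖ := by congr 1; ring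
      _ ≤ _ := norm_sub_le _ _
  have h4 : ‖a - c‖ < ‖z - c‖ + ‖z - a‖ := by
    have h5 : ‖a - c‖ ≤ ‖z - c‖ + ‖z - a‖ := by
      calc ‖a - c‖ = ‖(z - c) - (z - a)‖ := by congr 1; ring
        _ ≤ _ := norm_sub_le _ _
    refine lt_of_le_of_ne h5 fun h => ?_
    have hw : z ∈ segment ℝ c a := by
      rw [mem_segment_iff_wbtw, ← dist_add_dist_eq_iff, dist_comm c z, dist_eq_norm, dist_eq_norm,
        dist_comm c a, dist_eq_norm, h]
    obtain ⟨s, -, -, hs⟩ := eq_combo_of_mem_segment hw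
    obtain ⟨t, -, -, ht⟩ := eq_combo_of_mem_segment hz
    -- z lies on both lines through c, so the triangle c, z, z is degenerate; its area factors
    -- through that of c, a, d.
    have h6 : s * t * signedArea c a d = 0 := by
      have h7 : signedArea c ((1 - s) • c + s • a) ((1 - t) • c + t • d) = 0 := by
        rw [← hs, ← ht]; simp only [signedArea]; ring
      rw [← h7]
      simp only [signedArea, Complex.add_re, Complex.add_im, Complex.real_smul,
        Complex.re_ofReal_mul, Complex.im_ofReal_mul]
      ring
    have hzc : z ≠ c := fun h => hS.notMem_segment hc ha hb hac hbc (h ▸ hz')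
    have hs0 : s ≠ 0 := by rintro rfl; exact hzc (by simpa using hs)
    have ht0 : t ≠ 0 := by rintro rfl; exact hzc (by simpa using ht)
    exact hS.signedArea_ne_zero hc ha hd hac.symm hcd had
      ((mul_eq_zero.1 h6).resolve_left (mul_ne_zero hs0 ht0))
  linarith

/-- A crossing of two chords is moved in two steps to a crossing of two edges: first the chord of
`l₂` is replaced by an edge of `l₂`, then the chord of `l₁` by an edge of `l₁`. Uncrossing these
edges would shorten the path. -/
lemma disjoint_segment_of_isTwoOptimal {l₁ l₂ : List ℂ} (hnd : (l₁ ++ l₂).Nodup)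
    (hS : IsStrictlyExposed {p | p ∈ l₁ ++ l₂}) (h2 : IsTwoOptimal (l₁ ++ l₂))
    {p p' q q' : ℂ} (hp : p ∈ l₁) (hp' : p' ∈ l₁) (hq : q ∈ l₂) (hq' : q' ∈ l₂) :
    Disjoint (segment ℝ p p') (segment ℝ q q') := by
  rw [Set.disjoint_left]
  intro z hz hz'
  have hdis := List.disjoint_of_nodup_append hnd
  have hs₁ : ∀ x ∈ l₁, x ∈ {p | p ∈ l₁ ++ l₂} := fun x hx => by simp [hx]
  have hs₂ : ∀ x ∈ l₂, x ∈ {p | p ∈ l₁ ++ l₂} := fun x hx => by simp [hx]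
  obtain ⟨A, a, b, B, hAB, w, hw, hw'⟩ := hS.exists_consecutive_crossing hs₂
    (hs₁ p hp) (hs₁ p' hp') (fun h => hdis hp h) (fun h => hdis hp' h) hq hq' hz hz'
  have ha : a ∈ l₂ := by rw [hAB]; simp
  have hb : b ∈ l₂ := by rw [hAB]; simp
  obtain ⟨C, c, d, D, hCD, v, hv, hv'⟩ := hS.exists_consecutive_crossing hs₁
    (hs₂ a ha) (hs₂ b hb) (fun h => hdis h ha) (fun h => hdis h hb) hp hp' hw' hw
  have hc : c ∈ l₁ := by rw [hCD]; simp
  have hd : d ∈ l₁ := by rw [hCD]; simp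
  have hne : ∀ x ∈ l₁, ∀ y ∈ l₂, y ≠ x := fun x hx y hy h => hdis hx (h ▸ hy)
  have hcd : c ≠ d := by
    rintro rfl
    have := (List.nodup_append.1 hnd).1
    rw [hCD] at this
    simp [List.nodup_append] at this
  have h3 := h2 C c d (D ++ A) a b B (by rw [hCD, hAB]; simp)
  have h4 := hS.norm_lt_of_crossing (hs₂ a ha) (hs₂ b hb) (hs₁ c hc) (hs₁ d hd) (hne c hc a ha)
    (hne c hc b hb) (hne d hd a ha) hcd hv' hv
  linarith

end Exposed

/-! ### Winning directions on the circle and the choice of a half turn -/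

open Real in
lemma height_pos_of_between {w : ℂ} {α β θ : ℝ} (hα : 0 < height α w) (hβ : 0 < height β w)
    (h1 : α < θ) (h2 : θ < β) (h3 : β - α ≤ π) : 0 < height θ w := by
  have hlt : β - α < π := by
    refine lt_of_le_of_ne h3 fun h => ?_
    have : β = α + π := by linarith
    rw [this, height_add_pi] at hβ
    linarith
  -- On an arc shorter than π the direction θ is a positive combination of the directions α and β.
  have key : sin (β - α) * height θ w = sin (β - θ) * height α w + sin (θ - α) * height β w := by
    simp only [height, sin_sub]
    ring
  have hs : 0 < sin (β - α) := sin_pos_of_pos_of_lt_pi (by linarith) hlt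
  have hs1 : 0 < sin (β - θ) := sin_pos_of_pos_of_lt_pi (by linarith) (by linarith)
  have hs2 : 0 < sin (θ - α) := sin_pos_of_pos_of_lt_pi (by linarith) (by linarith)
  have : 0 < sin (β - α) * height θ w := by rw [key]; positivity
  exact pos_of_mul_pos_right this hs.le

open Real in
/-- Two directions in which a point beats two others cut the circle into two arcs, on one of which
it beats both. -/
lemma not_beaten_on_both_arcs {q p p' : ℂ} {α β θ θ' : ℝ} (hα : height α p < height α q)
    (hα' : height α p' < height α q) (hβ : height β p < height β q)
    (hβ' : height β p' < height β q) (h1 : α < θ) (h2 : θ < β) (h3 : β < θ')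
    (h4 : θ' < α + 2 * π) (hθ : height θ q < height θ p) (hθ' : height θ' q < height θ' p') :
    False := by
  rcases le_total (β - α) π with h | h
  · have := height_pos_of_between (w := q - p) (by rw [height_sub]; linarith)
      (by rw [height_sub]; linarith) h1 h2 h
    rw [height_sub] at this
    linarith
  · have := height_pos_of_between (w := q - p') (α := β) (β := α + 2 * π)
      (by rw [height_sub]; linarith)
      (by rw [height_add_two_pi, height_sub]; linarith) h3 h4 (by linarith)
    rw [height_sub] at this
    linarith

open Real in
lemma exists_direction_of_disjoint_segment {p p' q q' : ℂ}
    (h : Disjoint (segment ℝ p p') (segment ℝ q q')) :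
    ∃ ν, height ν p < height ν q ∧ height ν p < height ν q' ∧ height ν p' < height ν q ∧
      height ν p' < height ν q' := by
  have hcomp : ∀ a b : ℂ, IsCompact (segment ℝ a b) := fun a b => by
    rw [segment_eq_image]
    exact isCompact_Icc.image (by fun_prop)
  obtain ⟨f, u, v, hfu, huv, hfv⟩ := geometric_hahn_banach_compact_closed (convex_segment p p')
    (hcomp p p') (convex_segment q q') (hcomp q q').isClosed h
  have hf : ∀ z : ℂ, f z = z.re * f 1 + z.im * f Complex.I := fun z => by
    conv_lhs => rw [← Complex.re_add_im z]
    rw [map_add, ← smul_eq_mul (z.re : ℝ), ← smul_eq_mul (z.im : ℝ), ← map_smul, ← map_smul]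
    simp
  set c : ℂ := ⟨f 1, f Complex.I⟩
  have hfc : ∀ z, f z = ‖c‖ * height c.arg z := fun z => by
    rw [hf, height, mul_add]
    have h1 : ‖c‖ * cos c.arg = f 1 := Complex.norm_mul_cos_arg c
    have h2 : ‖c‖ * sin c.arg = f Complex.I := Complex.norm_mul_sin_arg c
    rw [← h1, ← h2]
    ring
  have hlt : ∀ x ∈ segment ℝ p p', ∀ y ∈ segment ℝ q q', height c.arg x < height c.arg y := by
    intro x hx y hy
    have h1 := (hfu x hx).trans (huv.trans (hfv y hy))
    rw [hfc, hfc] at h1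
    exact lt_of_mul_lt_mul_left h1 (norm_nonneg _)
  have hp := left_mem_segment ℝ p p'
  have hp' := right_mem_segment ℝ p p'
  have hq := left_mem_segment ℝ q q'
  have hq' := right_mem_segment ℝ q q'
  exact ⟨c.arg, hlt _ hp _ hq, hlt _ hp _ hq', hlt _ hp' _ hq, hlt _ hp' _ hq'⟩

lemma height_add_int_mul_two_pi (θ : ℝ) (k : ℤ) (p : ℂ) :
    height (θ + k * (2 * Real.pi)) p = height θ p := by
  unfold height
  rw [Real.cos_add_int_mul_two_pi, Real.sin_add_int_mul_two_pi]

/-- The directions in which some point of the first list beats all points of the second. -/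
def beatingSet (l₁ l₂ : List ℂ) : Set ℝ := {θ | ∃ p ∈ l₁, ∀ q ∈ l₂, height θ q < height θ p}

lemma beatingSet_add_two_pi (l₁ l₂ : List ℂ) (θ : ℝ) :
    θ + 2 * Real.pi ∈ beatingSet l₁ l₂ ↔ θ ∈ beatingSet l₁ l₂ := by
  simp [beatingSet, height_add_two_pi]

lemma isOpen_beatingSet (l₁ l₂ : List ℂ) : IsOpen (beatingSet l₁ l₂) := by
  have : beatingSet l₁ l₂ =
      ⋃ p ∈ l₁.toFinset, ⋂ q ∈ l₂.toFinset, {θ | height θ q < height θ p} := by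
    ext θ; simp [beatingSet]
  rw [this]
  refine isOpen_biUnion fun p _ => isOpen_biInter_finset fun q _ => ?_
  exact isOpen_lt (continuous_height q) (continuous_height p)

lemma disjoint_beatingSet (l₁ l₂ : List ℂ) : Disjoint (beatingSet l₁ l₂) (beatingSet l₂ l₁) := by
  rw [Set.disjoint_left]
  rintro θ ⟨p, hp, h⟩ ⟨q, hq, h'⟩
  exact lt_asymm (h q hq) (h' p hp)

open Real in
/-- The two sets do not interleave on the circle of directions. -/
def NotInterleaved (E F : Set ℝ) : Prop :=
  ∀ θ₁ θ₂ θ₃ θ₄, θ₁ < θ₂ → θ₂ < θ₃ → θ₃ < θ₄ → θ₄ < θ₁ + 2 * π →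
    θ₁ ∈ E → θ₂ ∈ F → θ₃ ∈ E → θ₄ ∈ F → False

-- Let p, q, p', q' win alternately. In a direction separating pp' from qq' both q and q' beat p and
-- p'. Together with a direction already won by q or q', this cuts the circle into two arcs. One has
-- length at most π, so the same point beats p and p' on all of it; but p' wins inside one arc and p
-- inside the other.
open Real in
lemma notInterleaved_beatingSet {l₁ l₂ : List ℂ}
    (h : ∀ p ∈ l₁, ∀ p' ∈ l₁, ∀ q ∈ l₂, ∀ q' ∈ l₂,
      Disjoint (segment ℝ p p') (segment ℝ q q')) :
    NotInterleaved (beatingSet l₁ l₂) (beatingSet l₂ l₁) := by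
  rintro θ₁ θ₂ θ₃ θ₄ h12 h23 h34 h41 ⟨p, hp, h1⟩ ⟨q, hq, h2⟩ ⟨p', hp', h3⟩ ⟨q', hq', h4⟩
  obtain ⟨ν, hν1, hν2, hν3, hν4⟩ :=
    exists_direction_of_disjoint_segment (h p hp p' hp' q hq q' hq')
  obtain ⟨μ, hμ, hμ1, hμ2⟩ : ∃ μ, (∀ z, height μ z = height ν z) ∧ θ₁ ≤ μ ∧ μ < θ₁ + 2 * π := by
    refine ⟨toIcoMod two_pi_pos θ₁ ν, fun z => ?_, left_le_toIcoMod _ _ _, toIcoMod_lt_right _ _ _⟩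
    have := height_add_int_mul_two_pi (toIcoMod two_pi_pos θ₁ ν) (toIcoDiv two_pi_pos θ₁ ν) z
    rw [← this]
    congr 1
    have := toIcoMod_add_toIcoDiv_zsmul two_pi_pos θ₁ ν
    rw [zsmul_eq_mul] at this
    exact this
  simp only [← hμ] at hν1 hν2 hν3 hν4
  have g1 : θ₁ < μ := by
    refine lt_of_le_of_ne hμ1 fun h => ?_
    rw [← h] at hν1
    exact lt_asymm hν1 (h1 q hq)
  rcases lt_trichotomy μ θ₃ with g | g | g
  · exact not_beaten_on_both_arcs (q := q') (p := p') (p' := p) (α := μ) (β := θ₄) (θ := θ₃)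
      (θ' := θ₁ + 2 * π) hν4 hν2 (h4 p' hp') (h4 p hp) g h34 h41 (by linarith) (h3 q' hq')
      (by simpa [height_add_two_pi] using h1 q' hq')
  · rw [g] at hν3
    exact lt_asymm hν3 (h3 q hq)
  · exact not_beaten_on_both_arcs (q := q) (p := p') (p' := p) (α := θ₂) (β := μ) (θ := θ₃)
      (θ' := θ₁ + 2 * π) (h2 p' hp') (h2 p hp) hν3 hν1 h23 g hμ2 (by linarith) (h3 q hq)
      (by simpa [height_add_two_pi] using h1 q hq)

open Real in
lemma dense_height_ne_zero {w : ℂ} (hw : w ≠ 0) : Dense {θ | height θ w ≠ 0} := by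
  rw [dense_iff_exists_between]
  intro a b hab
  by_contra! hcon
  simp only [Set.mem_ofPred_eq] at hcon
  have hzero : ∀ θ, a < θ → θ < b → height θ w = 0 := fun θ h1 h2 => by
    by_contra h
    rcases lt_or_ge θ b with h3 | h3
    · exact absurd h2 (not_lt.2 (hcon θ h h1))
    · linarith
  set c := min (b - a) π / 3
  have hc : 0 < c := by have := lt_min (sub_pos.2 hab) pi_pos; positivity
  have hcb : 3 * c ≤ b - a := by
    have := min_le_left (b - a) π
    simp only [c]; linarith
  have hcp : 3 * c ≤ π := by
    have := min_le_right (b - a) π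
    simp only [c]; linarith
  have h1 := hzero (a + c) (by linarith) (by linarith)
  have h2 := hzero (a + c + c) (by linarith) (by linarith)
  have hsc : sin c ≠ 0 := (sin_pos_of_pos_of_lt_pi hc (by linarith)).ne'
  generalize a + c = t at h1 h2
  unfold height at h1 h2
  rw [cos_add, sin_add] at h2
  have h3 : sin c * (w.im * cos t - w.re * sin t) = 0 := by
    linear_combination h2 - cos c * h1
  have h4 := (mul_eq_zero.1 h3).resolve_left hsc
  have h5 := sin_sq_add_cos_sq t
  apply hw
  apply Complex.ext
  · simp only [Complex.zero_re]
    linear_combination cos t * h1 - sin t * h4 - w.re * h5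
  · simp only [Complex.zero_im]
    linear_combination sin t * h1 + cos t * h4 - w.im * h5

lemma exists_strict_winner {m : List ℂ} {θ : ℝ} (hm : m ≠ [])
    (hθ : ∀ p ∈ m, ∀ q ∈ m, p ≠ q → height θ (p - q) ≠ 0) :
    ∃ p ∈ m, ∀ q ∈ m, q ≠ p → height θ q < height θ p := by
  obtain ⟨p, hp, hmax⟩ := m.toFinset.exists_max_image (height θ)
    ⟨m.head hm, List.mem_toFinset.2 (List.head_mem hm)⟩
  simp only [List.mem_toFinset] at hp hmax
  refine ⟨p, hp, fun q hq hqp => lt_of_le_of_ne (hmax q hq) fun h => ?_⟩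
  exact hθ q hq p hp hqp (by rw [height_sub, h, sub_self])

lemma dense_height_ne_zero_finset (W : Finset ℂ) (hW : ∀ w ∈ W, w ≠ 0) :
    Dense {θ | ∀ w ∈ W, height θ w ≠ 0} := by
  have h1 : Dense (⋂ w ∈ (W : Set ℂ), {θ | height θ w ≠ 0}) := by
    refine dense_biInter_of_isOpen (fun w _ => ?_) W.countable_toSet fun w hw => ?_
    · exact isOpen_ne_fun (continuous_height w) continuous_const
    · exact dense_height_ne_zero (hW w hw)
  refine h1.mono fun θ hθ w hw => ?_
  rw [Set.mem_iInter₂] at hθ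
  exact hθ w hw

/-- Ties between two distinct points occur only in directions orthogonal to their difference;
outside these finitely many closed nowhere dense sets there is a strict winner. -/
lemma dense_beatingSet_union {l₁ l₂ : List ℂ} (hnd : (l₁ ++ l₂).Nodup) (hne : l₁ ++ l₂ ≠ []) :
    Dense (beatingSet l₁ l₂ ∪ beatingSet l₂ l₁) := by
  classical
  refine (dense_height_ne_zero_finset
    ((((l₁ ++ l₂).toFinset ×ˢ (l₁ ++ l₂).toFinset).image fun x => x.1 - x.2).erase 0)
    fun w hw => Finset.ne_of_mem_erase hw).mono fun θ hθ => ?_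
  obtain ⟨p, hp, hwin⟩ := exists_strict_winner hne (θ := θ) fun p hp q hq hpq =>
    hθ (p - q) (Finset.mem_erase.2 ⟨sub_ne_zero.2 hpq, Finset.mem_image.2
      ⟨(p, q), Finset.mem_product.2 ⟨List.mem_toFinset.2 hp, List.mem_toFinset.2 hq⟩, rfl⟩⟩)
  have hdis := List.disjoint_of_nodup_append hnd
  rcases List.mem_append.1 hp with h | h
  · exact Or.inl ⟨p, h, fun q hq => hwin q (List.mem_append_right _ hq) fun e => hdis h (e ▸ hq)⟩
  · exact Or.inr ⟨p, h, fun q hq => hwin q (List.mem_append_left _ hq) fun e => hdis hq (e ▸ h)⟩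

lemma add_int_mul_mem_iff {S : Set ℝ} {T : ℝ} (hS : ∀ θ, θ + T ∈ S ↔ θ ∈ S) (k : ℤ) (θ : ℝ) :
    θ + k * T ∈ S ↔ θ ∈ S := by
  induction k using Int.induction_on with
  | zero => simp
  | succ i ih =>
    rw [← ih, ← hS (θ + ((i : ℕ) : ℤ) * T)]
    push_cast
    ring_nf
  | pred i ih =>
    rw [← ih, ← hS]
    push_cast
    ring_nf

open Real in
lemma exists_mem_Ico_of_periodic {S : Set ℝ} (hS : ∀ θ, θ + 2 * π ∈ S ↔ θ ∈ S)
    (hne : S.Nonempty) (a : ℝ) : ∃ θ ∈ S, a ≤ θ ∧ θ < a + 2 * π := by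
  obtain ⟨s, hs⟩ := hne
  refine ⟨toIcoMod two_pi_pos a s, ?_, left_le_toIcoMod _ _ _, toIcoMod_lt_right _ _ _⟩
  have := toIcoMod_add_toIcoDiv_zsmul two_pi_pos a s
  rw [zsmul_eq_mul] at this
  rwa [← this, add_int_mul_mem_iff hS] at hs

open Real in
/-- If a half turn avoids `L₂`, then some half turn avoids `L₂` while the complementary half turn
avoids `E₁`. -/
lemma exists_half_turn {E₁ E₂ L₁ L₂ : Set ℝ} (oE₁ : IsOpen E₁) (oL₁ : IsOpen L₁)
    (pE₁ : ∀ θ, θ + 2 * π ∈ E₁ ↔ θ ∈ E₁) (pL₁ : ∀ θ, θ + 2 * π ∈ L₁ ↔ θ ∈ L₁)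
    (pL₂ : ∀ θ, θ + 2 * π ∈ L₂ ↔ θ ∈ L₂) (hE : E₁ ⊆ E₂) (hL : L₂ ⊆ L₁) (hd : Disjoint E₁ L₁)
    (ni₁ : NotInterleaved E₁ L₁) (ni₂ : NotInterleaved E₂ L₂)
    (hL₁ : ∀ x, ∃ y ∈ Set.Icc x (x + π), y ∈ L₁) {x₀ : ℝ}
    (h₀ : ∀ y ∈ Set.Icc x₀ (x₀ + π), y ∉ L₂) (hdense : Dense (E₂ ∪ L₂)) :
    ∃ x, (∀ y ∈ Set.Icc x (x + π), y ∉ L₂) ∧ ∀ y ∈ Set.Icc (x + π) (x + 2 * π), y ∉ E₁ := by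
  have hπ := pi_pos
  rcases E₁.eq_empty_or_nonempty with hE₁ | hE₁
  · exact ⟨x₀, h₀, fun y _ hy => by simp [hE₁] at hy⟩
  rw [Set.disjoint_left] at hd
  -- The circle is cut open at ω in `L₁`. If `L₂` is nonempty, ω is taken in `L₂`, hence outside the
  -- given half turn.
  obtain ⟨ω, hω, hω'⟩ : ∃ ω ∈ L₁, L₂ = ∅ ∨ (ω ∈ L₂ ∧ ω < x₀ ∧ x₀ + π < ω + 2 * π) := by
    rcases L₂.eq_empty_or_nonempty with h | h
    · obtain ⟨y, -, hy⟩ := hL₁ 0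
      exact ⟨y, hy, Or.inl h⟩
    · obtain ⟨ω, hω, h1, h2⟩ := exists_mem_Ico_of_periodic pL₂ h (x₀ - 2 * π)
      refine ⟨ω, hL hω, Or.inr ⟨hω, by linarith, ?_⟩⟩
      by_contra! hcon
      exact h₀ (ω + 2 * π) ⟨by linarith, hcon⟩ ((pL₂ ω).2 hω)
  have hω2 : ω + 2 * π ∈ L₁ := (pL₁ ω).2 hω
  set F := E₁ ∩ Set.Ioo ω (ω + 2 * π) with hF
  have oF : IsOpen F := oE₁.inter isOpen_Ioo
  obtain ⟨e₀, he₀⟩ : F.Nonempty := by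
    obtain ⟨e, he, h1, h2⟩ := exists_mem_Ico_of_periodic pE₁ hE₁ ω
    refine ⟨e, he, lt_of_le_of_ne h1 fun h => ?_, h2⟩
    exact hd he (h ▸ hω)
  have hb : BddBelow F := ⟨ω, fun e he => he.2.1.le⟩
  have ha : BddAbove F := ⟨ω + 2 * π, fun e he => he.2.2.le⟩
  set i₁ := sInf F
  set i₂ := sSup F
  have fl : ∀ y, i₁ < y → ∃ e ∈ F, e < y := fun y hy => exists_lt_of_csInf_lt ⟨e₀, he₀⟩ hy
  have fr : ∀ y, y < i₂ → ∃ e ∈ F, y < e := fun y hy => exists_lt_of_lt_csSup ⟨e₀, he₀⟩ hy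
  have fi : ∀ e ∈ F, i₁ < e ∧ e < i₂ := by
    intro e he
    obtain ⟨l, u, heI, hI⟩ := mem_nhds_iff_exists_Ioo_subset.1 (oF.mem_nhds he)
    have h1 : (l + e) / 2 ∈ F := hI ⟨by linarith [heI.1], by linarith [heI.1, heI.2]⟩
    have h2 : (e + u) / 2 ∈ F := hI ⟨by linarith [heI.1, heI.2], by linarith [heI.2]⟩
    exact ⟨lt_of_le_of_lt (csInf_le hb h1) (by linarith [heI.1]),
      lt_of_lt_of_le (by linarith [heI.2]) (le_csSup ha h2)⟩
  -- A point of `L₁` in the hull of `E₁` would interleave with `E₁` because of ω. So this hull is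
  -- free of `L₁`, and therefore shorter than π.
  have fL : ∀ y, i₁ ≤ y → y ≤ i₂ → y ∉ L₁ := by
    intro y h1 h2 hy
    obtain ⟨l, u, hyI, hI⟩ := mem_nhds_iff_exists_Ioo_subset.1 (oL₁.mem_nhds hy)
    obtain ⟨e, he, heu⟩ := fl u (lt_of_le_of_lt h1 hyI.2)
    obtain ⟨e', he', hel⟩ := fr l (lt_of_lt_of_le hyI.1 h2)
    have g1 : e ≤ l := by
      by_contra! hcon
      exact hd he.1 (hI ⟨hcon, heu⟩)
    have g2 : u ≤ e' := by
      by_contra! hcon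
      exact hd he'.1 (hI ⟨hel, hcon⟩)
    exact ni₁ e y e' (ω + 2 * π) (lt_of_le_of_lt g1 hyI.1) (lt_of_lt_of_le hyI.2 g2) he'.2.2
      (by linarith [he.2.1]) he.1 hy he'.1 hω2
  have hlt : i₂ - i₁ < π := by
    by_contra! hcon
    obtain ⟨y, hy, hyL⟩ := hL₁ i₁
    exact fL y hy.1 (by linarith [hy.2]) hyL
  have hωi : ω < i₁ := by
    by_contra! hcon
    obtain ⟨l, u, hyI, hI⟩ := mem_nhds_iff_exists_Ioo_subset.1 (oL₁.mem_nhds hω)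
    obtain ⟨e, he, heu⟩ := fl u (lt_of_le_of_lt hcon hyI.2)
    exact hd he.1 (hI ⟨hyI.1.trans he.2.1, heu⟩)
  have fE : ∀ x, ω < x → x ≤ i₁ → i₂ ≤ x + π → ∀ y ∈ Set.Icc (x + π) (x + 2 * π), y ∉ E₁ := by
    intro x h1 h2 h3 y hy hyE
    rcases lt_trichotomy y (ω + 2 * π) with h | h | h
    · have := (fi y ⟨hyE, by linarith [hy.1], h⟩).2
      linarith [hy.1]
    · exact hd hyE (h ▸ hω2)
    · have h4 : y - 2 * π ∈ E₁ := (pE₁ _).1 (by simpa using hyE)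
      have h5 := (fi _ he₀).1
      have := (fi (y - 2 * π) ⟨h4, by linarith, by linarith [hy.2, he₀.2.2]⟩).1
      linarith [hy.2]
  rcases hω' with hempty | ⟨hω₂, hωx, hxω⟩
  · exact ⟨i₁, fun y _ hy => by simp [hempty] at hy, fE i₁ hωi le_rfl (by linarith)⟩
  obtain ⟨e', he', hx1, hx2⟩ : ∃ e' ∈ E₂, x₀ < e' ∧ e' < x₀ + π := by
    obtain ⟨y, hy, h1, h2⟩ := hdense.exists_between (show x₀ < x₀ + π by linarith)
    rcases hy with hy | hy
    · exact ⟨y, hy, h1, h2⟩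
    · exact absurd hy (h₀ y ⟨h1.le, h2.le⟩)
  have hω₂' : ω + 2 * π ∈ L₂ := (pL₂ ω).2 hω₂
  have fi₀ := fi _ he₀
  -- The half turn is shifted just enough to contain [i₁, i₂]. The points gained lie in [i₁, i₂],
  -- hence outside `L₁`, or between points of `E₂`, hence outside `L₂` by non-interleaving.
  rcases lt_or_ge i₁ x₀ with hcase | hcase
  · refine ⟨i₁, fun y hy hyL => ?_, fE i₁ hωi le_rfl (by linarith)⟩
    rcases le_or_gt x₀ y with h | h
    · exact h₀ y ⟨h, by linarith [hy.2]⟩ hyL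
    rcases le_or_gt y i₂ with h' | h'
    · exact fL y hy.1 h' (hL hyL)
    exact ni₂ e₀ y e' (ω + 2 * π) (by linarith) (by linarith) (by linarith)
      (by linarith [he₀.2.1]) (hE he₀.1) hyL he' hω₂'
  rcases le_or_gt i₂ (x₀ + π) with hcase' | hcase'
  · exact ⟨x₀, h₀, fE x₀ hωx hcase hcase'⟩
  · refine ⟨i₂ - π, fun y hy hyL => ?_, fE _ (by linarith) (by linarith) (by linarith)⟩
    rcases le_or_gt y (x₀ + π) with h | h
    · exact h₀ y ⟨by linarith [hy.1], h⟩ hyL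
    rcases le_or_gt i₁ y with h' | h'
    · exact fL y h' (by linarith [hy.2]) (hL hyL)
    exact ni₂ e' y e₀ (ω + 2 * π) (by linarith) (by linarith) he₀.2.2
      (by linarith) he' hyL (hE he₀.1) hω₂'

/-! ### The planar inequality -/

lemma exists_first_split {α : Type*} {Q : List α → List α → Prop} (A D : List α) (h : ¬ Q A D)
    (h' : Q (A ++ D) []) :
    ∃ A' q D', A ++ D = A' ++ q :: D' ∧ ¬ Q A' (q :: D') ∧ Q (A' ++ [q]) D' := by
  induction D generalizing A with
  | nil => rw [List.append_nil] at h'; exact absurd h' h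
  | cons q D ih =>
    by_cases hq : Q (A ++ [q]) D
    · exact ⟨A, q, D, rfl, h, hq⟩
    · simpa using ih (A ++ [q]) hq (by simpa using h')

-- Multiplication by exp(-ic) rotates the centre of the half circle to 0.
open Real in
lemma integral_half_le_pathLength_center {X : Finset ℂ} {hX : X.Nonempty} {A : List ℂ} {q : ℂ}
    (c : ℝ) (hcov : ∀ θ ∈ Set.Icc (c - π / 2) (c + π / 2), ∃ p ∈ A ++ [q],
      planarSupport X hX θ ≤ height θ p) :
    (∫ θ in (c - π / 2)..(c + π / 2), planarSupport X hX θ) ≤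
      pathLength (A ++ [q]) + height c q + planarSupport X hX c := by
  classical
  set ρ : ℂ := Complex.exp (-(c * Complex.I)) with hρ
  have hρ1 : ‖ρ‖ = 1 := by
    rw [hρ, ← neg_mul, ← Complex.ofReal_neg]
    exact Complex.norm_exp_ofReal_mul_I _
  have hh : ∀ θ p, height (θ + c) p = height θ (p * ρ) := fun θ p => height_add_angle θ c p
  have hY : (X.image (· * ρ)).Nonempty := hX.image _
  have hsup : ∀ θ, planarSupport (X.image (· * ρ)) hY θ = planarSupport X hX (θ + c) := fun θ => by
    unfold planarSupport
    rw [Finset.sup'_image]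
    exact Finset.sup'_congr hX rfl fun p _ => (hh θ p).symm
  have hpl : ∀ l : List ℂ, pathLength (l.map (· * ρ)) = pathLength l := by
    intro l
    induction l with
    | nil => rfl
    | cons x l ih =>
      cases l with
      | nil => rfl
      | cons y l =>
        simp only [List.map_cons, pathLength_cons_cons] at ih ⊢
        rw [ih, ← sub_mul, norm_mul, hρ1, mul_one]
  have h1 := integral_half_le_pathLength (X := X.image (· * ρ)) (hX := hY)
    (A := A.map (· * ρ)) (q := q * ρ) (fun θ hθ => by
      obtain ⟨p, hp, h⟩ := hcov (θ + c) ⟨by linarith [hθ.1], by linarith [hθ.2]⟩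
      refine ⟨p * ρ, ?_, ?_⟩
      · have := List.mem_map_of_mem (f := (· * ρ)) hp
        simpa using this
      · rw [hsup, ← hh]; exact h)
  have h2 : (q * ρ).re = height c q := by
    have := hh 0 q
    rw [zero_add] at this
    rw [this]; simp [height]
  have h3 : A.map (· * ρ) ++ [q * ρ] = (A ++ [q]).map (· * ρ) := by simp
  rw [h2, h3, hpl] at h1
  simp only [hsup, zero_add] at h1
  rw [intervalIntegral.integral_comp_add_right (fun θ => planarSupport X hX θ)] at h1
  convert h1 using 2 <;> ring_nf

open Real in
/-- The perimeter of the convex hull of a planar finite set is at most the length of a path whose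
convex hull contains the set plus the diameter of the set. -/
theorem integral_planarSupport_le {X : Finset ℂ} {hX : X.Nonempty} {l : List ℂ}
    (hl : ∀ θ, ∃ p ∈ l, planarSupport X hX θ ≤ height θ p) {d : ℝ}
    (hd : ∀ x ∈ X, ∀ y ∈ X, ‖x - y‖ ≤ d) :
    ∫ θ in (0 : ℝ)..(2 * π), planarSupport X hX θ ≤ pathLength l + d := by
  obtain ⟨m, hm, hml, hnd, hexp, hopt⟩ := exists_optimal_cover hl
  have hmne : m ≠ [] := by
    obtain ⟨p, hp, -⟩ := hm 0
    exact List.ne_nil_of_mem hp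
  -- The vertices pass one by one from the final stretch to the initial one; q is the first whose
  -- transfer leaves a half turn in which the final stretch never wins.
  obtain ⟨A, q, D, hmA, hnQ, x₀, hx₀⟩ := exists_first_split
    (Q := fun A D : List ℂ => ∃ x, ∀ y ∈ Set.Icc x (x + π), y ∉ beatingSet D A) [] m
    (by
      rintro ⟨x, hx⟩
      refine hx x ⟨le_rfl, by linarith [pi_pos]⟩ ⟨m.head hmne, List.head_mem hmne, ?_⟩
      simp)
    (by exact ⟨0, fun y _ h => by obtain ⟨p, hp, -⟩ := h; simp at hp⟩)
  rw [List.nil_append] at hmA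
  push Not at hnQ
  have hmA' : m = (A ++ [q]) ++ D := by rw [hmA]; simp
  obtain ⟨x, hx, hx'⟩ := exists_half_turn (E₁ := beatingSet A (q :: D))
    (E₂ := beatingSet (A ++ [q]) D) (L₁ := beatingSet (q :: D) A) (L₂ := beatingSet D (A ++ [q]))
    (isOpen_beatingSet _ _) (isOpen_beatingSet _ _) (beatingSet_add_two_pi _ _)
    (beatingSet_add_two_pi _ _) (beatingSet_add_two_pi _ _)
    (fun θ ⟨p, hp, h⟩ => ⟨p, by simp [hp], fun r hr => h r (by simp [hr])⟩)
    (fun θ ⟨p, hp, h⟩ => ⟨p, by simp [hp], fun r hr => h r (by simp [hr])⟩)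
    (disjoint_beatingSet _ _)
    (notInterleaved_beatingSet fun p hp p' hp' r hr r' hr' =>
      disjoint_segment_of_isTwoOptimal (by rwa [← hmA]) (by rwa [← hmA]) (by rwa [← hmA])
        hp hp' hr hr')
    (notInterleaved_beatingSet fun p hp p' hp' r hr r' hr' =>
      disjoint_segment_of_isTwoOptimal (by rwa [← hmA']) (by rwa [← hmA']) (by rwa [← hmA'])
        hp hp' hr hr')
    hnQ hx₀ (dense_beatingSet_union (by rwa [← hmA']) (by rwa [← hmA']))
  have hcov : ∀ θ ∈ Set.Icc (x + π / 2 - π / 2) (x + π / 2 + π / 2), ∃ p ∈ A ++ [q],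
      planarSupport X hX θ ≤ height θ p := by
    intro θ hθ
    obtain ⟨r, hr, h⟩ := hm θ
    rw [hmA', List.mem_append] at hr
    rcases hr with hr | hr
    · exact ⟨r, hr, h⟩
    · have h1 := hx θ ⟨by linarith [hθ.1], by linarith [hθ.2]⟩
      simp only [beatingSet, Set.mem_ofPred_eq, not_exists, not_and, not_forall, not_lt] at h1
      obtain ⟨p, hp, hpr⟩ := h1 r hr
      exact ⟨p, hp, h.trans hpr⟩
  have hcov' : ∀ θ ∈ Set.Icc (x + π / 2 + π - π / 2) (x + π / 2 + π + π / 2),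
      ∃ p ∈ D.reverse ++ [q], planarSupport X hX θ ≤ height θ p := by
    intro θ hθ
    obtain ⟨r, hr, h⟩ := hm θ
    rw [hmA, List.mem_append] at hr
    rcases hr with hr | hr
    · have h1 := hx' θ ⟨by linarith [hθ.1], by linarith [hθ.2]⟩
      simp only [beatingSet, Set.mem_ofPred_eq, not_exists, not_and, not_forall, not_lt] at h1
      obtain ⟨p, hp, hpr⟩ := h1 r hr
      refine ⟨p, ?_, h.trans hpr⟩
      simp only [List.mem_cons] at hp
      simp only [List.mem_append, List.mem_reverse, List.mem_singleton]
      tauto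
    · refine ⟨r, ?_, h⟩
      simp only [List.mem_cons] at hr
      simp only [List.mem_append, List.mem_reverse, List.mem_singleton]
      tauto
  have h1 := integral_half_le_pathLength_center (x + π / 2) hcov
  have h2 := integral_half_le_pathLength_center (x + π / 2 + π) hcov'
  have h3 : pathLength (D.reverse ++ [q]) = pathLength (q :: D) := by
    rw [← List.reverse_cons, pathLength_reverse]
  have h4 : pathLength m = pathLength (A ++ [q]) + pathLength (q :: D) := by
    rw [hmA, pathLength_append_cons]
  have hdiam : planarSupport X hX (x + π / 2) + planarSupport X hX (x + π / 2 + π) ≤ d := by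
    obtain ⟨p, hp, hp'⟩ := exists_height_eq_planarSupport X hX (x + π / 2)
    obtain ⟨r, hr, hr'⟩ := exists_height_eq_planarSupport X hX (x + π / 2 + π)
    rw [hp', hr', height_add_pi]
    have := height_le_norm (x + π / 2) (p - r)
    rw [height_sub] at this
    linarith [hd p hp r hr]
  -- The second half circle has the opposite centre, so the two height terms of q cancel in the sum.
  rw [h3, height_add_pi] at h2
  have hint : ∀ a b, IntervalIntegrable (planarSupport X hX) volume a b := fun a b =>
    (continuous_planarSupport X hX).intervalIntegrable a b
  have h5 := intervalIntegral.integral_add_adjacent_intervals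
    (hint (x + π / 2 - π / 2) (x + π / 2 + π / 2))
    (hint (x + π / 2 + π / 2) (x + π / 2 + π + π / 2))
  have hper : Function.Periodic (planarSupport X hX) (2 * π) := fun θ => by
    unfold planarSupport
    exact Finset.sup'_congr hX rfl fun p _ => height_add_two_pi θ p
  have h6 := hper.intervalIntegral_add_eq 0 x
  rw [zero_add] at h6
  rw [show x + π / 2 - π / 2 = x by ring, show x + π / 2 + π + π / 2 = x + 2 * π by ring] at h5
  rw [show x + π / 2 + π + π / 2 = x + 2 * π by ring,
    show x + π / 2 + π - π / 2 = x + π / 2 + π / 2 by ring] at h2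
  rw [show x + π / 2 - π / 2 = x by ring] at h1
  rw [h6, ← h5]
  linarith

/-! ### Integrals over the unit sphere -/

section Sphere

variable {E : Type*} [NormedAddCommGroup E] [InnerProductSpace ℝ E] [FiniteDimensional ℝ E]

lemma exists_orthonormalBasis_apply_zero {d : ℕ} [NeZero d] (hd : Module.finrank ℝ E = d) {e : E}
    (he : ‖e‖ = 1) : ∃ b : OrthonormalBasis (Fin d) ℝ E, b 0 = e := by
  obtain ⟨b, hb⟩ := Orthonormal.exists_orthonormalBasis_extension_of_card_eq (𝕜 := ℝ)
    (ι := Fin d) (v := fun _ => e) (s := {0}) (by simpa using hd) (by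
      rw [orthonormal_iff_ite]
      rintro ⟨i, hi⟩ ⟨j, hj⟩
      rw [Set.mem_singleton_iff] at hi hj
      subst hi hj
      simp [he])
  exact ⟨b, hb 0 rfl⟩

lemma exists_isometry_apply_eq {u v : E} (hu : ‖u‖ = 1) (hv : ‖v‖ = 1) :
    ∃ g : E ≃ₗᵢ[ℝ] E, g u = v := by
  have : Nontrivial E := ⟨⟨u, 0, fun h => by simp [h] at hu⟩⟩
  have : NeZero (Module.finrank ℝ E) := ⟨Module.finrank_pos.ne'⟩
  obtain ⟨b, hb⟩ := exists_orthonormalBasis_apply_zero (E := E) rfl hu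
  obtain ⟨c, hc⟩ := exists_orthonormalBasis_apply_zero (E := E) rfl hv
  refine ⟨b.equiv c (Equiv.refl _), ?_⟩
  rw [← hb, OrthonormalBasis.equiv_apply_basis, Equiv.refl_apply, hc]

variable [MeasurableSpace E] [BorelSpace E]

/-- Used with Gaussian weights, it turns integrals over the sphere into integrals over the whole
space, where isometry invariance and product structure are available. -/
lemma integral_polar [Nontrivial E] (F : E → ℝ) (ψ : ℝ → ℝ) :
    ∫ x : E, F (‖x‖⁻¹ • x) * ψ ‖x‖ =
      (∫ u : Metric.sphere (0 : E) 1, F u ∂(volume : Measure E).toSphere) *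
        ∫ r in Set.Ioi (0 : ℝ), r ^ (Module.finrank ℝ E - 1) * ψ r := by
  calc ∫ x : E, F (‖x‖⁻¹ • x) * ψ ‖x‖
      = ∫ x : ({(0 : E)}ᶜ : Set E), F (‖x.1‖⁻¹ • x.1) * ψ ‖x.1‖
          ∂((volume : Measure E).comap (↑)) := by
        rw [integral_subtype_comap (measurableSet_singleton _).compl
          fun x : E => F (‖x‖⁻¹ • x) * ψ ‖x‖, restrict_compl_singleton]
    _ = ∫ x : Metric.sphere (0 : E) 1 × Set.Ioi (0 : ℝ), F x.1 * ψ x.2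
          ∂((volume : Measure E).toSphere.prod (.volumeIoiPow (Module.finrank ℝ E - 1))) := by
        simpa using (volume : Measure E).measurePreserving_homeomorphUnitSphereProd.integral_comp
          (Homeomorph.measurableEmbedding _)
          (fun x : Metric.sphere (0 : E) 1 × Set.Ioi (0 : ℝ) => F x.1 * ψ x.2)
    _ = (∫ u : Metric.sphere (0 : E) 1, F u ∂(volume : Measure E).toSphere) *
          ∫ r : Set.Ioi (0 : ℝ), ψ r ∂(.volumeIoiPow (Module.finrank ℝ E - 1)) :=
        integral_prod_mul (fun u : Metric.sphere (0 : E) 1 => F u) fun r : Set.Ioi (0 : ℝ) => ψ r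
    _ = _ := by
        congr 1
        simp only [Measure.volumeIoiPow, ENNReal.ofReal]
        rw [integral_withDensity_eq_integral_smul
          (by exact (measurable_subtype_coe.pow_const _).real_toNNReal),
          integral_subtype_comap measurableSet_Ioi
            fun a => Real.toNNReal (a ^ (Module.finrank ℝ E - 1)) • ψ a]
        refine setIntegral_congr_fun measurableSet_Ioi fun x hx => ?_
        simp only [NNReal.smul_def, Real.coe_toNNReal _ (pow_nonneg (le_of_lt hx) _), smul_eq_mul]

lemma integral_pow_mul_exp_neg_sq (k : ℕ) :
    ∫ r in Set.Ioi (0 : ℝ), r ^ k * Real.exp (-r ^ 2) = Real.Gamma ((k + 1) / 2) / 2 := by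
  have h := integral_rpow_mul_exp_neg_rpow (p := 2) (q := k) (by norm_num)
    (by have : (0 : ℝ) ≤ k := Nat.cast_nonneg k
        linarith)
  simp only [Real.rpow_natCast, Real.rpow_two] at h
  rw [h]; ring

lemma integral_sphere_comp_isometry [Nontrivial E] (g : E ≃ₗᵢ[ℝ] E) (F : E → ℝ) :
    ∫ u : Metric.sphere (0 : E) 1, F (g u) ∂(volume : Measure E).toSphere =
      ∫ u : Metric.sphere (0 : E) 1, F u ∂(volume : Measure E).toSphere := by
  have h1 := integral_polar (E := E) (fun x => F (g x)) fun r => Real.exp (-r ^ 2)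
  have h2 := integral_polar (E := E) F fun r => Real.exp (-r ^ 2)
  have h3 : ∫ x : E, F (g (‖x‖⁻¹ • x)) * Real.exp (-‖x‖ ^ 2) =
      ∫ x : E, F (‖x‖⁻¹ • x) * Real.exp (-‖x‖ ^ 2) := by
    rw [← g.measurePreserving.integral_comp g.toHomeomorph.measurableEmbedding
      fun x => F (‖x‖⁻¹ • x) * Real.exp (-‖x‖ ^ 2)]
    simp
  rw [h1, h2, integral_pow_mul_exp_neg_sq] at h3
  exact mul_right_cancel₀ (by positivity) h3

lemma integral_sphere_neg [Nontrivial E] (F : E → ℝ) :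
    ∫ u : Metric.sphere (0 : E) 1, F (-u) ∂(volume : Measure E).toSphere =
      ∫ u : Metric.sphere (0 : E) 1, F u ∂(volume : Measure E).toSphere :=
  integral_sphere_comp_isometry (LinearIsometryEquiv.neg ℝ) F

lemma integral_abs_mul_exp_neg_sq : ∫ t : ℝ, |t| * Real.exp (-t ^ 2) = 1 := by
  have h := integral_comp_abs (f := fun t => t * Real.exp (-t ^ 2))
  have h1 := integral_pow_mul_exp_neg_sq 1
  simp only [pow_one] at h1
  simp only [sq_abs] at h
  rw [h, h1]
  norm_num

/-- The Gaussian factors over coordinates: the distinguished one contributes 1, each other one √π.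
-/
lemma integral_euclidean_abs_coord (d : ℕ) [NeZero d] :
    ∫ y : EuclideanSpace ℝ (Fin d), |y 0| * Real.exp (-‖y‖ ^ 2) =
      Real.sqrt Real.pi ^ (d - 1) := by
  rw [← (PiLp.volume_preserving_toLp (Fin d)).integral_comp
    (MeasurableEquiv.toLp 2 (Fin d → ℝ)).measurableEmbedding]
  obtain ⟨k, rfl⟩ := Nat.exists_eq_succ_of_ne_zero (NeZero.ne d)
  have h1 : ∀ y : Fin (k + 1) → ℝ, |(WithLp.toLp 2 y : EuclideanSpace ℝ (Fin (k + 1))) 0| *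
      Real.exp (-‖(WithLp.toLp 2 y : EuclideanSpace ℝ (Fin (k + 1)))‖ ^ 2) =
      ∏ i, (if i = 0 then |y i| * Real.exp (-y i ^ 2) else Real.exp (-y i ^ 2)) := by
    intro y
    rw [EuclideanSpace.norm_sq_eq, Fin.prod_univ_succ, Fin.sum_univ_succ, neg_add, Real.exp_add,
      ← Finset.sum_neg_distrib, Real.exp_sum]
    simp [Fin.succ_ne_zero, mul_assoc]
  simp only [h1]
  rw [integral_fintype_prod_volume_eq_prod
    (f := fun i (t : ℝ) => if i = 0 then |t| * Real.exp (-t ^ 2) else Real.exp (-t ^ 2)),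
    Fin.prod_univ_succ]
  have hg : ∫ t : ℝ, Real.exp (-t ^ 2) = Real.sqrt Real.pi := by
    simpa using integral_gaussian 1
  simp [Fin.succ_ne_zero, integral_abs_mul_exp_neg_sq, hg]

/-- The mean absolute value of a linear functional on the sphere. -/
lemma integral_sphere_abs_inner [Nontrivial E] (z : E) :
    ∫ u : Metric.sphere (0 : E) 1, |inner ℝ z (u : E)| ∂(volume : Measure E).toSphere =
      2 * Real.pi ^ (((Module.finrank ℝ E : ℝ) - 1) / 2) /
        Real.Gamma (((Module.finrank ℝ E : ℝ) + 1) / 2) * ‖z‖ := by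
  obtain ⟨d, hd⟩ : ∃ d, Module.finrank ℝ E = d := ⟨_, rfl⟩
  have hd0 : 0 < d := hd ▸ Module.finrank_pos
  have : NeZero d := ⟨hd0.ne'⟩
  rw [hd]
  rcases eq_or_ne z 0 with rfl | hz
  · simp
  have hz0 : ‖z‖ ≠ 0 := norm_ne_zero_iff.2 hz
  obtain ⟨b, hb⟩ := exists_orthonormalBasis_apply_zero hd (e := ‖z‖⁻¹ • z)
    (by rw [norm_smul, norm_inv, norm_norm, inv_mul_cancel₀ hz0])
  have hin : ∀ x : E, inner ℝ z x = ‖z‖ * (b.repr x) 0 := fun x => by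
    rw [b.repr_apply_apply, hb, real_inner_smul_left, ← mul_assoc, mul_inv_cancel₀ hz0, one_mul]
  have h1 := integral_polar (E := E) (fun x => |inner ℝ z x|) fun r => r * Real.exp (-r ^ 2)
  have h2 : ∫ x : E, |inner ℝ z (‖x‖⁻¹ • x)| * (‖x‖ * Real.exp (-‖x‖ ^ 2)) =
      ‖z‖ * Real.sqrt Real.pi ^ (d - 1) := by
    rw [← integral_euclidean_abs_coord, ← integral_const_mul,
      ← b.measurePreserving_repr.integral_comp b.repr.toHomeomorph.measurableEmbedding]
    refine integral_congr_ae (.of_forall fun x => ?_)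
    simp only [LinearIsometryEquiv.norm_map]
    rcases eq_or_ne x 0 with rfl | hx
    · simp
    rw [inner_smul_right, hin, abs_mul, abs_mul, abs_norm, abs_inv, abs_norm]
    have : ‖x‖ ≠ 0 := norm_ne_zero_iff.2 hx
    field_simp
  have h3 : ∫ r in Set.Ioi (0 : ℝ), r ^ (Module.finrank ℝ E - 1) * (r * Real.exp (-r ^ 2)) =
      Real.Gamma (((d : ℝ) + 1) / 2) / 2 := by
    rw [← integral_pow_mul_exp_neg_sq, hd]
    refine integral_congr_ae (.of_forall fun r => ?_)
    simp only
    rw [← mul_assoc, ← pow_succ, Nat.sub_add_cancel hd0]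
  have h4 : Real.sqrt Real.pi ^ (d - 1) = Real.pi ^ (((d : ℝ) - 1) / 2) := by
    rw [Real.sqrt_eq_rpow, ← Real.rpow_natCast, ← Real.rpow_mul Real.pi_pos.le,
      Nat.cast_sub (Nat.one_le_iff_ne_zero.2 hd0.ne')]
    congr 1
    push_cast; ring
  rw [h2, h3, h4] at h1
  have hG : 0 < Real.Gamma (((d : ℝ) + 1) / 2) := Real.Gamma_pos_of_pos (by positivity)
  field_simp
  linarith

lemma toSphere_real_univ [Nontrivial E] :
    (volume : Measure E).toSphere.real Set.univ =
      2 * Real.pi ^ ((Module.finrank ℝ E : ℝ) / 2) / Real.Gamma ((Module.finrank ℝ E : ℝ) / 2) := by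
  have hd : (0 : ℝ) < Module.finrank ℝ E := by exact_mod_cast Module.finrank_pos
  have hG : 0 < Real.Gamma ((Module.finrank ℝ E : ℝ) / 2) := Real.Gamma_pos_of_pos (by positivity)
  rw [Measure.toSphere_real_apply_univ, Measure.real, InnerProductSpace.volume_ball,
    Real.Gamma_add_one (by positivity), ENNReal.toReal_mul, ENNReal.toReal_ofReal (by positivity),
    Real.sqrt_eq_rpow, ← Real.rpow_natCast, ← Real.rpow_mul Real.pi_pos.le]
  simp
  field_simp

end Sphere

/-! ### Averaging over the orthogonal group -/

section Unitary

variable {E : Type*} [NormedAddCommGroup E] [InnerProductSpace ℝ E] [CompleteSpace E]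

lemma norm_inv_apply (g : unitary (E →L[ℝ] E)) (x : E) :
    ‖((g⁻¹ : unitary (E →L[ℝ] E)) : E →L[ℝ] E) x‖ = ‖x‖ := Unitary.norm_map _ x

lemma continuous_inv_apply {α : Type*} [TopologicalSpace α] {F : E → ℝ} (hF : Continuous F)
    {v : α → E} (hv : Continuous v) :
    Continuous (Function.uncurry fun (a : α) (g : unitary (E →L[ℝ] E)) =>
      F (((g⁻¹ : unitary (E →L[ℝ] E)) : E →L[ℝ] E) (v a))) := by
  refine hF.comp (Continuous.clm_apply ?_ (hv.comp continuous_fst))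
  exact continuous_subtype_val.comp (continuous_inv.comp continuous_snd)

end Unitary

section Average

variable {E : Type*} [NormedAddCommGroup E] [InnerProductSpace ℝ E] [FiniteDimensional ℝ E]

lemma exists_bound_of_continuous {F : E → ℝ} (hF : Continuous F) :
    ∃ C, ∀ x, ‖x‖ = 1 → ‖F x‖ ≤ C := by
  have : ProperSpace E := FiniteDimensional.proper ℝ _
  obtain ⟨C, hC⟩ := (isCompact_closedBall (0 : E) 1).exists_bound_of_continuousOn hF.continuousOn
  exact ⟨C, fun x hx => hC x (by simp [hx])⟩

variable [CompleteSpace E]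

instance compactSpace_unitary : CompactSpace (unitary (E →L[ℝ] E)) := by
  have : ProperSpace (E →L[ℝ] E) := FiniteDimensional.proper ℝ _
  refine (isCompact_iff_compactSpace (s := (unitary (E →L[ℝ] E) : Set (E →L[ℝ] E)))).1 ?_
  refine Metric.isCompact_of_isClosed_isBounded isClosed_unitary ?_
  refine (Metric.isBounded_closedBall (x := (0 : E →L[ℝ] E)) (r := 1)).subset fun g hg => ?_
  rw [mem_closedBall_zero_iff]
  refine ContinuousLinearMap.opNorm_le_bound _ zero_le_one fun x => ?_
  rw [one_mul]
  exact (Unitary.norm_map ⟨g, hg⟩ x).le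

lemma integrable_inv_apply {α : Type*} [TopologicalSpace α] [MeasurableSpace α]
    [OpensMeasurableSpace α] [SecondCountableTopology α] (ν : Measure α) [IsFiniteMeasure ν]
    (μ : Measure (unitary (E →L[ℝ] E))) [IsFiniteMeasure μ]
    {F : E → ℝ} (hF : Continuous F) {v : α → E} (hv : Continuous v) (hv1 : ∀ a, ‖v a‖ = 1) :
    Integrable (Function.uncurry fun (a : α) (g : unitary (E →L[ℝ] E)) =>
      F (((g⁻¹ : unitary (E →L[ℝ] E)) : E →L[ℝ] E) (v a))) (ν.prod μ) := by
  obtain ⟨C, hC⟩ := exists_bound_of_continuous hF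
  refine Integrable.of_bound (continuous_inv_apply hF hv).aestronglyMeasurable C
    (.of_forall fun x => hC _ ?_)
  rw [norm_inv_apply, hv1]

variable [MeasurableSpace E] [BorelSpace E]

/-- The Haar average of F(g⁻¹ u) does not depend on the unit vector u, because isometries act
transitively on the sphere. Integrating over u and swapping the integrals identifies it with the
mean over the sphere. -/
lemma exists_sphere_average [Nontrivial E] :
    ∃ μ : Measure (unitary (E →L[ℝ] E)), IsProbabilityMeasure μ ∧ ∀ F : E → ℝ, Continuous F →
      ∀ u : E, ‖u‖ = 1 → (volume : Measure E).toSphere.real Set.univ *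
        ∫ g, F (((g⁻¹ : unitary (E →L[ℝ] E)) : E →L[ℝ] E) u) ∂μ =
      ∫ v : Metric.sphere (0 : E) 1, F v ∂(volume : Measure E).toSphere := by
  set μ : Measure (unitary (E →L[ℝ] E)) := Measure.haarMeasure ⊤ with hμ
  have hprob : IsProbabilityMeasure μ := ⟨by
    simpa using Measure.haarMeasure_self (K₀ := (⊤ :
      TopologicalSpace.PositiveCompacts (unitary (E →L[ℝ] E))))⟩
  refine ⟨μ, hprob, fun F hF u hu => ?_⟩
  have hconst : ∀ v : Metric.sphere (0 : E) 1,
      ∫ g, F (((g⁻¹ : unitary (E →L[ℝ] E)) : E →L[ℝ] E) v) ∂μ =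
        ∫ g, F (((g⁻¹ : unitary (E →L[ℝ] E)) : E →L[ℝ] E) u) ∂μ := by
    intro v
    obtain ⟨k, hk⟩ := exists_isometry_apply_eq hu (show ‖(v : E)‖ = 1 by simp)
    set k' : unitary (E →L[ℝ] E) := Unitary.linearIsometryEquiv.symm k with hk'
    -- Left translation by k'⁻¹ becomes right multiplication by k' after inversion, and k' maps u to
    -- v; this is why g⁻¹ appears.
    rw [← integral_mul_left_eq_self
      (fun g : unitary (E →L[ℝ] E) => F (((g⁻¹ : unitary (E →L[ℝ] E)) : E →L[ℝ] E) u)) k'⁻¹]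
    refine integral_congr_ae (.of_forall fun g => ?_)
    simp only
    rw [mul_inv_rev, inv_inv, ← hk]
    rfl
  have hswap := integral_integral_swap (μ := (volume : Measure E).toSphere) (ν := μ)
    (integrable_inv_apply (volume : Measure E).toSphere μ hF
      (continuous_subtype_val (p := fun x => x ∈ Metric.sphere (0 : E) 1)) (fun v => by simp))
  simp only [hconst, integral_const, smul_eq_mul] at hswap
  rw [hswap]
  have hinv : ∀ g : unitary (E →L[ℝ] E), ∫ v : Metric.sphere (0 : E) 1,
      F (((g⁻¹ : unitary (E →L[ℝ] E)) : E →L[ℝ] E) v) ∂(volume : Measure E).toSphere =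
      ∫ v : Metric.sphere (0 : E) 1, F v ∂(volume : Measure E).toSphere := fun g =>
    integral_sphere_comp_isometry (Unitary.linearIsometryEquiv g⁻¹) F
  simp [hinv]

open Real in
/-- An inequality between integrals over great circles passes to integrals over the sphere. -/
lemma integral_sphere_le_of_circle [Nontrivial E] {F₁ F₂ : E → ℝ} (h₁ : Continuous F₁)
    (h₂ : Continuous F₂) {v : ℝ → E} (hv : Continuous v) (hv1 : ∀ θ, ‖v θ‖ = 1) {d : ℝ}
    (h : ∀ g : E ≃ₗᵢ[ℝ] E, ∫ θ in (0 : ℝ)..(2 * π), F₁ (g (v θ)) ≤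
      (∫ θ in (0 : ℝ)..(0 + π), F₂ (g (v θ))) / 2 + d) :
    2 * π * ∫ u : Metric.sphere (0 : E) 1, F₁ u ∂(volume : Measure E).toSphere ≤
      π / 2 * (∫ u : Metric.sphere (0 : E) 1, F₂ u ∂(volume : Measure E).toSphere) +
        (volume : Measure E).toSphere.real Set.univ * d := by
  obtain ⟨μ, hμ, hav⟩ := exists_sphere_average (E := E)
  set ω := (volume : Measure E).toSphere.real Set.univ
  have hfin : ∀ c : ℝ, IsFiniteMeasure ((volume : Measure ℝ).restrict (Set.uIoc 0 c)) := fun c => by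
    rw [Set.uIoc]; infer_instance
  have key : ∀ F : E → ℝ, Continuous F → ∀ c : ℝ, ω * ∫ g, (∫ θ in (0 : ℝ)..c,
      F (((g⁻¹ : unitary (E →L[ℝ] E)) : E →L[ℝ] E) (v θ))) ∂μ =
      c * ∫ u : Metric.sphere (0 : E) 1, F u ∂(volume : Measure E).toSphere := by
    intro F hF c
    rw [← intervalIntegral_integral_swap (integrable_inv_apply _ μ hF hv hv1),
      ← intervalIntegral.integral_const_mul]
    simp [hav F hF _ (hv1 _)]
  have hint : ∀ F : E → ℝ, Continuous F → ∀ c : ℝ, Integrable (fun g : unitary (E →L[ℝ] E) =>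
      ∫ θ in (0 : ℝ)..c, F (((g⁻¹ : unitary (E →L[ℝ] E)) : E →L[ℝ] E) (v θ))) μ := by
    intro F hF c
    have := (integrable_inv_apply (volume.restrict (Set.uIoc 0 c)) μ hF hv hv1).integral_prod_right
    simp only [Function.uncurry] at this
    simp only [intervalIntegral.intervalIntegral_eq_integral_uIoc]
    exact Integrable.smul (if (0 : ℝ) ≤ c then (1 : ℝ) else -1) this
  have hle := integral_mono (hint F₁ h₁ (2 * π)) (((hint F₂ h₂ (0 + π)).div_const 2).add
    (integrable_const d)) (fun g => h (Unitary.linearIsometryEquiv g⁻¹))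
  have hω : 0 ≤ ω := measureReal_nonneg
  have h3 := mul_le_mul_of_nonneg_left hle hω
  rw [key F₁ h₁] at h3
  simp only [Pi.add_apply] at h3
  rw [integral_add ((hint F₂ h₂ (0 + π)).div_const 2) (integrable_const d), integral_div, mul_add,
    ← mul_div_assoc, key F₂ h₂] at h3
  simp only [integral_const, probReal_univ, one_smul, zero_add] at h3
  linarith

end Average

/-! ### The inequality for finite sets and polygonal paths -/

section FiniteSets

variable {E : Type*} [NormedAddCommGroup E] [InnerProductSpace ℝ E]

lemma exists_inner_le_of_mem_convexHull {S : Set E} {x : E} (hx : x ∈ convexHull ℝ S) (u : E) :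
    ∃ p ∈ S, inner ℝ x u ≤ inner ℝ p u := by
  by_contra! hcon
  have hconv : Convex ℝ {y : E | inner ℝ y u < inner ℝ x u} :=
    convex_halfSpace_lt ⟨fun a b => inner_add_left a b u, fun c a => real_inner_smul_left a u c⟩ _
  have h : x ∈ {y : E | inner ℝ y u < inner ℝ x u} :=
    convexHull_min (s := S) (fun p hp => hcon p hp) hconv hx
  exact lt_irrefl (inner ℝ x u : ℝ) h

lemma continuous_pathLength_inner (l : List E) :
    Continuous fun u : E => pathLength (l.map fun p => inner ℝ p u) := by
  induction l with
  | nil => simp only [List.map_nil, pathLength_nil]; fun_prop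
  | cons x l ih =>
    cases l with
    | nil => simp only [List.map_cons, List.map_nil, pathLength_singleton]; fun_prop
    | cons y l =>
      simp only [List.map_cons, pathLength_cons_cons] at ih ⊢
      exact Continuous.add (by fun_prop) ih

variable [FiniteDimensional ℝ E] [MeasurableSpace E] [BorelSpace E]

lemma integrable_sphere {F : E → ℝ} (hF : Continuous F) :
    Integrable (fun u : Metric.sphere (0 : E) 1 => F u) (volume : Measure E).toSphere := by
  obtain ⟨C, hC⟩ := exists_bound_of_continuous hF
  exact Integrable.of_bound (hF.comp continuous_subtype_val).aestronglyMeasurable C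
    (.of_forall fun x => hC _ (by simp))

variable [Nontrivial E]

lemma integral_sphere_pathLength_inner (l : List E) :
    ∫ u : Metric.sphere (0 : E) 1, pathLength (l.map fun p => inner ℝ p (u : E))
        ∂(volume : Measure E).toSphere =
      2 * Real.pi ^ (((Module.finrank ℝ E : ℝ) - 1) / 2) /
        Real.Gamma (((Module.finrank ℝ E : ℝ) + 1) / 2) * pathLength l := by
  induction l with
  | nil => simp
  | cons x l ih =>
    cases l with
    | nil => simp
    | cons y l =>
      simp only [List.map_cons, pathLength_cons_cons] at ih ⊢
      have h1 : Continuous fun u : E => ‖(inner ℝ y u - inner ℝ x u : ℝ)‖ := by fun_prop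
      have h2 := continuous_pathLength_inner (y :: l)
      simp only [List.map_cons] at h2
      rw [integral_add (integrable_sphere h1) (integrable_sphere h2), ih, mul_add,
        ← integral_sphere_abs_inner]
      simp only [inner_sub_left, Real.norm_eq_abs]

variable [CompleteSpace E]

open Real in
/-- The mean width of a finite set is controlled by the length of any path whose convex hull
contains the set, and by the diameter of the set. -/
theorem integral_sphere_sup_inner_le (hdim : 2 ≤ Module.finrank ℝ E) {X : Finset E}
    (hX : X.Nonempty) {l : List E} (hl : (X : Set E) ⊆ convexHull ℝ {p | p ∈ l}) {d : ℝ}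
    (hd : ∀ x ∈ X, ∀ y ∈ X, ‖x - y‖ ≤ d) :
    ∫ u : Metric.sphere (0 : E) 1, X.sup' hX (fun x => inner ℝ x (u : E))
        ∂(volume : Measure E).toSphere ≤
      π ^ (((Module.finrank ℝ E : ℝ) - 1) / 2) /
        (2 * Gamma (((Module.finrank ℝ E : ℝ) + 1) / 2)) * pathLength l +
      π ^ ((Module.finrank ℝ E : ℝ) / 2 - 1) / Gamma ((Module.finrank ℝ E : ℝ) / 2) * d := by
  classical
  have hF₁ : Continuous fun u : E => X.sup' hX (fun x => inner ℝ x u) :=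
    Continuous.finset_sup'_apply hX fun p _ => by fun_prop
  set b := stdOrthonormalBasis ℝ E
  set e₁ : E := b ⟨0, by omega⟩ with he₁
  set e₂ : E := b ⟨1, by omega⟩ with he₂
  have h11 : inner ℝ e₁ e₁ = (1 : ℝ) := by rw [b.inner_eq_one]
  have h22 : inner ℝ e₂ e₂ = (1 : ℝ) := by rw [b.inner_eq_one]
  have h12 : inner ℝ e₁ e₂ = (0 : ℝ) := b.inner_eq_zero (by simp)
  have h21 : inner ℝ e₂ e₁ = (0 : ℝ) := b.inner_eq_zero (by simp)
  set v : ℝ → E := fun θ => cos θ • e₁ + sin θ • e₂ with hv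
  have hv1 : ∀ θ, ‖v θ‖ = 1 := fun θ => by
    have : ‖v θ‖ ^ 2 = 1 := by
      rw [← real_inner_self_eq_norm_sq, hv]
      simp only [inner_add_left, inner_add_right, real_inner_smul_left, real_inner_smul_right,
        h11, h12, h21, h22]
      linear_combination sin_sq_add_cos_sq θ
    exact (pow_eq_one_iff_of_nonneg (norm_nonneg _) two_ne_zero).1 this
  have hmain := integral_sphere_le_of_circle hF₁ (continuous_pathLength_inner l)
    (v := v) (by fun_prop) hv1 (d := d) (fun g => by
      -- T is the orthogonal projection to the plane of the great circle g ∘ v, in coordinates; it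
      -- does not increase distances.
      set T : E → ℂ := fun p => ⟨inner ℝ p (g e₁), inner ℝ p (g e₂)⟩ with hT
      have hh : ∀ θ p, height θ (T p) = inner ℝ p (g (v θ)) := fun θ p => by
        simp only [height, hT, hv, map_add, map_smul, inner_add_right, real_inner_smul_right]
        ring
      have hY : (X.image T).Nonempty := hX.image _
      have hsup : ∀ θ, planarSupport (X.image T) hY θ =
          X.sup' hX (fun x => inner ℝ x (g (v θ))) := fun θ => by
        unfold planarSupport
        rw [Finset.sup'_image]
        exact Finset.sup'_congr hX rfl fun p _ => hh θ p
      have hpl : ∀ θ, pathLength ((l.map T).map (height θ)) =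
          pathLength (l.map fun p => inner ℝ p (g (v θ))) := fun θ => by
        rw [List.map_map]
        congr 1
        exact List.map_congr_left fun p _ => hh θ p
      have hcov : ∀ θ, ∃ p ∈ l.map T, planarSupport (X.image T) hY θ ≤ height θ p := by
        intro θ
        obtain ⟨x, hx, hxe⟩ := Finset.exists_mem_eq_sup' hX (fun x => inner ℝ x (g (v θ)))
        obtain ⟨p, hp, hxp⟩ := exists_inner_le_of_mem_convexHull (hl hx) (g (v θ))
        refine ⟨T p, List.mem_map_of_mem hp, ?_⟩
        rw [hsup, hh, hxe]
        exact hxp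
      have hdiam : ∀ x ∈ X.image T, ∀ y ∈ X.image T, ‖x - y‖ ≤ d := by
        intro x hx y hy
        obtain ⟨x, hxX, rfl⟩ := Finset.mem_image.1 hx
        obtain ⟨y, hyX, rfl⟩ := Finset.mem_image.1 hy
        obtain ⟨φ, hφ⟩ := exists_height_eq (T x - T y)
        have h1 := hφ φ
        rw [sub_self, cos_zero, mul_one, height_sub, hh, hh, ← inner_sub_left] at h1
        rw [← h1]
        refine (real_inner_le_norm _ _).trans ?_
        rw [g.norm_map, hv1, mul_one]
        exact hd x hxX y hyX
      have h1 := integral_planarSupport_le hcov hdiam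
      have h2 := integral_pathLength_height 0 (l.map T)
      simp only [hsup] at h1
      simp only [hpl] at h2
      rw [h2]
      linarith)
  rw [integral_sphere_pathLength_inner, toSphere_real_univ] at hmain
  have hπ := pi_pos
  have hpow : π ^ ((Module.finrank ℝ E : ℝ) / 2) = π ^ ((Module.finrank ℝ E : ℝ) / 2 - 1) * π := by
    rw [← rpow_add_one hπ.ne']; congr 1; ring
  rw [hpow] at hmain
  have h3 : 0 < 2 * π := by positivity
  refine le_of_mul_le_mul_left (hmain.trans_eq ?_) h3
  have hG : 0 < Gamma (((Module.finrank ℝ E : ℝ) + 1) / 2) := Gamma_pos_of_pos (by positivity)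
  have hG' : 0 < Gamma ((Module.finrank ℝ E : ℝ) / 2) := Gamma_pos_of_pos (by
    have : (2 : ℝ) ≤ Module.finrank ℝ E := by exact_mod_cast hdim
    linarith)
  field_simp

end FiniteSets

/-! ### Support functions of convex bodies -/

section SupportFunction

variable {n : ℕ} (K : ConvexBody (EuclideanSpace ℝ (Fin n)))

lemma isCompact_inner_image (u : EuclideanSpace ℝ (Fin n)) :
    IsCompact ((fun x : EuclideanSpace ℝ (Fin n) => (inner ℝ x u : ℝ)) ''
      (K : Set (EuclideanSpace ℝ (Fin n)))) :=
  K.isCompact.image (by fun_prop)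

variable {K} in
lemma inner_le_supportFunction {x : EuclideanSpace ℝ (Fin n)} (hx : x ∈ K)
    (u : EuclideanSpace ℝ (Fin n)) : inner ℝ x u ≤ supportFunction K u :=
  le_csSup (isCompact_inner_image K u).bddAbove ⟨x, hx, rfl⟩

lemma exists_supportFunction_eq (u : EuclideanSpace ℝ (Fin n)) :
    ∃ x ∈ K, supportFunction K u = inner ℝ x u := by
  obtain ⟨x, hx, h⟩ := (isCompact_inner_image K u).sSup_mem (K.nonempty.image _)
  exact ⟨x, hx, h.symm⟩

lemma exists_norm_le_of_mem : ∃ R : ℝ, 0 ≤ R ∧ ∀ x ∈ K, ‖x‖ ≤ R := by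
  obtain ⟨R, hR⟩ := K.isBounded.exists_norm_le
  exact ⟨max R 0, le_max_right _ _, fun x hx => (hR x hx).trans (le_max_left _ _)⟩

lemma supportFunction_le_add {R : ℝ} (hR : ∀ x ∈ K, ‖x‖ ≤ R) (u v : EuclideanSpace ℝ (Fin n)) :
    supportFunction K u ≤ supportFunction K v + R * ‖u - v‖ := by
  obtain ⟨x, hx, h⟩ := exists_supportFunction_eq K u
  have h1 := inner_le_supportFunction hx v
  have h2 := real_inner_le_norm x (u - v)
  have h3 := mul_le_mul_of_nonneg_right (hR x hx) (norm_nonneg (u - v))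
  rw [inner_sub_right] at h2
  linarith

lemma continuous_supportFunction : Continuous (supportFunction K) := by
  obtain ⟨R, hR0, hR⟩ := exists_norm_le_of_mem K
  exact (LipschitzWith.of_le_add_mul ⟨R, hR0⟩ fun u v => by
    rw [dist_eq_norm]; exact supportFunction_le_add K hR u v).continuous

lemma norm_eq_integral_supportFunction [Nontrivial (EuclideanSpace ℝ (Fin n))] :
    ConvexCover.norm K = ∫ u : Metric.sphere (0 : EuclideanSpace ℝ (Fin n)) 1,
      supportFunction K u ∂(volume : Measure (EuclideanSpace ℝ (Fin n))).toSphere := by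
  have h := continuous_supportFunction K
  have h' : Continuous fun u => supportFunction K (-u) := h.comp continuous_neg
  unfold ConvexCover.norm widthFunction
  rw [integral_add (integrable_sphere h) (integrable_sphere h'),
    integral_sphere_neg]
  ring

end SupportFunction

/-! ### From finite sets and polygons to bodies and curves -/

lemma pathLength_map_le_eVariationOn {E : Type*} [NormedAddCommGroup E] {φ : ℝ → E} {a b : ℝ}
    {l : List ℝ} (hl : l.Pairwise (· ≤ ·)) (hmem : ∀ t ∈ l, a ≤ t ∧ t ≤ b) :
    ENNReal.ofReal (pathLength (l.map φ)) ≤ eVariationOn φ (Set.Icc a b) := by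
  induction l generalizing a with
  | nil => simp
  | cons s l ih =>
    cases l with
    | nil => simp
    | cons t l =>
      have hst : s ≤ t := (List.pairwise_cons.1 hl).1 t (by simp)
      have h1 := ih (a := t) (List.pairwise_cons.1 hl).2 (fun r hr => by
        refine ⟨?_, (hmem r (by simp at hr ⊢; tauto)).2⟩
        rcases List.mem_cons.1 hr with rfl | hr
        · exact le_rfl
        · exact (List.pairwise_cons.1 (List.pairwise_cons.1 hl).2).1 r hr)
      have hs := hmem s (by simp)
      have ht := hmem t (by simp)
      have h2 : ENNReal.ofReal ‖φ t - φ s‖ ≤ eVariationOn φ (Set.Icc a t) := by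
        rw [← dist_eq_norm, ← edist_dist]
        exact eVariationOn.edist_le φ ⟨ht.1, le_rfl⟩ ⟨hs.1, hst⟩
      have h3 := eVariationOn.Icc_add_Icc φ (s := Set.univ) ht.1 ht.2 (Set.mem_univ _)
      simp only [Set.univ_inter] at h3
      simp only [List.map_cons, pathLength_cons_cons] at h1 ⊢
      rw [ENNReal.ofReal_add (norm_nonneg _) (pathLength_nonneg _), ← h3]
      exact add_le_add h2 h1

/-- Each point of a convex hull uses only finitely many points of the curve. Sorting their times
makes the polygon inscribed, so that its length is bounded by the variation. -/
lemma exists_sorted_times {E : Type*} [NormedAddCommGroup E] [NormedSpace ℝ E] {φ : ℝ → E}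
    {a b : ℝ} {X : Finset E} (hX : (X : Set E) ⊆ convexHull ℝ (φ '' Set.Icc a b)) :
    ∃ l : List ℝ, l.Pairwise (· ≤ ·) ∧ (∀ t ∈ l, a ≤ t ∧ t ≤ b) ∧
      (X : Set E) ⊆ convexHull ℝ {p | p ∈ l.map φ} := by
  classical
  have h1 : ∀ x ∈ X, ∃ T : Finset ℝ, (∀ t ∈ T, a ≤ t ∧ t ≤ b) ∧ x ∈ convexHull ℝ (φ '' T) := by
    intro x hx
    have hx' := hX hx
    rw [convexHull_eq_union_convexHull_finite_subsets] at hx'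
    simp only [Set.mem_iUnion] at hx'
    obtain ⟨P, hP, hxP⟩ := hx'
    obtain ⟨T, hT, hTP⟩ := Finset.subset_set_image_iff.1 hP
    exact ⟨T, fun t ht => hT ht, by rw [← Finset.coe_image, hTP]; exact hxP⟩
  choose! T hT hTx using h1
  refine ⟨(X.biUnion T).sort (· ≤ ·), Finset.pairwise_sort _ _, fun t ht => ?_, fun x hx => ?_⟩
  · rw [Finset.mem_sort, Finset.mem_biUnion] at ht
    obtain ⟨x, hx, ht⟩ := ht
    exact hT x hx t ht
  · refine convexHull_mono ?_ (hTx x hx)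
    rintro p ⟨t, ht, rfl⟩
    exact List.mem_map_of_mem ((Finset.mem_sort _).2 (Finset.mem_biUnion.2 ⟨x, hx, ht⟩))

open Real in
theorem norm_le_of_eVariationOn_ne_top {n : ℕ} (hn : 2 ≤ n)
    (K : ConvexBody (EuclideanSpace ℝ (Fin n))) {a b : ℝ} {φ : ℝ → EuclideanSpace ℝ (Fin n)}
    (hK : (K : Set (EuclideanSpace ℝ (Fin n))) ⊆ convexHull ℝ (φ '' Set.Icc a b))
    (hφ : eVariationOn φ (Set.Icc a b) ≠ ⊤) :
    ConvexCover.norm K ≤ π ^ (((n : ℝ) - 1) / 2) / (2 * Gamma (((n : ℝ) + 1) / 2)) *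
        (eVariationOn φ (Set.Icc a b)).toReal +
      π ^ ((n : ℝ) / 2 - 1) / Gamma ((n : ℝ) / 2) *
        Metric.diam (K : Set (EuclideanSpace ℝ (Fin n))) := by
  classical
  have hdim : Module.finrank ℝ (EuclideanSpace ℝ (Fin n)) = n := finrank_euclideanSpace_fin
  have : Nontrivial (EuclideanSpace ℝ (Fin n)) :=
    Module.nontrivial_of_finrank_pos (R := ℝ) (by omega)
  rw [norm_eq_integral_supportFunction]
  set ω := (volume : Measure (EuclideanSpace ℝ (Fin n))).toSphere.real Set.univ with hω
  have hω0 : 0 ≤ ω := measureReal_nonneg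
  refine le_of_forall_pos_le_add fun ε hε => ?_
  -- Passing from K to a δ-net lowers the support function by at most δ, hence its integral by at
  -- most ω δ.
  obtain ⟨δ, hδ, hδε⟩ : ∃ δ : ℝ, 0 < δ ∧ ω * δ ≤ ε := by
    refine ⟨ε / (ω + 1), by positivity, ?_⟩
    rw [mul_div_assoc', div_le_iff₀ (by positivity)]
    nlinarith
  obtain ⟨Y, hYK, hYf, hKY⟩ := K.isCompact.finite_cover_balls hδ
  set X := hYf.toFinset with hXdef
  have hXK : ∀ x ∈ X, x ∈ K := fun x hx => hYK (hYf.mem_toFinset.1 hx)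
  have hnet : ∀ y ∈ K, ∃ x ∈ X, ‖y - x‖ ≤ δ := fun y hy => by
    obtain ⟨x, hx, hyx⟩ := Set.mem_iUnion₂.1 (hKY hy)
    exact ⟨x, hYf.mem_toFinset.2 hx, by rw [← dist_eq_norm]; exact (Metric.mem_ball.1 hyx).le⟩
  have hX : X.Nonempty := by
    obtain ⟨y, hy⟩ := K.nonempty
    obtain ⟨x, hx, -⟩ := hnet y hy
    exact ⟨x, hx⟩
  obtain ⟨l, hsort, hlmem, hl⟩ := exists_sorted_times (X := X) (φ := φ) (a := a) (b := b)
    (fun x hx => hK (hXK x hx))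
  have hmain := integral_sphere_sup_inner_le (by omega) hX hl
    (d := Metric.diam (K : Set (EuclideanSpace ℝ (Fin n)))) (fun x hx y hy => by
      rw [← dist_eq_norm]
      exact Metric.dist_le_diam_of_mem K.isBounded (hXK x hx) (hXK y hy))
  rw [hdim] at hmain
  have hlen : pathLength (l.map φ) ≤ (eVariationOn φ (Set.Icc a b)).toReal :=
    (ENNReal.ofReal_le_iff_le_toReal hφ).1 (pathLength_map_le_eVariationOn hsort hlmem)
  have hcont : Continuous fun u : EuclideanSpace ℝ (Fin n) =>
      X.sup' hX (fun x => (inner ℝ x u : ℝ)) + δ :=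
    (Continuous.finset_sup'_apply hX fun p _ => by fun_prop).add continuous_const
  have hcont' : Continuous fun u : EuclideanSpace ℝ (Fin n) =>
      X.sup' hX (fun x => (inner ℝ x u : ℝ)) :=
    Continuous.finset_sup'_apply hX fun p _ => by fun_prop
  have happrox := integral_mono (integrable_sphere (continuous_supportFunction K))
    (integrable_sphere hcont) (fun u => by
      obtain ⟨y, hy, hyu⟩ := exists_supportFunction_eq K (u : EuclideanSpace ℝ (Fin n))
      obtain ⟨x, hx, hyx⟩ := hnet y hy
      have h1 := real_inner_le_norm (y - x) (u : EuclideanSpace ℝ (Fin n))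
      rw [show ‖(u : EuclideanSpace ℝ (Fin n))‖ = 1 by simp, mul_one, inner_sub_left] at h1
      have h2 := Finset.le_sup' (fun x => (inner ℝ x (u : EuclideanSpace ℝ (Fin n)) : ℝ)) hx
      simp only at h2 ⊢
      linarith)
  rw [integral_add (integrable_sphere hcont') (integrable_const _), integral_const,
    smul_eq_mul] at happrox
  have hn' : (2 : ℝ) ≤ n := by exact_mod_cast hn
  have hG : 0 < Gamma (((n : ℝ) + 1) / 2) := Gamma_pos_of_pos (by positivity)
  have hc : 0 ≤ π ^ (((n : ℝ) - 1) / 2) / (2 * Gamma (((n : ℝ) + 1) / 2)) := by positivity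
  have h5 := mul_le_mul_of_nonneg_left hlen hc
  linarith

/-! ### Volumes of sums with segments -/

/-- A nonnegative additive function on the half-line is linear. -/
lemma eq_mul_of_additive {F : ℝ → ℝ} (hadd : ∀ s t, 0 ≤ s → 0 ≤ t → F (s + t) = F s + F t)
    (hpos : ∀ t, 0 ≤ t → 0 ≤ F t) {t : ℝ} (ht : 0 ≤ t) : F t = t * F 1 := by
  have hmono : ∀ s t, 0 ≤ s → s ≤ t → F s ≤ F t := fun s t hs hst => by
    have := hadd s (t - s) hs (by linarith)
    rw [add_sub_cancel] at this
    linarith [hpos (t - s) (by linarith)]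
  have h0 : F 0 = 0 := by
    have := hadd 0 0 le_rfl le_rfl
    rw [add_zero] at this
    linarith
  have hnat : ∀ (k : ℕ) (s : ℝ), 0 ≤ s → F (k * s) = k * F s := fun k s hs => by
    induction k with
    | zero => simp [h0]
    | succ k ih =>
      push_cast
      rw [add_mul, one_mul, hadd _ _ (by positivity) hs, ih]
      ring
  -- N t lies between consecutive integers, so by monotonicity F (N t) = N · F t differs from N t ·
  -- F 1 by at most F 1.
  have hbound : ∀ N : ℕ, (N : ℝ) * |F t - t * F 1| ≤ F 1 := fun N => by
    have h1 := hmono _ _ (by positivity) (Nat.floor_le (show 0 ≤ (N : ℝ) * t by positivity))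
    have h2 := hmono _ _ (by positivity) (Nat.lt_floor_add_one ((N : ℝ) * t)).le
    have h3 := hnat ⌊(N : ℝ) * t⌋₊ 1 zero_le_one
    have h4 := hnat (⌊(N : ℝ) * t⌋₊ + 1) 1 zero_le_one
    push_cast at h4
    rw [mul_one] at h3 h4
    rw [h3, hnat N t ht] at h1
    rw [h4, hnat N t ht] at h2
    have h5 := Nat.floor_le (show 0 ≤ (N : ℝ) * t by positivity)
    have h6 := (Nat.lt_floor_add_one ((N : ℝ) * t)).le
    have h7 := hpos 1 zero_le_one
    have h8 := mul_le_mul_of_nonneg_right h5 h7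
    have h9 := mul_le_mul_of_nonneg_right h6 h7
    rw [← abs_of_nonneg (Nat.cast_nonneg N : (0 : ℝ) ≤ N), ← abs_mul, abs_le]
    constructor <;> linarith
  by_contra hne
  have hpos' : 0 < |F t - t * F 1| := abs_pos.2 (sub_ne_zero.2 hne)
  obtain ⟨N, hN⟩ := exists_nat_gt (F 1 / |F t - t * F 1|)
  rw [div_lt_iff₀ hpos'] at hN
  linarith [hbound N]

lemma mem_cthickening_iff_exists {E : Type*} [NormedAddCommGroup E] {A : Set E} (hA : IsCompact A) {r : ℝ} (hr : 0 ≤ r) {x : E} :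
    x ∈ Metric.cthickening r A ↔ ∃ a ∈ A, ‖x - a‖ ≤ r := by
  rw [hA.cthickening_eq_biUnion_closedBall hr]
  simp [dist_eq_norm]

section Sweep

variable {E : Type*} [NormedAddCommGroup E] [InnerProductSpace ℝ E]

/-- The Minkowski sum of a set and the segment from `0` to `t • v`. -/
def sweep (A : Set E) (v : E) (t : ℝ) : Set E :=
  (fun p : E × ℝ => p.1 + p.2 • v) '' (A ×ˢ Set.Icc 0 t)

lemma mem_sweep {A : Set E} {v : E} {t : ℝ} {x : E} :
    x ∈ sweep A v t ↔ ∃ a ∈ A, ∃ τ, 0 ≤ τ ∧ τ ≤ t ∧ a + τ • v = x := by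
  simp only [sweep, Set.mem_image, Set.mem_prod, Set.mem_Icc, Prod.exists]
  constructor
  · rintro ⟨a, τ, ⟨ha, h0, h1⟩, h⟩
    exact ⟨a, ha, τ, h0, h1, h⟩
  · rintro ⟨a, ha, τ, h0, h1, h⟩
    exact ⟨a, τ, ⟨ha, h0, h1⟩, h⟩

lemma isCompact_sweep {A : Set E} (hA : IsCompact A) (v : E) (t : ℝ) : IsCompact (sweep A v t) :=
  (hA.prod isCompact_Icc).image (by fun_prop)

lemma convex_sweep {A : Set E} (hA : Convex ℝ A) (v : E) (t : ℝ) : Convex ℝ (sweep A v t) :=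
  (hA.prod (convex_Icc 0 t)).is_linear_image
    ⟨fun p q => by simp only [Prod.fst_add, Prod.snd_add, add_smul]; abel,
      fun c p => by simp only [Prod.smul_fst, Prod.smul_snd, smul_add, smul_smul, smul_eq_mul]⟩

lemma subset_sweep (A : Set E) (v : E) {t : ℝ} (ht : 0 ≤ t) : A ⊆ sweep A v t := fun a ha =>
  mem_sweep.2 ⟨a, ha, 0, le_rfl, ht, by simp⟩

lemma sweep_comm (A : Set E) (v w : E) (s t : ℝ) :
    sweep (sweep A v s) w t = sweep (sweep A w t) v s := by
  have : ∀ (v w : E) (s t : ℝ), sweep (sweep A v s) w t ⊆ sweep (sweep A w t) v s := by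
    intro v w s t x hx
    obtain ⟨y, hy, τ, h0, h1, rfl⟩ := mem_sweep.1 hx
    obtain ⟨a, ha, σ, g0, g1, rfl⟩ := mem_sweep.1 hy
    exact mem_sweep.2 ⟨a + τ • w, mem_sweep.2 ⟨a, ha, τ, h0, h1, rfl⟩, σ, g0, g1, by abel⟩
  exact (this v w s t).antisymm (this w v t s)

lemma sweep_add_eq_union {A : Set E} (v : E) {s t : ℝ} (hs : 0 ≤ s) (ht : 0 ≤ t) :
    sweep A v (s + t) = sweep A v s ∪ (fun x => s • v + x) '' sweep A v t := by
  ext x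
  constructor
  · intro hx
    obtain ⟨a, ha, τ, h0, h1, rfl⟩ := mem_sweep.1 hx
    rcases le_total τ s with h | h
    · exact Or.inl (mem_sweep.2 ⟨a, ha, τ, h0, h, rfl⟩)
    · refine Or.inr ⟨a + (τ - s) • v, mem_sweep.2 ⟨a, ha, τ - s, by linarith, by linarith, rfl⟩, ?_⟩
      simp only [sub_smul]; abel
  · rintro (hx | ⟨y, hy, rfl⟩)
    · obtain ⟨a, ha, τ, h0, h1, rfl⟩ := mem_sweep.1 hx
      exact mem_sweep.2 ⟨a, ha, τ, h0, by linarith, rfl⟩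
    · obtain ⟨a, ha, τ, h0, h1, rfl⟩ := mem_sweep.1 hy
      exact mem_sweep.2 ⟨a, ha, s + τ, by linarith, by linarith, by simp only [add_smul]; abel⟩

/-- If b + β • v equals a point a of A shifted back along v, it lies on the segment from b to a,
hence in A by convexity. Thus the overlap in `sweep_add_eq_union` is a translate of A, and the
volume gained by sweeping is additive in t. -/
lemma sweep_inter_eq {A : Set E} (hA : Convex ℝ A) (v : E) {s t : ℝ} (hs : 0 ≤ s) (ht : 0 ≤ t) :
    sweep A v s ∩ (fun x => s • v + x) '' sweep A v t = (fun x => s • v + x) '' A := by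
  ext x
  constructor
  · rintro ⟨hx, y, hy, rfl⟩
    obtain ⟨b, hb, β, hβ0, hβ1, rfl⟩ := mem_sweep.1 hy
    obtain ⟨a, ha, τ, h0, h1, hx⟩ := mem_sweep.1 hx
    refine ⟨b + β • v, ?_, rfl⟩
    rcases (show 0 ≤ (s - τ) + β by linarith).eq_or_lt with h | h
    · rw [show β = 0 by linarith]; simpa using hb
    have hab : b + β • v = (β / ((s - τ) + β)) • a + ((s - τ) / ((s - τ) + β)) • b := by
      have h2 : a = b + (s - τ + β) • v := by
        have : a = s • v + (b + β • v) - τ • v := by simp only at hx; rw [← hx]; abel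
        rw [this, add_smul, sub_smul]; abel
      rw [h2, smul_add, smul_smul, div_mul_cancel₀ _ h.ne', add_right_comm, ← add_smul, ← add_div,
        add_comm β, div_self h.ne', one_smul]
    rw [hab]
    exact hA ha hb (div_nonneg hβ0 h.le) (div_nonneg (by linarith) h.le) (by
      rw [← add_div, add_comm β, div_self h.ne'])
  · rintro ⟨a, ha, rfl⟩
    exact ⟨mem_sweep.2 ⟨a, ha, s, hs, le_rfl, add_comm _ _⟩, a, subset_sweep A v ht ha, rfl⟩

/-- The Minkowski sum of a set and the segments from `0` to `t • v`, for `v` in a list. -/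
def sweeps : List E → ℝ → Set E → Set E
  | [], _, A => A
  | v :: l, t, A => sweep (sweeps l t A) v t

lemma isCompact_sweeps (l : List E) (t : ℝ) {A : Set E} (hA : IsCompact A) :
    IsCompact (sweeps l t A) := by
  induction l with
  | nil => exact hA
  | cons v l ih => exact isCompact_sweep ih v t

lemma convex_sweeps (l : List E) (t : ℝ) {A : Set E} (hA : Convex ℝ A) :
    Convex ℝ (sweeps l t A) := by
  induction l with
  | nil => exact hA
  | cons v l ih => exact convex_sweep ih v t

lemma sweep_sweeps (l : List E) (t : ℝ) (A : Set E) (w : E) (s : ℝ) :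
    sweep (sweeps l t A) w s = sweeps l t (sweep A w s) := by
  induction l with
  | nil => rfl
  | cons v l ih => rw [sweeps, sweep_comm, ih]; rfl

/-- The support function of the sum of the segments from `0` to the elements of a list. -/
def segmentSupport (l : List E) (u : E) : ℝ := (l.map fun v => max 0 (inner ℝ v u : ℝ)).sum

lemma exists_mem_sweeps (l : List E) {t : ℝ} (ht : 0 ≤ t) {A : Set E} {k : E} (hk : k ∈ A)
    (u : E) : ∃ c ∈ sweeps l t A, inner ℝ c u = inner ℝ k u + t * segmentSupport l u := by
  induction l with
  | nil => exact ⟨k, hk, by simp [segmentSupport]⟩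
  | cons v l ih =>
    obtain ⟨c, hc, hcu⟩ := ih
    rcases le_total 0 (inner ℝ v u : ℝ) with h | h
    · refine ⟨c + t • v, mem_sweep.2 ⟨c, hc, t, ht, le_rfl, rfl⟩, ?_⟩
      simp only [segmentSupport, List.map_cons, List.sum_cons] at hcu ⊢
      rw [inner_add_left, real_inner_smul_left, hcu, max_eq_right h]
      ring
    · refine ⟨c, mem_sweep.2 ⟨c, hc, 0, le_rfl, ht, by simp⟩, ?_⟩
      simp only [segmentSupport, List.map_cons, List.sum_cons] at hcu ⊢
      rw [hcu, max_eq_left h]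
      ring

lemma inner_le_of_mem_sweeps (l : List E) {t : ℝ} {A : Set E} {c : E}
    (hc : c ∈ sweeps l t A) (u : E) :
    ∃ k ∈ A, inner ℝ c u ≤ inner ℝ k u + t * segmentSupport l u := by
  induction l generalizing c with
  | nil => exact ⟨c, hc, by simp [segmentSupport]⟩
  | cons v l ih =>
    obtain ⟨b, hb, τ, h0, h1, rfl⟩ := mem_sweep.1 hc
    obtain ⟨k, hk, h⟩ := ih hb
    refine ⟨k, hk, ?_⟩
    simp only [segmentSupport, List.map_cons, List.sum_cons] at h ⊢
    rw [inner_add_left, real_inner_smul_left, mul_add]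
    have h2 : τ * inner ℝ v u ≤ t * max 0 (inner ℝ v u : ℝ) :=
      (mul_le_mul_of_nonneg_left (le_max_right 0 (inner ℝ v u : ℝ)) h0).trans
        (mul_le_mul_of_nonneg_right h1 (le_max_left _ _))
    linarith

/-- Hahn–Banach: a closed convex set contains whatever its support function dominates. Inclusions
between parallel bodies and sums of segments thus become inequalities between support functions. -/
lemma subset_of_inner_le [CompleteSpace E] {C D : Set E} (hC : IsClosed C) (hC' : Convex ℝ C)
    (h : ∀ u, ∀ d ∈ D, ∃ c ∈ C, (inner ℝ d u : ℝ) ≤ inner ℝ c u) : D ⊆ C := by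
  intro d hd
  by_contra hdC
  obtain ⟨f, r, hf, hr⟩ := geometric_hahn_banach_closed_point hC' hC hdC
  obtain ⟨c, hc, hdc⟩ := h ((InnerProductSpace.toDual ℝ E).symm f) d hd
  rw [real_inner_comm, real_inner_comm _ c, InnerProductSpace.toDual_symm_apply,
    InnerProductSpace.toDual_symm_apply] at hdc
  linarith [hf c hc]

lemma exists_mem_closedBall_inner_eq {r : ℝ} (hr : 0 ≤ r) (u : E) :
    ∃ b : E, ‖b‖ ≤ r ∧ inner ℝ b u = r * ‖u‖ := by
  refine ⟨(r / ‖u‖) • u, ?_, ?_⟩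
  · rw [norm_smul, norm_div, norm_norm, Real.norm_of_nonneg hr]
    rcases eq_or_ne u 0 with rfl | hu
    · simpa using hr
    · rw [div_mul_cancel₀ _ (norm_ne_zero_iff.2 hu)]
  · rw [real_inner_smul_left, real_inner_self_eq_norm_sq]
    rcases eq_or_ne u 0 with rfl | hu
    · simp
    · have := norm_ne_zero_iff.2 hu
      field_simp

lemma cthickening_subset_sweeps [CompleteSpace E] {A : Set E} (hA : IsCompact A)
    (hA' : Convex ℝ A) (l : List E) {δ t : ℝ} (hδ : δ ≤ 1) (ht : 0 ≤ t)
    (hl : ∀ u, (1 - δ) * ‖u‖ ≤ segmentSupport l u) :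
    Metric.cthickening ((1 - δ) * t) A ⊆ sweeps l t A := by
  refine subset_of_inner_le (isCompact_sweeps l t hA).isClosed (convex_sweeps l t hA')
    fun u d hd => ?_
  obtain ⟨a, ha, hda⟩ := (mem_cthickening_iff_exists hA
    (mul_nonneg (by linarith) ht)).1 hd
  obtain ⟨c, hc, hcu⟩ := exists_mem_sweeps l ht ha u
  refine ⟨c, hc, ?_⟩
  rw [hcu]
  have h1 := real_inner_le_norm (d - a) u
  rw [inner_sub_left] at h1
  have h2 := mul_le_mul_of_nonneg_right hda (norm_nonneg u)
  have h3 := mul_le_mul_of_nonneg_left (hl u) ht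
  linarith

lemma sweeps_subset_cthickening [CompleteSpace E] {A : Set E} (hA : IsCompact A)
    (hA' : Convex ℝ A) (l : List E) {δ t : ℝ} (hδ : 0 ≤ 1 + δ) (ht : 0 ≤ t)
    (hl : ∀ u, segmentSupport l u ≤ (1 + δ) * ‖u‖) :
    sweeps l t A ⊆ Metric.cthickening ((1 + δ) * t) A := by
  refine subset_of_inner_le Metric.isClosed_cthickening (hA'.cthickening _) fun u c hc => ?_
  obtain ⟨k, hk, hcu⟩ := inner_le_of_mem_sweeps l hc u
  obtain ⟨b, hb, hbu⟩ := exists_mem_closedBall_inner_eq (mul_nonneg hδ ht) u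
  refine ⟨k + b, (mem_cthickening_iff_exists hA (mul_nonneg hδ ht)).2
    ⟨k, hk, by simpa using hb⟩, ?_⟩
  rw [inner_add_left, hbu]
  have h3 := mul_le_mul_of_nonneg_left (hl u) ht
  linarith

variable [FiniteDimensional ℝ E] [MeasurableSpace E] [BorelSpace E]

lemma volume_real_translate (c : E) (A : Set E) :
    (volume : Measure E).real ((fun x => c + x) '' A) = (volume : Measure E).real A := by
  rw [Set.image_add_left, Measure.real, measure_preimage_add, Measure.real]

lemma volume_real_sweep {A : Set E} (hA : IsCompact A) (hA' : Convex ℝ A) (v : E) {t : ℝ}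
    (ht : 0 ≤ t) : (volume : Measure E).real (sweep A v t) = (volume : Measure E).real A +
      t * ((volume : Measure E).real (sweep A v 1) - (volume : Measure E).real A) := by
  have h := eq_mul_of_additive
    (F := fun t => (volume : Measure E).real (sweep A v t) - (volume : Measure E).real A)
    (fun s t hs ht => by
      have hm : MeasurableSet ((fun x => s • v + x) '' sweep A v t) :=
        ((isCompact_sweep hA v t).image (by fun_prop)).measurableSet
      have h1 := measureReal_union_add_inter (μ := (volume : Measure E)) (s := sweep A v s) hm
        (isCompact_sweep hA v s).measure_lt_top.ne
        ((isCompact_sweep hA v t).image (by fun_prop)).measure_lt_top.ne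
      rw [← sweep_add_eq_union v hs ht, sweep_inter_eq hA' v hs ht, volume_real_translate,
        volume_real_translate] at h1
      linarith)
    (fun t ht => sub_nonneg.2 (measureReal_mono (subset_sweep A v ht)
      (isCompact_sweep hA v t).measure_lt_top.ne)) ht
  linarith

/-- Sweeping by one vector is affine in its time with coefficients vol(C) and vol(`sweep C v 1`),
where C = `sweeps l t A`. The unit sweep can be moved inside, so the induction hypothesis for A and
for `sweep A v 1` applies. -/
lemma exists_polynomial_volume_sweeps (l : List E) {A : Set E} (hA : IsCompact A)
    (hA' : Convex ℝ A) :
    ∃ p : Polynomial ℝ, ∀ t, 0 ≤ t → (volume : Measure E).real (sweeps l t A) = p.eval t := by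
  induction l generalizing A with
  | nil => exact ⟨Polynomial.C ((volume : Measure E).real A), fun t _ => by simp [sweeps]⟩
  | cons v l ih =>
    obtain ⟨p, hp⟩ := ih hA hA'
    obtain ⟨q, hq⟩ := ih (isCompact_sweep hA v 1) (convex_sweep hA' v 1)
    refine ⟨p + Polynomial.X * (q - p), fun t ht => ?_⟩
    rw [sweeps, volume_real_sweep (isCompact_sweeps l t hA) (convex_sweeps l t hA') v ht,
      sweep_sweeps, hp t ht, hq t ht]
    simp

end Sweep

/-! ### The Steiner formula -/

section Steiner

variable {E : Type*} [NormedAddCommGroup E] [InnerProductSpace ℝ E]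

lemma segmentSupport_append (l m : List E) (u : E) :
    segmentSupport (l ++ m) u = segmentSupport l u + segmentSupport m u := by
  simp [segmentSupport]

lemma segmentSupport_map_smul {c : ℝ} (hc : 0 ≤ c) (l : List E) (u : E) :
    segmentSupport (l.map (c • ·)) u = c * segmentSupport l u := by
  simp only [segmentSupport, List.map_map, ← List.sum_map_mul_left]
  congr 1
  refine List.map_congr_left fun v _ => ?_
  simp only [Function.comp_apply, real_inner_smul_left]
  rw [mul_max_of_nonneg _ _ hc, mul_zero]

lemma segmentSupport_smul_right (l : List E) {c : ℝ} (hc : 0 ≤ c) (u : E) :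
    segmentSupport l (c • u) = c * segmentSupport l u := by
  simp only [segmentSupport, ← List.sum_map_mul_left]
  congr 1
  refine List.map_congr_left fun v _ => ?_
  rw [real_inner_smul_right, mul_max_of_nonneg _ _ hc, mul_zero]

variable [FiniteDimensional ℝ E]

lemma isCompact_cthickening {A : Set E} (hA : IsCompact A) (t : ℝ) :
    IsCompact (Metric.cthickening t A) := by
  have : ProperSpace E := FiniteDimensional.proper ℝ _
  exact hA.cthickening

variable [MeasurableSpace E] [BorelSpace E]

lemma exists_integral_sphere_max_inner [Nontrivial E] :
    ∃ κ : ℝ, 0 < κ ∧ ∀ u : E, ∫ v : Metric.sphere (0 : E) 1, max 0 (inner ℝ (v : E) u : ℝ)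
      ∂(volume : Measure E).toSphere = κ * ‖u‖ := by
  refine ⟨Real.pi ^ (((Module.finrank ℝ E : ℝ) - 1) / 2) /
    Real.Gamma (((Module.finrank ℝ E : ℝ) + 1) / 2), ?_, fun u => ?_⟩
  · have := Real.pi_pos
    have hG : 0 < Real.Gamma (((Module.finrank ℝ E : ℝ) + 1) / 2) :=
      Real.Gamma_pos_of_pos (by positivity)
    positivity
  · have h1 := integral_sphere_abs_inner u
    have hc : Continuous fun v : E => max 0 (inner ℝ v u : ℝ) := by fun_prop
    have hc' : Continuous fun v : E => max 0 (inner ℝ (-v) u : ℝ) := by fun_prop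
    have h2 := integral_sphere_neg fun v : E => max 0 (inner ℝ v u : ℝ)
    have h3 := integral_add (integrable_sphere hc) (integrable_sphere hc')
    have h4 : ∀ v : Metric.sphere (0 : E) 1, max 0 (inner ℝ (v : E) u : ℝ) +
        max 0 (inner ℝ (-(v : E)) u : ℝ) = |inner ℝ u (v : E)| := fun v => by
      rw [inner_neg_left, real_inner_comm]
      rcases le_total 0 (inner ℝ u (v : E) : ℝ) with h | h
      · rw [max_eq_right h, max_eq_left (by linarith), abs_of_nonneg h, add_zero]
      · rw [max_eq_left h, max_eq_right (by linarith), abs_of_nonpos h, zero_add]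
    simp only [h4] at h3
    rw [h1, h2] at h3
    linear_combination (-1 / 2) * h3

/-- The Euclidean unit ball is approximated by sums of segments. -/
lemma exists_segmentSupport_approx [Nontrivial E] {δ : ℝ} (hδ : 0 < δ) :
    ∃ l : List E, ∀ u, |segmentSupport l u - ‖u‖| ≤ δ * ‖u‖ := by
  obtain ⟨κ, hκ, hint⟩ := exists_integral_sphere_max_inner (E := E)
  set S := Metric.sphere (0 : E) 1
  set σ := (volume : Measure E).toSphere with hσ
  have hne : NeZero σ := ⟨Measure.toSphere_ne_zero _⟩
  set Z : Set C(S, ℝ) := {g | ∃ l : List E, ∀ u : S, g u = segmentSupport l u} with hZ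
  have hZconv : Convex ℝ Z := by
    rintro g ⟨l, hl⟩ h ⟨m, hm⟩ a b ha hb -
    refine ⟨l.map (a • ·) ++ m.map (b • ·), fun u => ?_⟩
    rw [segmentSupport_append, segmentSupport_map_smul ha, segmentSupport_map_smul hb, ← hl, ← hm]
    simp
  have hcont : Continuous fun p : S × S => max 0 (inner ℝ (p.1 : E) (p.2 : E) : ℝ) := by fun_prop
  set Φ : C(S, C(S, ℝ)) := ContinuousMap.curry ⟨_, hcont⟩ with hΦ
  have hΦapp : ∀ v u : S, Φ v u = max 0 (inner ℝ (v : E) (u : E) : ℝ) := fun v u => rfl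
  have hΦint : Integrable Φ σ :=
    Φ.continuous.integrable_of_hasCompactSupport (HasCompactSupport.of_compactSpace _)
  -- The mean over v of the functions max(0, ⟨v, ·⟩) is constant on the sphere by rotation
  -- invariance. As the average of a C(S, ℝ)-valued function it lies in the closed convex set
  -- `closure Z`, so it is a uniform limit of support functions of sums of segments.
  have hmem : (⨍ v, Φ v ∂σ) ∈ closure Z :=
    hZconv.closure.average_mem isClosed_closure (.of_forall fun v => subset_closure
      ⟨[(v : E)], fun u => by simp [segmentSupport, hΦapp]⟩) hΦint
  set c : ℝ := κ / σ.real Set.univ with hc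
  have hω : 0 < σ.real Set.univ := measureReal_univ_pos
  have hc0 : 0 < c := div_pos hκ hω
  have hav : ∀ u : S, (⨍ v, Φ v ∂σ) u = c := fun u => by
    rw [average_eq, ContinuousMap.smul_apply, ContinuousMap.integral_apply hΦint]
    simp only [hΦapp]
    rw [hint u]
    simp only [hc, smul_eq_mul, norm_eq_of_mem_sphere, mul_one]
    field_simp
  obtain ⟨g, ⟨l, hl⟩, hg⟩ := Metric.mem_closure_iff.1 hmem (δ * c) (by positivity)
  refine ⟨l.map (c⁻¹ • ·), fun u => ?_⟩
  rw [segmentSupport_map_smul (inv_nonneg.2 hc0.le)]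
  rcases eq_or_ne u 0 with rfl | hu
  · simp [segmentSupport]
  have hu0 : 0 < ‖u‖ := norm_pos_iff.2 hu
  set w : S := ⟨‖u‖⁻¹ • u, by simp [S, norm_smul, hu0.ne']⟩ with hw
  have h1 : |c - segmentSupport l (w : E)| ≤ δ * c := by
    have h0 := (ContinuousMap.dist_apply_le_dist (f := ⨍ v, Φ v ∂σ) (g := g) w).trans hg.le
    rwa [hav, hl, Real.dist_eq] at h0
  have h2 : segmentSupport l u = ‖u‖ * segmentSupport l (w : E) := by
    rw [← segmentSupport_smul_right l hu0.le, hw, smul_smul, mul_inv_cancel₀ hu0.ne', one_smul]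
  rw [h2, show c⁻¹ * (‖u‖ * segmentSupport l (w : E)) - ‖u‖ =
    -(‖u‖ * c⁻¹ * (c - segmentSupport l (w : E))) by field_simp; ring, abs_neg, abs_mul,
    abs_of_nonneg (by positivity : 0 ≤ ‖u‖ * c⁻¹)]
  calc ‖u‖ * c⁻¹ * |c - segmentSupport l (w : E)| ≤ ‖u‖ * c⁻¹ * (δ * c) := by gcongr
    _ = δ * ‖u‖ := by field_simp

/-- The volume of the outer parallel body. -/
def parallelVolume (A : Set E) (t : ℝ) : ℝ := (volume : Measure E).real (Metric.cthickening t A)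

/-- The homothety of ratio r ≥ 1 centred at a point of A maps the t-parallel body onto a set
containing the (r t)-parallel body. This bounds the growth by degree d and absorbs the factors 1 ± δ
in the radius. -/
lemma parallelVolume_mul_le {A : Set E} (hA : IsCompact A) (hA' : Convex ℝ A) {r t : ℝ}
    (hr : 1 ≤ r) (ht : 0 ≤ t) :
    parallelVolume A (r * t) ≤ r ^ Module.finrank ℝ E * parallelVolume A t := by
  have : ProperSpace E := FiniteDimensional.proper ℝ _
  have hr0 : 0 < r := by linarith
  rcases A.eq_empty_or_nonempty with rfl | ⟨x, hx⟩
  · simp [parallelVolume]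
  have hsub : Metric.cthickening (r * t) A ⊆
      AffineMap.homothety x r '' Metric.cthickening t A := by
    intro y hy
    obtain ⟨a, ha, hya⟩ := (mem_cthickening_iff_exists hA (by positivity)).1 hy
    refine ⟨x + r⁻¹ • (y - x), (mem_cthickening_iff_exists hA ht).2
      ⟨(1 - r⁻¹) • x + r⁻¹ • a, ?_, ?_⟩, ?_⟩
    · have hr1 : r⁻¹ ≤ 1 := inv_le_one_of_one_le₀ hr
      exact hA' hx ha (by linarith) (by positivity) (by ring)
    · rw [show x + r⁻¹ • (y - x) - ((1 - r⁻¹) • x + r⁻¹ • a) = r⁻¹ • (y - a) by module,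
        norm_smul, Real.norm_of_nonneg (by positivity)]
      rw [inv_mul_le_iff₀ hr0]
      exact hya
    · rw [AffineMap.homothety_apply]
      simp [smul_smul, hr0.ne']
  have hcomp : IsCompact (AffineMap.homothety x r '' Metric.cthickening t A) :=
    hA.cthickening.image (by
      simp only [funext (AffineMap.homothety_apply x r)]
      simp only [vsub_eq_sub, vadd_eq_add]
      fun_prop)
  refine (measureReal_mono hsub hcomp.measure_lt_top.ne).trans_eq ?_
  rw [Measure.real, Measure.addHaar_image_homothety, ENNReal.toReal_mul,
    ENNReal.toReal_ofReal (abs_nonneg _), abs_of_nonneg (by positivity)]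
  rfl

lemma degree_le_of_eval_le {p : Polynomial ℝ} {C : ℝ} {d : ℕ}
    (hp : ∀ t, 1 ≤ t → |p.eval t| ≤ C * t ^ d) : p.degree ≤ d := by
  by_contra! hcon
  have h1 := p.abs_div_tendsto_atTop_atTop_of_degree_gt (Polynomial.X ^ d)
    (by rwa [Polynomial.degree_X_pow]) (pow_ne_zero _ Polynomial.X_ne_zero)
  have h2 := (h1.eventually_gt_atTop C).and (Filter.eventually_ge_atTop (1 : ℝ))
  obtain ⟨t, ht, ht1⟩ := h2.exists
  have htd : 0 < t ^ d := by positivity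
  rw [Polynomial.eval_pow, Polynomial.eval_X, abs_div, abs_of_pos htd, lt_div_iff₀ htd] at ht
  linarith [hp t ht1]

/-- The sum of segments lies between the balls of radii 1 - δ and 1 + δ, so the volume of A plus t
times this sum, a polynomial in t, lies between two parallel volumes. -/
lemma exists_polynomial_near_parallelVolume [Nontrivial E] [CompleteSpace E] {A : Set E} (hA : IsCompact A)
    (hA' : Convex ℝ A) {δ : ℝ} (hδ : 0 < δ) (hδ1 : δ < 1) :
    ∃ p : Polynomial ℝ, p.degree ≤ Module.finrank ℝ E ∧ ∀ t, 0 ≤ t →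
      (1 - δ) ^ Module.finrank ℝ E * parallelVolume A t ≤ p.eval t ∧
      p.eval t ≤ (1 + δ) ^ Module.finrank ℝ E * parallelVolume A t := by
  obtain ⟨l, hl⟩ := exists_segmentSupport_approx (E := E) hδ
  obtain ⟨p, hp⟩ := exists_polynomial_volume_sweeps l hA hA'
  have hlow : ∀ t, 0 ≤ t →
      (1 - δ) ^ Module.finrank ℝ E * parallelVolume A t ≤ p.eval t := by
    intro t ht
    have h1 := measureReal_mono (μ := (volume : Measure E)) (cthickening_subset_sweeps hA hA' l
      hδ1.le ht fun u => by linarith [(abs_le.1 (hl u)).1]) (isCompact_sweeps l t hA).measure_lt_top.ne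
    have hd : 0 < 1 - δ := by linarith
    have h2 := parallelVolume_mul_le hA hA' (one_le_inv₀ hd |>.2 (by linarith))
      (mul_nonneg hd.le ht)
    rw [← mul_assoc, inv_mul_cancel₀ hd.ne', one_mul] at h2
    rw [← hp t ht]
    refine le_trans ?_ h1
    calc (1 - δ) ^ Module.finrank ℝ E * parallelVolume A t
        ≤ (1 - δ) ^ Module.finrank ℝ E * ((1 - δ)⁻¹ ^ Module.finrank ℝ E *
          parallelVolume A ((1 - δ) * t)) := by gcongr
      _ = _ := by
        rw [← mul_assoc, ← mul_pow, mul_inv_cancel₀ hd.ne', one_pow, one_mul]; rfl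
  have hupp : ∀ t, 0 ≤ t →
      p.eval t ≤ (1 + δ) ^ Module.finrank ℝ E * parallelVolume A t := by
    intro t ht
    have h1 := measureReal_mono (μ := (volume : Measure E)) (sweeps_subset_cthickening hA hA' l
      (δ := δ) (by linarith) ht fun u => by linarith [(abs_le.1 (hl u)).2])
      (isCompact_cthickening hA _).measure_lt_top.ne
    rw [← hp t ht]
    exact h1.trans (parallelVolume_mul_le hA hA' (by linarith) ht)
  refine ⟨p, degree_le_of_eval_le (C := (1 + δ) ^ Module.finrank ℝ E * parallelVolume A 1)
    fun t ht => ?_, fun t ht => ⟨hlow t ht, hupp t ht⟩⟩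
  have ht0 : 0 ≤ t := by linarith
  rw [← hp t ht0, abs_of_nonneg measureReal_nonneg, hp t ht0, mul_assoc, mul_comm _ (t ^ _)]
  refine (hupp t ht0).trans ?_
  have := parallelVolume_mul_le hA hA' ht zero_le_one
  rw [mul_one] at this
  gcongr

/-- The volume of the outer parallel body is a polynomial in the distance. -/
lemma exists_polynomial_parallelVolume [Nontrivial E] [CompleteSpace E] {A : Set E} (hA : IsCompact A)
    (hA' : Convex ℝ A) :
    ∃ p : Polynomial ℝ, p.degree ≤ Module.finrank ℝ E ∧ ∀ t, 0 ≤ t →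
      parallelVolume A t = p.eval t := by
  set d := Module.finrank ℝ E
  set s := Finset.range (d + 1)
  set v : ℕ → ℝ := fun i => i
  have hv : Set.InjOn v s := fun i _ j _ h => by simpa [v] using h
  have hex : ∀ k : ℕ, ∃ p : Polynomial ℝ, p.degree ≤ d ∧ ∀ t, 0 ≤ t →
      (1 - 1 / ((k : ℝ) + 2)) ^ d * parallelVolume A t ≤ p.eval t ∧
      p.eval t ≤ (1 + 1 / ((k : ℝ) + 2)) ^ d * parallelVolume A t := fun k =>
    exists_polynomial_near_parallelVolume hA hA' (by positivity) (by
      rw [div_lt_one (by positivity)]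
      have : (0 : ℝ) ≤ k := Nat.cast_nonneg k
      linarith)
  choose p hpd hp using hex
  have hk : Filter.Tendsto (fun k : ℕ => 1 / ((k : ℝ) + 2)) Filter.atTop (nhds 0) := by
    have := (tendsto_one_div_add_atTop_nhds_zero_nat (𝕜 := ℝ)).comp (Filter.tendsto_add_atTop_nat 1)
    refine this.congr fun k => ?_
    simp only [Function.comp_apply]
    push_cast
    ring
  have hlim : ∀ t, 0 ≤ t → Filter.Tendsto (fun k => (p k).eval t) Filter.atTop
      (nhds (parallelVolume A t)) := fun t ht => by
    refine tendsto_of_tendsto_of_tendsto_of_le_of_le ?_ ?_ (fun k => (hp k t ht).1)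
      (fun k => (hp k t ht).2)
    · have := ((hk.const_sub 1).pow d).mul_const (parallelVolume A t)
      simpa using this
    · have := ((hk.const_add 1).pow d).mul_const (parallelVolume A t)
      simpa using this
  -- The approximating polynomials have degree at most d, so they are determined linearly by their
  -- values at 0, …, d; convergence there gives a limit that is again a polynomial of degree at most
  -- d.
  refine ⟨Lagrange.interpolate s v fun i => parallelVolume A (v i), ?_, fun t ht => ?_⟩
  · have := Lagrange.degree_interpolate_lt (fun i => parallelVolume A (v i)) hv
    rw [Finset.card_range] at this
    exact Polynomial.degree_le_iff_coeff_zero _ _ |>.2 fun m hm =>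
      Polynomial.coeff_eq_zero_of_degree_lt (this.trans_le (by exact_mod_cast hm))
  · refine tendsto_nhds_unique (hlim t ht) ?_
    have h1 : ∀ k, p k = Lagrange.interpolate s v fun i => (p k).eval (v i) := fun k =>
      Lagrange.eq_interpolate hv (by
        rw [Finset.card_range]
        exact lt_of_le_of_lt (hpd k) (by exact_mod_cast Nat.lt_succ_self d))
    have h2 : ∀ k, (p k).eval t = ∑ i ∈ s, (p k).eval (v i) * (Lagrange.basis s v i).eval t :=
      fun k => by
        conv_lhs => rw [h1 k]
        simp [Lagrange.interpolate_apply, Polynomial.eval_finsetSum]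
    simp only [h2, Lagrange.interpolate_apply, Polynomial.eval_finsetSum, Polynomial.eval_mul,
      Polynomial.eval_C]
    exact tendsto_finsetSum _ fun i _ => (hlim (v i) (Nat.cast_nonneg i)).mul_const _

end Steiner

theorem exists_steinerFormula {n : ℕ} (hn : n ≠ 0) (K : ConvexBody (EuclideanSpace ℝ (Fin n))) :
    ∃ W, SteinerFormula K W := by
  have hdim : Module.finrank ℝ (EuclideanSpace ℝ (Fin n)) = n := finrank_euclideanSpace_fin
  have : Nontrivial (EuclideanSpace ℝ (Fin n)) :=
    Module.nontrivial_of_finrank_pos (R := ℝ) (by omega)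
  obtain ⟨p, hpd, hp⟩ := exists_polynomial_parallelVolume K.isCompact K.convex
  rw [hdim] at hpd
  refine ⟨fun k => p.coeff k / n.choose k, fun ε hε => ?_⟩
  have h := hp ε hε
  unfold parallelVolume at h
  rw [outerParallelBody, h, Polynomial.eval_eq_sum_range' (n := n + 1)
    (Nat.lt_succ_of_le (Polynomial.natDegree_le_of_degree_le hpd))]
  refine Finset.sum_congr rfl fun k hk => ?_
  have : (n.choose k : ℝ) ≠ 0 := by
    exact_mod_cast (Nat.choose_pos (Finset.mem_range_succ_iff.1 hk)).ne'
  field_simp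

/-! ### The first-order term of the volume and the quermassintegral of index n - 1 -/

lemma linear_coeff_eq_zero {a b C s₀ : ℝ} (hs₀ : 0 < s₀)
    (h : ∀ s, 0 < s → s ≤ s₀ → |a + b * s| ≤ C * s ^ 2) : b = 0 := by
  have hev : ∀ᶠ s in nhdsWithin (0 : ℝ) (Set.Ioi 0), 0 < s ∧ s ≤ s₀ := by
    filter_upwards [Ioc_mem_nhdsGT hs₀] with s hs using hs
  have hlim : ∀ f : ℝ → ℝ, Continuous f →
      Filter.Tendsto f (nhdsWithin (0 : ℝ) (Set.Ioi 0)) (nhds (f 0)) := fun f hf =>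
    (hf.tendsto 0).mono_left nhdsWithin_le_nhds
  have ha : a = 0 := by
    have := le_of_tendsto_of_tendsto (hlim (fun s => |a + b * s|) (by fun_prop))
      (hlim (fun s => C * s ^ 2) (by fun_prop)) (hev.mono fun s hs => h s hs.1 hs.2)
    simpa using this
  subst ha
  have := le_of_tendsto_of_tendsto (hlim (fun _ => |b|) (by fun_prop))
    (hlim (fun s => C * s) (by fun_prop)) (hev.mono fun s hs => by
      have := h s hs.1 hs.2
      rw [zero_add, abs_mul, abs_of_pos hs.1] at this
      have hs0 := hs.1
      nlinarith)
  simpa using this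

/-- An upper counterpart of Bernoulli's inequality; 3 ^ n is a crude constant that survives the
induction. -/
lemma one_add_pow_le {x : ℝ} (hx : |x| ≤ 1) (n : ℕ) : (1 + x) ^ n ≤ 1 + n * x + 3 ^ n * x ^ 2 := by
  obtain ⟨h1, h2⟩ := abs_le.1 hx
  induction n with
  | zero => simp; positivity
  | succ n ih =>
    have h3 : (n : ℝ) ≤ 3 ^ n := by
      have h4 : n < 3 ^ n := Nat.lt_pow_self (by norm_num)
      exact_mod_cast h4.le
    have h5 := mul_le_mul_of_nonneg_left ih (show 0 ≤ 1 + x by linarith)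
    have h6 : (0 : ℝ) < 3 ^ n := by positivity
    rw [pow_succ']
    push_cast
    rw [pow_succ]
    refine h5.trans ?_
    nlinarith [mul_nonneg (sub_nonneg.2 h3) (sq_nonneg x),
      mul_nonneg (mul_nonneg h6.le (sq_nonneg x)) (sub_nonneg.2 h2)]

section StarShaped

variable {E : Type*} [NormedAddCommGroup E] [InnerProductSpace ℝ E] [FiniteDimensional ℝ E]
  [MeasurableSpace E] [BorelSpace E] [Nontrivial E]

/-- The volume of a star-shaped set in terms of its radial function. -/
lemma volume_real_star {ρ : E → ℝ} (hρ : Continuous ρ) (hpos : ∀ u, ‖u‖ = 1 → 0 < ρ u) :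
    (volume : Measure E).real {x | x ≠ 0 ∧ ‖x‖ < ρ (‖x‖⁻¹ • x)} =
      (∫ u : Metric.sphere (0 : E) 1, ρ u ^ Module.finrank ℝ E ∂(volume : Measure E).toSphere) /
        Module.finrank ℝ E := by
  have hd : 0 < Module.finrank ℝ E := Module.finrank_pos
  set T : Set (Metric.sphere (0 : E) 1 × Set.Ioi (0 : ℝ)) := {p | (p.2 : ℝ) < ρ p.1} with hT
  have hTm : MeasurableSet T := (isOpen_lt (by fun_prop) (by fun_prop)).measurableSet
  have h1 : (volume : Measure E) {x | x ≠ 0 ∧ ‖x‖ < ρ (‖x‖⁻¹ • x)} =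
      (volume : Measure E).toSphere.prod (.volumeIoiPow (Module.finrank ℝ E - 1)) T := by
    rw [← (volume : Measure E).measurePreserving_homeomorphUnitSphereProd.measure_preimage
      hTm.nullMeasurableSet, comap_subtype_coe_apply (measurableSet_singleton _).compl]
    congr 1
    ext x
    simp only [Set.mem_ofPred_eq, Set.mem_image, Set.mem_preimage, hT, Subtype.exists,
      Set.mem_compl_iff, Set.mem_singleton_iff, homeomorphUnitSphereProd_apply_snd_coe,
      homeomorphUnitSphereProd_apply_fst_coe]
    constructor
    · rintro ⟨h, h'⟩
      exact ⟨x, h, h', rfl⟩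
    · rintro ⟨y, hy, hy', rfl⟩
      exact ⟨hy, hy'⟩
  have h2 : ∀ u : Metric.sphere (0 : E) 1,
      (Measure.volumeIoiPow (Module.finrank ℝ E - 1)) (Prod.mk u ⁻¹' T) =
        ENNReal.ofReal (ρ u ^ Module.finrank ℝ E / Module.finrank ℝ E) := fun u => by
    have hu := hpos u (by simp)
    have : Prod.mk u ⁻¹' T = Set.Iio (⟨ρ u, hu⟩ : Set.Ioi (0 : ℝ)) := by
      ext r
      simp [hT, ← Subtype.coe_lt_coe]
    rw [this, Measure.volumeIoiPow_apply_Iio, Nat.sub_add_cancel hd, Nat.cast_sub hd]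
    simp
  rw [Measure.real, h1, Measure.prod_apply hTm]
  simp only [h2]
  have hc : Continuous fun u : E => ρ u ^ Module.finrank ℝ E / Module.finrank ℝ E := by fun_prop
  rw [← ofReal_integral_eq_lintegral_ofReal (integrable_sphere hc) (.of_forall fun u => by
    have := hpos u (by simp)
    positivity), integral_div, ENNReal.toReal_ofReal]
  refine div_nonneg (integral_nonneg fun u => ?_) (Nat.cast_nonneg _)
  have := hpos u (by simp)
  positivity

end StarShaped

section Quermass

open scoped Pointwise

variable {n : ℕ} {K : ConvexBody (EuclideanSpace ℝ (Fin n))}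

lemma mem_smul_cthickening_iff {s : ℝ} (hs : 0 < s) {x : EuclideanSpace ℝ (Fin n)} :
    x ∈ s • Metric.cthickening s⁻¹ (K : Set (EuclideanSpace ℝ (Fin n))) ↔
      ∃ k ∈ K, ‖x - s • k‖ ≤ 1 := by
  rw [Set.mem_smul_set_iff_inv_smul_mem₀ hs.ne',
    mem_cthickening_iff_exists K.isCompact (inv_nonneg.2 hs.le)]
  refine exists_congr fun k => and_congr Iff.rfl ?_
  rw [← inv_smul_smul₀ hs.ne' k, ← smul_sub, norm_smul, Real.norm_of_nonneg (by positivity),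
    inv_smul_smul₀ hs.ne', ← div_eq_inv_mul, div_le_iff₀ hs, inv_mul_cancel₀ hs.ne']

lemma abs_supportFunction_le {R : ℝ} (hR : ∀ x ∈ K, ‖x‖ ≤ R) {u : EuclideanSpace ℝ (Fin n)}
    (hu : ‖u‖ = 1) : |supportFunction K u| ≤ R := by
  obtain ⟨k, hk, h⟩ := exists_supportFunction_eq K u
  rw [h]
  have := abs_real_inner_le_norm k u
  rw [hu, mul_one] at this
  exact this.trans (hR k hk)

/-- Let k maximize ⟨·, u⟩ on K and put τ = s h_K(u), q = sR. Then ‖x - s k‖² ≤ (‖x‖ - τ)² - τ² + q²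
≤ (1 - q²)² + q² ≤ 1. -/
lemma subset_smul_cthickening {R s : ℝ} (hR0 : 0 ≤ R) (hR : ∀ x ∈ K, ‖x‖ ≤ R) (hs : 0 < s)
    (hsR : s * R ≤ 1 / 2) :
    {x : EuclideanSpace ℝ (Fin n) | x ≠ 0 ∧
      ‖x‖ < 1 + (s * supportFunction K (‖x‖⁻¹ • x) - s ^ 2 * R ^ 2)} ⊆
      s • Metric.cthickening s⁻¹ (K : Set (EuclideanSpace ℝ (Fin n))) := by
  rintro x ⟨hx, hlt⟩
  have hx0 : 0 < ‖x‖ := norm_pos_iff.2 hx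
  set u := ‖x‖⁻¹ • x with hu
  have hu1 : ‖u‖ = 1 := by rw [hu, norm_smul, norm_inv, norm_norm, inv_mul_cancel₀ hx0.ne']
  have hxu : x = ‖x‖ • u := by rw [hu, smul_smul, mul_inv_cancel₀ hx0.ne', one_smul]
  obtain ⟨k, hk, h⟩ := exists_supportFunction_eq K u
  have hb := abs_le.1 (abs_supportFunction_le hR hu1)
  refine (mem_smul_cthickening_iff hs).2 ⟨k, hk, ?_⟩
  have hsq : ‖x - s • k‖ ^ 2 = ‖x‖ ^ 2 - 2 * (‖x‖ * (s * supportFunction K u)) +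
      s ^ 2 * ‖k‖ ^ 2 := by
    rw [norm_sub_sq_real, real_inner_smul_right, norm_smul, mul_pow, Real.norm_eq_abs, sq_abs, h]
    conv_lhs => rw [hxu]
    rw [real_inner_smul_left, real_inner_comm k u, norm_smul, norm_norm, hu1, mul_one]
    ring
  set t := s * supportFunction K u with ht
  have ht1 : |t| ≤ s * R := by
    rw [ht, abs_mul, abs_of_pos hs]
    exact mul_le_mul_of_nonneg_left (abs_supportFunction_le hR hu1) hs.le
  obtain ⟨ht2, ht3⟩ := abs_le.1 ht1
  have hk2 : s ^ 2 * ‖k‖ ^ 2 ≤ (s * R) ^ 2 := by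
    rw [mul_pow]
    have := hR k hk
    gcongr
  have hq : s ^ 2 * R ^ 2 = (s * R) ^ 2 := by ring
  rw [hq] at hlt
  set q := s * R
  have hq0 : 0 ≤ q := by positivity
  have h1 : (‖x‖ - t) ^ 2 ≤ (1 - q ^ 2) ^ 2 := by
    apply sq_le_sq'
    · nlinarith
    · linarith
  have h2 : ‖x - s • k‖ ^ 2 ≤ 1 := by
    rw [hsq]
    have h4 : q ^ 2 ≤ 1 := by nlinarith
    nlinarith [sq_nonneg t, sq_nonneg q]
  exact (sq_le_one_iff₀ (norm_nonneg _)).1 h2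

lemma smul_cthickening_subset {s : ℝ} (hs : 0 < s) :
    s • Metric.cthickening s⁻¹ (K : Set (EuclideanSpace ℝ (Fin n))) ⊆
    {x : EuclideanSpace ℝ (Fin n) | x ≠ 0 ∧
      ‖x‖ < 1 + (s * supportFunction K (‖x‖⁻¹ • x) + s ^ 2)} ∪ {0} := by
  intro x hx
  by_cases hx0 : x = 0
  · exact Or.inr hx0
  refine Or.inl ⟨hx0, ?_⟩
  obtain ⟨k, hk, hxk⟩ := (mem_smul_cthickening_iff hs).1 hx
  have hx1 : 0 < ‖x‖ := norm_pos_iff.2 hx0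
  set u := ‖x‖⁻¹ • x with hu
  have hu1 : ‖u‖ = 1 := by rw [hu, norm_smul, norm_inv, norm_norm, inv_mul_cancel₀ hx1.ne']
  have hxu : inner ℝ x u = ‖x‖ := by
    rw [hu, real_inner_smul_right, real_inner_self_eq_norm_sq]
    field_simp
  have h1 := real_inner_le_norm (x - s • k) u
  rw [hu1, mul_one, inner_sub_left, real_inner_smul_left, hxu] at h1
  have h2 := mul_le_mul_of_nonneg_left (inner_le_supportFunction hk u) hs.le
  -- The term s² only makes the inequality strict.
  have : 0 < s ^ 2 := by positivity
  linarith

/-- The quantity s ^ n · `parallelVolume K s⁻¹` is the volume of B + sK. By the two inclusions this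
set lies, up to the origin, between star-shaped sets with radial functions 1 + s h_K + O(s²), and n
times the volume of such a set is the integral of the n-th power of its radial function. -/
lemma exists_parallelVolume_estimate [Nontrivial (EuclideanSpace ℝ (Fin n))]
    (K : ConvexBody (EuclideanSpace ℝ (Fin n))) :
    ∃ C s₀ : ℝ, 0 < s₀ ∧ s₀ ≤ 1 ∧ ∀ s, 0 < s → s ≤ s₀ →
      |n * (s ^ n * parallelVolume (K : Set (EuclideanSpace ℝ (Fin n))) s⁻¹) -
        (volume : Measure (EuclideanSpace ℝ (Fin n))).toSphere.real Set.univ -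
        n * s * ∫ u : Metric.sphere (0 : EuclideanSpace ℝ (Fin n)) 1, supportFunction K u
          ∂(volume : Measure (EuclideanSpace ℝ (Fin n))).toSphere| ≤ C * s ^ 2 := by
  have hdim : Module.finrank ℝ (EuclideanSpace ℝ (Fin n)) = n := finrank_euclideanSpace_fin
  have hn : 0 < n := hdim ▸ Module.finrank_pos
  have hn' : (0 : ℝ) < n := by exact_mod_cast hn
  obtain ⟨R, hR0, hR⟩ := exists_norm_le_of_mem K
  have hcont := continuous_supportFunction K
  set σ := (volume : Measure (EuclideanSpace ℝ (Fin n))).toSphere with hσ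
  set ω := σ.real Set.univ with hω
  have hω0 : 0 ≤ ω := measureReal_nonneg
  set H := ∫ u : Metric.sphere (0 : EuclideanSpace ℝ (Fin n)) 1, supportFunction K u ∂σ with hH
  set c := (n : ℝ) * R ^ 2 + n + 3 ^ n * (R + 1) ^ 2 with hc
  refine ⟨c * ω, 1 / (2 * (R + 1)), by positivity, ?_, fun s hs hs₀ => ?_⟩
  · rw [div_le_one (by positivity)]; linarith
  rw [le_div_iff₀ (by positivity)] at hs₀
  have hsR : s * R ≤ 1 / 2 := by nlinarith
  have hs1 : s ≤ 1 / 2 := by nlinarith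
  have hcl : ∀ a b : ℝ, Continuous fun u => a + b * supportFunction K u := fun a b => by fun_prop
  have hlin : ∀ a b : ℝ, ∫ u : Metric.sphere (0 : EuclideanSpace ℝ (Fin n)) 1,
      (a + b * supportFunction K u) ∂σ = a * ω + b * H := fun a b => by
    rw [integral_add (integrable_const _) ((integrable_sphere hcont).const_mul b),
      integral_const_mul, integral_const, smul_eq_mul]
    ring
  have hvol : (volume : Measure (EuclideanSpace ℝ (Fin n))).real
      (s • Metric.cthickening s⁻¹ (K : Set (EuclideanSpace ℝ (Fin n)))) =
      s ^ n * parallelVolume (K : Set (EuclideanSpace ℝ (Fin n))) s⁻¹ := by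
    rw [Measure.real, Measure.addHaar_smul_of_nonneg _ hs.le, hdim, ENNReal.toReal_mul,
      ENNReal.toReal_ofReal (by positivity)]
    rfl
  have hbound : ∀ u : EuclideanSpace ℝ (Fin n), ‖u‖ = 1 → |s * supportFunction K u| ≤ s * R :=
    fun u hu => by
      rw [abs_mul, abs_of_pos hs]
      exact mul_le_mul_of_nonneg_left (abs_supportFunction_le hR hu) hs.le
  set ρ₁ : EuclideanSpace ℝ (Fin n) → ℝ :=
    fun u => 1 + (s * supportFunction K u - s ^ 2 * R ^ 2) with hρ₁
  set ρ₂ : EuclideanSpace ℝ (Fin n) → ℝ :=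
    fun u => 1 + (s * supportFunction K u + s ^ 2) with hρ₂
  have hc₁ : Continuous ρ₁ := by fun_prop
  have hc₂ : Continuous ρ₂ := by fun_prop
  have hlow₁ := volume_real_star hc₁ (fun u hu => by
    have := abs_le.1 (hbound u hu)
    simp only [hρ₁]
    nlinarith)
  have hupp₁ := volume_real_star hc₂ (fun u hu => by
    have := abs_le.1 (hbound u hu)
    simp only [hρ₂]
    nlinarith)
  rw [hdim] at hlow₁ hupp₁
  have hTfin : (volume : Measure (EuclideanSpace ℝ (Fin n)))
      (s • Metric.cthickening s⁻¹ (K : Set (EuclideanSpace ℝ (Fin n)))) ≠ ⊤ :=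
    ((isCompact_cthickening K.isCompact s⁻¹).smul s).measure_lt_top.ne
  have hlow : (∫ u : Metric.sphere (0 : EuclideanSpace ℝ (Fin n)) 1, ρ₁ u ^ n ∂σ) / n ≤
      s ^ n * parallelVolume (K : Set (EuclideanSpace ℝ (Fin n))) s⁻¹ := by
    rw [← hvol, ← hlow₁]
    exact measureReal_mono (subset_smul_cthickening hR0 hR hs hsR) hTfin
  have hufin : (volume : Measure (EuclideanSpace ℝ (Fin n)))
      ({x | x ≠ 0 ∧ ‖x‖ < ρ₂ (‖x‖⁻¹ • x)} ∪ {0}) ≠ ⊤ := by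
    refine ((measure_mono (t := Metric.closedBall (0 : EuclideanSpace ℝ (Fin n)) 2) ?_).trans_lt
      (isCompact_closedBall _ _).measure_lt_top).ne
    rintro x (⟨hx, hlt⟩ | rfl)
    · have hx1 : ‖x‖ ≠ 0 := norm_ne_zero_iff.2 hx
      have := abs_le.1 (hbound (‖x‖⁻¹ • x) (by
        rw [norm_smul, norm_inv, norm_norm, inv_mul_cancel₀ hx1]))
      rw [mem_closedBall_zero_iff]
      simp only [hρ₂] at hlt
      nlinarith
    · simp
  have hupp : s ^ n * parallelVolume (K : Set (EuclideanSpace ℝ (Fin n))) s⁻¹ ≤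
      (∫ u : Metric.sphere (0 : EuclideanSpace ℝ (Fin n)) 1, ρ₂ u ^ n ∂σ) / n := by
    rw [← hvol, ← hupp₁]
    refine (measureReal_mono (smul_cthickening_subset hs) hufin).trans
      ((measureReal_union_le _ _).trans_eq ?_)
    rw [measureReal_def (s := {0}), measure_singleton, ENNReal.toReal_zero, add_zero]
  have hint₁ : (1 - n * (s ^ 2 * R ^ 2)) * ω + (n * s) * H ≤
      ∫ u : Metric.sphere (0 : EuclideanSpace ℝ (Fin n)) 1, ρ₁ u ^ n ∂σ := by
    rw [← hlin]
    refine integral_mono (integrable_sphere (hcl _ _))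
      (integrable_sphere (F := fun u => ρ₁ u ^ n) (by fun_prop)) fun u => ?_
    have h1 := abs_le.1 (hbound u (by simp))
    have h2 := one_add_mul_le_pow (a := s * supportFunction K (u : EuclideanSpace ℝ (Fin n)) -
      s ^ 2 * R ^ 2) (by nlinarith) n
    simp only [hρ₁]
    linarith
  have hint₂ : ∫ u : Metric.sphere (0 : EuclideanSpace ℝ (Fin n)) 1, ρ₂ u ^ n ∂σ ≤
      (1 + (n * s ^ 2 + 3 ^ n * (s * (R + 1)) ^ 2)) * ω + (n * s) * H := by
    rw [← hlin]
    refine integral_mono (integrable_sphere (F := fun u => ρ₂ u ^ n) (by fun_prop))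
      (integrable_sphere (hcl _ _)) fun u => ?_
    have h1 := abs_le.1 (hbound u (by simp))
    set y := s * supportFunction K (u : EuclideanSpace ℝ (Fin n)) + s ^ 2 with hy
    have hy1 : |y| ≤ s * (R + 1) := abs_le.2 ⟨by nlinarith, by nlinarith⟩
    have h2 := one_add_pow_le (hy1.trans (by linarith)) n
    have h3 : y ^ 2 ≤ (s * (R + 1)) ^ 2 := by
      rw [← sq_abs y]
      gcongr
    have h4 := mul_le_mul_of_nonneg_left h3 (show (0 : ℝ) ≤ 3 ^ n by positivity)
    simp only [hρ₂]
    rw [← hy]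
    calc (1 + y) ^ n ≤ 1 + n * y + 3 ^ n * y ^ 2 := h2
      _ ≤ 1 + n * y + 3 ^ n * (s * (R + 1)) ^ 2 := by linarith
      _ = _ := by rw [hy]; ring
  rw [div_le_iff₀ hn'] at hlow
  rw [le_div_iff₀ hn'] at hupp
  have e1 : 0 ≤ (n : ℝ) * R ^ 2 * s ^ 2 * ω := by positivity
  have e2 : 0 ≤ (n : ℝ) * s ^ 2 * ω := by positivity
  have e3 : 0 ≤ 3 ^ n * (s * (R + 1)) ^ 2 * ω := by positivity
  have e4 : c * ω * s ^ 2 = (n : ℝ) * R ^ 2 * s ^ 2 * ω + n * s ^ 2 * ω +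
      3 ^ n * (s * (R + 1)) ^ 2 * ω := by rw [hc]; ring
  rw [e4, abs_le]
  constructor <;> linarith

theorem norm_eq_of_steinerFormula (hn : 2 ≤ n) {W : ℕ → ℝ} (hW : SteinerFormula K W) :
    ConvexCover.norm K = n * W (n - 1) := by
  have hdim : Module.finrank ℝ (EuclideanSpace ℝ (Fin n)) = n := finrank_euclideanSpace_fin
  have : Nontrivial (EuclideanSpace ℝ (Fin n)) :=
    Module.nontrivial_of_finrank_pos (R := ℝ) (by omega)
  rw [norm_eq_integral_supportFunction]
  obtain ⟨C, s₀, hs₀, hs₀1, hest⟩ := exists_parallelVolume_estimate K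
  set H := ∫ u : Metric.sphere (0 : EuclideanSpace ℝ (Fin n)) 1, supportFunction K u
    ∂(volume : Measure (EuclideanSpace ℝ (Fin n))).toSphere
  set ω := (volume : Measure (EuclideanSpace ℝ (Fin n))).toSphere.real Set.univ
  obtain ⟨m, rfl⟩ := Nat.exists_eq_add_of_le' hn
  set c : ℕ → ℝ := fun j => ((m + 2).choose j : ℝ) * W (m + 2 - j) with hc
  -- Substituting ε = 1/s and multiplying by s ^ n reverses the Steiner polynomial, so W (n - 1)
  -- appears in the coefficient of s.
  have hG : ∀ s, 0 < s → s ^ (m + 2) *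
      parallelVolume (K : Set (EuclideanSpace ℝ (Fin (m + 2)))) s⁻¹ =
      ∑ j ∈ Finset.range (m + 2 + 1), c j * s ^ j := fun s hs => by
    have h := hW s⁻¹ (inv_nonneg.2 hs.le)
    rw [outerParallelBody] at h
    rw [parallelVolume, h, Finset.mul_sum, ← Finset.sum_flip]
    refine Finset.sum_congr rfl fun j hj => ?_
    have hj' : j ≤ m + 2 := Finset.mem_range_succ_iff.1 hj
    rw [Nat.choose_symm hj', inv_pow]
    have : s ^ (m + 2) = s ^ (m + 2 - j) * s ^ j := by rw [← pow_add, Nat.sub_add_cancel hj']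
    rw [this]
    simp only [hc]
    field_simp
  set D := ∑ j ∈ Finset.range (m + 1), |c (j + 1 + 1)| with hD
  have hb := linear_coeff_eq_zero (a := ((m + 2 : ℕ) : ℝ) * c 0 - ω)
    (b := ((m + 2 : ℕ) : ℝ) * c 1 - ((m + 2 : ℕ) : ℝ) * H)
    (C := C + ((m + 2 : ℕ) : ℝ) * D) hs₀ (fun s hs hss => by
      have h1 := hest s hs hss
      rw [hG s hs, Finset.sum_range_succ', Finset.sum_range_succ'] at h1
      have h2 : |∑ j ∈ Finset.range (m + 1), c (j + 1 + 1) * s ^ (j + 1 + 1)| ≤ D * s ^ 2 := by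
        refine (Finset.abs_sum_le_sum_abs _ _).trans ?_
        rw [hD, Finset.sum_mul]
        refine Finset.sum_le_sum fun j _ => ?_
        rw [abs_mul, abs_of_pos (by positivity : 0 < s ^ (j + 1 + 1))]
        have : s ^ (j + 1 + 1) ≤ s ^ 2 := pow_le_pow_of_le_one hs.le (hss.trans hs₀1) (by omega)
        gcongr
      set Q := ∑ j ∈ Finset.range (m + 1), c (j + 1 + 1) * s ^ (j + 1 + 1)
      have h3 : ((m + 2 : ℕ) : ℝ) * c 0 - ω +
          (((m + 2 : ℕ) : ℝ) * c 1 - ((m + 2 : ℕ) : ℝ) * H) * s =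
          (((m + 2 : ℕ) : ℝ) * (Q + c (0 + 1) * s ^ (0 + 1) + c 0 * s ^ 0) - ω -
            ((m + 2 : ℕ) : ℝ) * s * H) - ((m + 2 : ℕ) : ℝ) * Q := by
        simp only [zero_add, pow_one, pow_zero]
        ring
      rw [h3]
      refine (abs_sub _ _).trans ?_
      rw [abs_mul, abs_of_nonneg (Nat.cast_nonneg (m + 2) : (0 : ℝ) ≤ ((m + 2 : ℕ) : ℝ))]
      have h4 := mul_le_mul_of_nonneg_left h2
        (Nat.cast_nonneg (m + 2) : (0 : ℝ) ≤ ((m + 2 : ℕ) : ℝ))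
      linarith)
  have hm : ((m + 2 : ℕ) : ℝ) ≠ 0 := by positivity
  have h5 : c 1 = H := mul_left_cancel₀ hm (sub_eq_zero.1 hb)
  rw [← h5, hc]
  simp

end Quermass

end ConvexCover

end

theorem theorem2 (n : ℕ) (hn : 2 ≤ n)
    (K : ConvexBody (EuclideanSpace ℝ (Fin n)))
    (a b : ℝ) (hab : a ≤ b) (φ : ℝ → EuclideanSpace ℝ (Fin n))
    (hφ : ContinuousOn φ (Set.Icc a b))
    (hK : (K : Set (EuclideanSpace ℝ (Fin n))) ⊆ convexHull ℝ (φ '' Set.Icc a b)) :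
    ConvexCover.SteinerFormula K (ConvexCover.quermassintegral K) ∧
    ConvexCover.norm K = (n : ℝ) * ConvexCover.quermassintegral K (n - 1) ∧
    ((ConvexCover.norm K : ℝ) : EReal) ≤
      ((Real.pi ^ (((n : ℝ) - 1) / 2) / (2 * Real.Gamma (((n : ℝ) + 1) / 2)) : ℝ) : EReal) *
          ((eVariationOn φ (Set.Icc a b) : ENNReal) : EReal) +
        ((Real.pi ^ ((n : ℝ) / 2 - 1) / Real.Gamma ((n : ℝ) / 2) *
          Metric.diam (K : Set (EuclideanSpace ℝ (Fin n))) : ℝ) : EReal) := by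
  have hW : ConvexCover.SteinerFormula K (ConvexCover.quermassintegral K) := by
    have h := ConvexCover.exists_steinerFormula (by omega : n ≠ 0) K
    unfold ConvexCover.quermassintegral
    rw [dif_pos h]
    exact h.choose_spec
  refine ⟨hW, ConvexCover.norm_eq_of_steinerFormula hn hW, ?_⟩
  -- For infinite length the right-hand side is ⊤, since the coefficient of the length is strictly
  -- positive.
  by_cases htop : eVariationOn φ (Set.Icc a b) = ⊤
  · have hG : 0 < Real.Gamma (((n : ℝ) + 1) / 2) := Real.Gamma_pos_of_pos (by positivity)
    have hc : 0 < Real.pi ^ (((n : ℝ) - 1) / 2) / (2 * Real.Gamma (((n : ℝ) + 1) / 2)) := by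
      positivity
    rw [htop, EReal.coe_ennreal_top, EReal.coe_mul_top_of_pos hc, EReal.top_add_coe]
    exact le_top
  · rw [← ENNReal.ofReal_toReal htop, EReal.coe_ennreal_ofReal,
      max_eq_left ENNReal.toReal_nonneg]
    exact_mod_cast ConvexCover.norm_le_of_eVariationOn_ne_top hn K hK htop
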